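/- **Setting.** Let $\Lambda=\Lambda_0\oplus\Lambda_1$ be the Grassmann algebra over $\mathbb C$ on an infinite set of generators. Superfunctions are $u(x,\theta)=u^0(x)+\theta u^1(x)$ with $u^0,u^1\in C^\infty(\mathbb R/2\pi\mathbb Z)\otimes\Lambda$ and $\theta$ odd, $\theta^2=0$; put $D_\theta=\partial/\partial\theta+\theta\,\partial/\partial x$, so $D_\theta^2=\partial=\partial/\partial x$. Let $\mathcal G$ be the space of even operators $a=\sum_{j\le M}a_jD_\theta^j$ (the superfunction $a_j$ has the parity of $j$) with their associative product and commutator, $a_+=\sum_{j\ge 0}a_jD_\theta^j$, $a_-=a-a_+$, $\mathcal R a=(a_+-a_-)/2$, $[a,b]_{\mathcal R}=[\mathcal Ra,b]+[a,\mathcal Rb]$, and $(a,b)=\int dx\,d\theta\ (a\circ b)_{-1}$ (Berezin integral of the coefficient at $D_\theta^{-1}$). For $X\in\mathcal G$, $X_+u$ is the action of the differential operator $X_+$ on a superfunction $u$, and $X_+^*$ is its formal adjoint, $\int dx\,d\theta\,(X_+u)v=\int dx\,d\theta\,u\,(X_+^*v)$. Fix $m\ge 1$, $N\ge 0$, $n\ge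 0$. The extended phase space $\mathcal G^*\oplus W^{2N|2N}$ consists of $z=(l,f_i,\Phi_i^*,f_i^*,\Phi_i)_{i=1}^N$, where $l=\partial^m+\sum_{j<2m}l_jD_\theta^j$ is even, $f_i,\Phi_i^*$ are even smooth superfunctions, and $f_i^*,\Phi_i$ are odd smooth superfunctions; tangent vectors have $\delta l=\sum_{j<2m}\delta l_jD_\theta^j$ even and field components of the same parities. Put $\langle u,v\rangle=(1,uD_\theta^{-1}v)=(-1)^{p(v)}\int dx\,d\theta\,uv$, $p(v)$ being the parity of $v$. A gradient of a functional $F$ at $z$ consists of $\delta F/\delta l\in\mathcal G$, odd superfunctions $\delta F/\delta f_i,\ \delta F/\delta\Phi_i^*$ and even superfunctions $\delta F/\delta f_i^*,\ \delta F/\delta\Phi_i$ with $$\delta F=\Big(\frac{\delta F}{\delta l},\delta l\Big)+\sum_{i=1}^N\Big(\Big\langle\delta f_i,\frac{\delta F}{\delta f_i}\Big\rangle+\Big\langle\frac{\delta F}{\delta\Phi_i^*},\delta\Phi_i^*\Big\rangle+\Big\langle\frac{\delta F}{\delta f_i^*},\delta f_i^*\Big\rangle+\Big\langle\delta\Phi_i,\frac{\delta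 F}{\delta\Phi_i}\Big\rangle\Big)$$ for all tangent vectors. For a functional of $l$ alone the gradient $\nabla F(l)\in\mathcal G$ is defined by $\delta F=(\nabla F(l),\delta l)$. Let $\gamma_n(l)=\frac1{n+1}(l^{1/m},l^{n/m})$, where $l^{1/m}=\partial+\dots$ is the even monic $m$-th root of $l$. Let $\tilde{\mathcal L}=\tilde\Theta\otimes\tilde J$ act on gradients at $\tilde z$ by $$\tilde\Theta:\ X\mapsto[\tilde l,X_+]-[\tilde l,X]_+ ,\qquad \tilde J:\ \Big(\frac{\delta F}{\delta f_i},\frac{\delta F}{\delta\Phi_i^*},\frac{\delta F}{\delta f_i^*},\frac{\delta F}{\delta\Phi_i}\Big)\mapsto\Big(-\frac{\delta F}{\delta f_i^*},\frac{\delta F}{\delta\Phi_i},\frac{\delta F}{\delta f_i},-\frac{\delta F}{\delta\Phi_i^*}\Big).$$ **Theorem 1.** (a) The bracket $[\cdot,\cdot]_{\mathcal R}$ satisfies the Jacobi identity and $(\tilde l,[a,b]_{\mathcal R})=(\tilde\Theta a,b)$ for all $a,b,\tilde l\in\mathcal G$; and $\omega(\tilde JG,h)$ equals the pairing of $G$ with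 $h$ displayed above (field part), where $\omega(h,k)=\sum_i\int dx\,d\theta\,\big[(h_{f_i}k_{f_i^*}-k_{f_i}h_{f_i^*})-(h_{\Phi_i}k_{\Phi_i^*}-k_{\Phi_i}h_{\Phi_i^*})\big]$ is the odd symplectic form $\sum_i(f_i\wedge f_i^*-\Phi_i\wedge\Phi_i^*)$. (b) The root $l^{1/m}$ exists and is unique, and $\gamma_n$ is a Casimir functional: at every $l$ it has a gradient with $[l,\nabla\gamma_n(l)]=0$. (c) Let $B$ be the Bäcklund transformation $$B:(\tilde l,f_i,\Phi_i^*,f_i^*,\Phi_i)\mapsto\Big(l=\tilde l+\sum_{i=1}^N\big(f_iD_\theta^{-1}f_i^*+\Phi_iD_\theta^{-1}\Phi_i^*\big),\,f_i,\Phi_i^*,f_i^*,\Phi_i\Big),$$ and regard $\gamma_n$, evaluated at $l=l(\tilde z)$, as a functional of $\tilde z$. The Hamiltonian system $d\tilde z/dt_n=-\tilde{\mathcal L}\nabla\gamma_n$, i.e. $$\frac{d\tilde l}{dt_n}=\Big[\Big(\frac{\delta\gamma_n}{\delta\tilde l}\Big)_+,\tilde l\Big]-\Big[\frac{\delta\gamma_n}{\delta\tilde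 l},\tilde l\Big]_+,\quad\frac{d\tilde f_i}{dt_n}=\frac{\delta\gamma_n}{\delta\tilde f_i^*},\quad\frac{d\tilde\Phi_i^*}{dt_n}=-\frac{\delta\gamma_n}{\delta\tilde\Phi_i},\quad\frac{d\tilde f_i^*}{dt_n}=-\frac{\delta\gamma_n}{\delta\tilde f_i},\quad\frac{d\tilde\Phi_i}{dt_n}=\frac{\delta\gamma_n}{\delta\tilde\Phi_i^*},$$ and the extended Lax system $$\frac{dl}{dt_n}=[(\nabla\gamma_n(l))_+,l],\quad\frac{df_i}{dt_n}=(\nabla\gamma_n(l))_+f_i,\quad\frac{d\Phi_i}{dt_n}=(\nabla\gamma_n(l))_+\Phi_i,\quad\frac{df_i^*}{dt_n}=-(\nabla\gamma_n(l))_+^*f_i^*,\quad\frac{d\Phi_i^*}{dt_n}=-(\nabla\gamma_n(l))_+^*\Phi_i^*$$ are well-defined vector fields on the extended phase space (gradients exist, the right-hand sides do not depend on their choice, and they are tangent). $B$ is a bijection of the extended phase space onto itself, and the two systems are equivalent via $B$: a curve $\tilde z(t)$ in the phase space is smooth and satisfies the Hamiltonian system at a time $t$ if and only if the curve $B(\tilde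 z(t))$ is smooth and satisfies the extended Lax system at $t$. -/

import Mathlib

namespace SuperLax

noncomputable section

open scoped TensorProduct ContDiff

/-! ### Superfunctions on the super-circle -/

/-- The Grassmann algebra over `ℂ` with one generator for each element of `ι`. -/
abbrev Grass (ι : Type*) : Type _ := ExteriorAlgebra ℂ (ι →₀ ℂ)

/-- Smooth complex functions on `ℝ / 2πℤ`, as a subalgebra of all functions `ℝ → ℂ`. -/
def smoothCircle : Subalgebra ℂ (ℝ → ℂ) where
  carrier := {φ | ContDiff ℝ ∞ φ ∧ Function.Periodic φ (2 * Real.pi)}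
  mul_mem' := fun ha hb => ⟨ha.1.mul hb.1, ha.2.mul hb.2⟩
  add_mem' := fun ha hb => ⟨ha.1.add hb.1, ha.2.add hb.2⟩
  algebraMap_mem' := fun _ => ⟨contDiff_const, fun _ => rfl⟩

/-- The derivative `∂ = d/dx` on smooth functions on the circle. -/
def circleDeriv : smoothCircle →ₗ[ℂ] smoothCircle where
  toFun φ := ⟨deriv φ.1, (contDiff_infty_iff_deriv.1 φ.2.1).2, fun x => by
    have h : (fun y => φ.1 (y + 2 * Real.pi)) = φ.1 := funext φ.2.2
    rw [← deriv_comp_add_const, h]⟩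
  map_add' φ ψ := by
    ext x
    exact deriv_add (φ.2.1.differentiable (by simp) x) (ψ.2.1.differentiable (by simp) x)
  map_smul' c φ := by
    ext x
    exact deriv_const_smul c (φ.2.1.differentiable (by simp) x)

/-- The integral over a period. -/
def circleIntegral : smoothCircle →ₗ[ℂ] ℂ where
  toFun φ := ∫ x in (0 : ℝ)..(2 * Real.pi), φ.1 x
  map_add' φ ψ := intervalIntegral.integral_add
    (φ.2.1.continuous.intervalIntegrable _ _) (ψ.2.1.continuous.intervalIntegrable _ _)
  map_smul' c _ := intervalIntegral.integral_smul c _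

/-- Smooth functions on the circle with values in the Grassmann algebra,
`C^∞(𝕊¹) ⊗ Λ` (each of them involves finitely many Grassmann monomials). -/
abbrev GrassFun (ι : Type*) : Type _ := smoothCircle ⊗[ℂ] Grass ι

instance (ι : Type*) : Ring (GrassFun ι) := Algebra.TensorProduct.instRing

/-- The parity automorphism of `C^∞(𝕊¹) ⊗ Λ`: `+1` on even and `-1` on odd elements. -/
def parG (ι : Type*) : GrassFun ι →ₐ[ℂ] GrassFun ι :=
  Algebra.TensorProduct.map (AlgHom.id ℂ smoothCircle) CliffordAlgebra.involute

/-- `d/dx` on `C^∞(𝕊¹) ⊗ Λ`. -/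
def derivG (ι : Type*) : GrassFun ι →ₗ[ℂ] GrassFun ι := circleDeriv.rTensor (Grass ι)

/-- Superfunctions `u(x, θ) = u⁰(x) + θ u¹(x)`, stored as the pair `(u⁰, u¹)`. -/
def SF (ι : Type*) : Type _ := GrassFun ι × GrassFun ι

namespace SF

variable {ι : Type*}

instance : AddCommGroup (SF ι) := inferInstanceAs (AddCommGroup (GrassFun ι × GrassFun ι))
instance : Module ℂ (SF ι) := inferInstanceAs (Module ℂ (GrassFun ι × GrassFun ι))

/-- `(a⁰ + θ a¹)(b⁰ + θ b¹) = a⁰ b⁰ + θ (a¹ b⁰ + σ(a⁰) b¹)`, since `a⁰ θ = θ σ(a⁰)` and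
`θ² = 0`, where `σ` is the parity automorphism. -/
instance : Mul (SF ι) := ⟨fun a b => (a.1 * b.1, a.2 * b.1 + parG ι a.1 * b.2)⟩

instance : One (SF ι) := ⟨((1 : GrassFun ι), (0 : GrassFun ι))⟩

/-- The parity automorphism of superfunctions (`θ` is odd). -/
def par (a : SF ι) : SF ι := (parG ι a.1, -parG ι a.2)

/-- A superfunction of parity `p mod 2` (`p = 0`: even, `p = 1`: odd). -/
def HasParity (p : ℤ) (a : SF ι) : Prop := if Even p then par a = a else par a = -a

/-- The superderivative `D_θ = ∂/∂θ + θ ∂/∂x`. -/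
def D (a : SF ι) : SF ι := (a.2, derivG ι a.1)

/-- The Berezin integral `∫ dx dθ`, with `∫ dθ θ = 1` and `∫ dθ 1 = 0`. -/
def berezin (a : SF ι) : Grass ι :=
  TensorProduct.lid ℂ (Grass ι) (circleIntegral.rTensor (Grass ι) a.2)

end SF

/-! ### Super-integro-differential operators -/

/-- Formal series `∑_j a_j D_θ^j` (coefficients on the left) with `a_j = 0` for large `j`. -/
def opSubmodule (ι : Type*) : Submodule ℂ (ℤ → SF ι) where
  carrier := {a | ∃ M : ℤ, ∀ j, M < j → a j = 0}
  zero_mem' := ⟨0, fun _ _ => rfl⟩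
  add_mem' := by
    rintro a b ⟨M, hM⟩ ⟨K, hK⟩
    refine ⟨max M K, fun j hj => ?_⟩
    rw [Pi.add_apply, hM j (lt_of_le_of_lt (le_max_left _ _) hj),
      hK j (lt_of_le_of_lt (le_max_right _ _) hj), add_zero]
  smul_mem' := by
    rintro c a ⟨M, hM⟩
    refine ⟨M, fun j hj => ?_⟩
    rw [Pi.smul_apply, hM j hj, smul_zero]

/-- Super-integro-differential operators `∑_{j ≤ M} a_j D_θ^j`. -/
def Op (ι : Type*) : Type _ := opSubmodule ι

namespace Op

variable {ι : Type*}

instance : AddCommGroup (Op ι) := inferInstanceAs (AddCommGroup (opSubmodule ι))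
instance : Module ℂ (Op ι) := inferInstanceAs (Module ℂ (opSubmodule ι))

/-- The coefficient `a_j` at `D_θ^j`. -/
def coeff (a : Op ι) (j : ℤ) : SF ι := a.1 j

/-- The super-binomial coefficients: `0` if `k` is even and `j` odd, and the binomial
coefficient of `⌊k/2⌋` over `⌊j/2⌋` otherwise. -/
def superChoose (k : ℤ) (j : ℕ) : ℤ :=
  if Even k ∧ Odd j then 0 else Ring.choose (k / 2) (j / 2)

/-- The coefficient of `D_θ^{k-j}` in
`D_θ^k ∘ u = ∑_{j ≥ 0} [k over j] (-1)^{p(u)(k-j)} (D_θ^j u) D_θ^{k-j}`. -/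
def leibniz (k : ℤ) (j : ℕ) (u : SF ι) : SF ι :=
  superChoose k j • SF.D^[j] (if Even (k - j) then u else u.par)

lemma SF_mul_zero (a : SF ι) : a * 0 = 0 :=
  Prod.ext (mul_zero a.1) (by
    show a.2 * (0 : GrassFun ι) + parG ι a.1 * (0 : GrassFun ι) = 0
    rw [mul_zero, mul_zero, add_zero])

lemma SF_zero_mul (a : SF ι) : 0 * a = 0 :=
  Prod.ext (zero_mul a.1) (by
    show (0 : GrassFun ι) * a.1 + parG ι (0 : GrassFun ι) * a.2 = 0
    rw [map_zero, zero_mul, zero_mul, add_zero])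

lemma SF_par_zero : SF.par (0 : SF ι) = 0 :=
  Prod.ext (map_zero (parG ι)) (by
    show -parG ι (0 : GrassFun ι) = 0
    rw [map_zero]
    exact neg_zero (G := GrassFun ι))

lemma SF_D_zero : SF.D (0 : SF ι) = 0 := Prod.ext rfl (map_zero (derivG ι))

lemma leibniz_zero (k : ℤ) (j : ℕ) : leibniz k j (0 : SF ι) = 0 := by
  have h : SF.D^[j] (0 : SF ι) = 0 := Function.iterate_fixed SF_D_zero j
  simp [leibniz, SF_par_zero, h]

/-- The associative product of operators. The coefficient of `D_θ^r` collects the terms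
`a_i D_θ^i ∘ b_l D_θ^l` with `i + l - j = r`, a finite sum. -/
instance : Mul (Op ι) := ⟨fun a b =>
  ⟨fun r => ∑ᶠ p : ℤ × ℕ, a.coeff p.1 * leibniz p.1 p.2 (b.coeff (r - p.1 + p.2)), by
    obtain ⟨M, hM⟩ := a.2
    obtain ⟨K, hK⟩ := b.2
    refine ⟨M + K, fun r hr => finsum_eq_zero_of_forall_eq_zero fun p => ?_⟩
    by_cases h : M < p.1
    · have : a.coeff p.1 = 0 := hM _ h
      rw [this, SF_zero_mul]
    · have : b.coeff (r - p.1 + p.2) = 0 := hK _ (by omega)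
      rw [this, leibniz_zero, SF_mul_zero]⟩⟩

/-- The monomial `u D_θ^k`. -/
def mono (u : SF ι) (k : ℤ) : Op ι :=
  ⟨fun j => if j = k then u else 0, k, fun _ hj => if_neg hj.ne'⟩

instance : One (Op ι) := ⟨mono 1 0⟩

/-- Powers `a^k`, `k ∈ ℕ`. -/
def pow (a : Op ι) : ℕ → Op ι
  | 0 => 1
  | k + 1 => pow a k * a

/-- Even operators: the coefficient `a_j` has the parity of `j`. -/
def IsEven (a : Op ι) : Prop := ∀ j, (a.coeff j).HasParity j

/-- Even monic operators `∂^m + ∑_{j < 2m} a_j D_θ^j`. -/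
def IsMonic (m : ℕ) (a : Op ι) : Prop :=
  a.IsEven ∧ a.coeff (2 * m) = 1 ∧ ∀ j : ℤ, 2 * m < j → a.coeff j = 0

/-- Variations of monic operators of order `m`: even operators `∑_{j < 2m} a_j D_θ^j`. -/
def IsVariation (m : ℕ) (a : Op ι) : Prop :=
  a.IsEven ∧ ∀ j : ℤ, 2 * m ≤ j → a.coeff j = 0

/-- The projection `P_+` onto differential operators. -/
def pos (a : Op ι) : Op ι :=
  ⟨fun j => if 0 ≤ j then a.coeff j else 0, by
    obtain ⟨M, hM⟩ := a.2
    refine ⟨M, fun j hj => ?_⟩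
    have : a.coeff j = 0 := hM j hj
    simp [this]⟩

/-- The projection `P_-`. -/
def neg (a : Op ι) : Op ι := a - a.pos

/-- The commutator. -/
def comm (a b : Op ι) : Op ι := a * b - b * a

/-- The endomorphism `R = (P_+ - P_-)/2`. -/
def R (a : Op ι) : Op ι := (1 / 2 : ℂ) • (a.pos - a.neg)

/-- The `R`-deformed commutator `[a, b]_R = [R a, b] + [a, R b]`. -/
def commR (a b : Op ι) : Op ι := comm (R a) b + comm a (R b)

/-- The bilinear form `(a, b) = ∫ dx dθ res (a ∘ b)`, where `res a = a_{-1}`. -/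
def form (a b : Op ι) : Grass ι := ((a * b).coeff (-1)).berezin

/-- The action `X_+ u = ∑_{j ≥ 0} X_j D_θ^j u` of the differential part on a superfunction. -/
def actPos (X : Op ι) (u : SF ι) : SF ι := ∑ᶠ j : ℕ, X.coeff j * SF.D^[j] u

/-- The action of the formal adjoint `(X_+)^*`, given by
`(a D_θ^j)^* v = (-1)^{j(j+1)/2} (-1)^{p(a) j} D_θ^j (a v)`; for even `X` one has
`∫ dx dθ (X_+ u) v = ∫ dx dθ u (X_+^* v)`. -/
def adjPos (X : Op ι) (v : SF ι) : SF ι :=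
  ∑ᶠ j : ℕ, (-1 : ℤ) ^ (j * (j + 1) / 2) •
    SF.D^[j] ((if Even j then X.coeff j else (X.coeff j).par) * v)

/-- The operator `u D_θ^{-1} v`. -/
def dyad (u v : SF ι) : Op ι := mono u 0 * mono 1 (-1) * mono v 0

/-- The pairing of a superfunction `u` (of type `f` or `Φ`) with a superfunction `v` of the dual
type (`f^*` or `Φ^*`), `⟨u, v⟩ = (1, u D_θ^{-1} v) = (-1)^{p(v)} ∫ dx dθ u v`, so that
`⟨X_+ u, v⟩ = (X, u D_θ^{-1} v)` for even operators `X`. -/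
def pair (u v : SF ι) : Grass ι := form 1 (dyad u v)

/-- `P` is an `m`-th root `l^{1/m} = ∂ + ...` of `l`. -/
def IsRoot (m : ℕ) (l P : Op ι) : Prop := P.IsMonic 1 ∧ P.pow m = l

open Classical in
/-- The root `l^{1/m}`. -/
def root (m : ℕ) (l : Op ι) : Op ι := if h : ∃ P, IsRoot m l P then h.choose else 0

/-- The Casimir functionals `γ_n(l) = (l^{1/m}, l^{n/m}) / (n + 1)`. -/
def gamma (m n : ℕ) (l : Op ι) : Grass ι :=
  (1 / ((n : ℂ) + 1)) • form (root m l) ((root m l).pow n)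

end Op

/-! ### Gradients -/

/-- The function `g` with values in the Grassmann algebra has derivative `v` at `ε = 0`
(tested on all linear functionals). -/
def HasVariation {ι : Type*} (g : ℝ → Grass ι) (v : Grass ι) : Prop :=
  ∀ φ : Module.Dual ℂ (Grass ι), HasDerivAt (fun ε => φ (g ε)) (φ v) 0

/-- `X` is a gradient `∇F(l)` of a functional `F` of monic operators of order `m`:
`δF(l) = (X, δl)`. -/
def IsOpGradient {ι : Type*} (m : ℕ) (F : Op ι → Grass ι) (l X : Op ι) : Prop :=
  X.IsEven ∧ ∀ h : Op ι, h.IsVariation m →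
    HasVariation (fun ε => F (l + (ε : ℂ) • h)) (Op.form X h)

/-- The components `(l, f_i, Φ_i^*, f_i^*, Φ_i)` of points, of tangent vectors, and of gradients
on the extended phase space. -/
@[ext]
structure ExtSpace (ι : Type*) (N : ℕ) where
  l : Op ι
  f : Fin N → SF ι
  Phis : Fin N → SF ι
  fs : Fin N → SF ι
  Phi : Fin N → SF ι

namespace ExtSpace

variable {ι : Type*} {N : ℕ}

instance : Neg (ExtSpace ι N) := ⟨fun z => ⟨-z.l, -z.f, -z.Phis, -z.fs, -z.Phi⟩⟩

/-- The point `z + ε h`. -/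
def shift (z h : ExtSpace ι N) (ε : ℝ) : ExtSpace ι N :=
  ⟨z.l + (ε : ℂ) • h.l, z.f + (ε : ℂ) • h.f, z.Phis + (ε : ℂ) • h.Phis,
    z.fs + (ε : ℂ) • h.fs, z.Phi + (ε : ℂ) • h.Phi⟩

/-- `f_i`, `Φ_i^*` are even, `f_i^*`, `Φ_i` are odd. -/
def HasFieldParities (z : ExtSpace ι N) : Prop :=
  ∀ i, (z.f i).HasParity 0 ∧ (z.Phis i).HasParity 0 ∧
    (z.fs i).HasParity 1 ∧ (z.Phi i).HasParity 1

/-- Points of the extended phase space, with Lax operators of order `m`. -/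
def IsPoint (m : ℕ) (z : ExtSpace ι N) : Prop := z.l.IsMonic m ∧ z.HasFieldParities

/-- Tangent vectors of the extended phase space. -/
def IsTangent (m : ℕ) (h : ExtSpace ι N) : Prop := h.l.IsVariation m ∧ h.HasFieldParities

/-- Cotangent vectors: components `(δγ/δl, δγ/δf_i, δγ/δΦ_i^*, δγ/δf_i^*, δγ/δΦ_i)`; each field
component has the parity opposite to that of the variable. -/
def IsCovector (G : ExtSpace ι N) : Prop :=
  G.l.IsEven ∧ ∀ i, (G.f i).HasParity 1 ∧ (G.Phis i).HasParity 1 ∧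
    (G.fs i).HasParity 0 ∧ (G.Phi i).HasParity 0

/-- The pairing of the field components of a cotangent vector with those of a tangent vector. -/
def fieldPair (G h : ExtSpace ι N) : Grass ι :=
  ∑ i, (Op.pair (h.f i) (G.f i) + Op.pair (G.Phis i) (h.Phis i) +
    Op.pair (G.fs i) (h.fs i) + Op.pair (h.Phi i) (G.Phi i))

/-- `G` is a gradient of the functional `F` at `z`:
`δF = (δF/δl, δl) + ∑_i (⟨δf_i, δF/δf_i⟩ + ...)`. -/
def IsGradient (m : ℕ) (F : ExtSpace ι N → Grass ι) (z G : ExtSpace ι N) : Prop :=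
  G.IsCovector ∧ ∀ h : ExtSpace ι N, h.IsTangent m →
    HasVariation (fun ε => F (z.shift h ε)) (Op.form G.l h.l + fieldPair G h)

/-! ### Poisson structures -/

/-- The Lie-Poisson structure `Θ : X ↦ [l, X_+] - [l, X]_+`. -/
def Theta (l X : Op ι) : Op ι := Op.comm l X.pos - (Op.comm l X).pos

/-- The tensor product `Θ ⊗ J` at the point `z`: it acts as `Θ` on the operator component, and as
`J : (δ/δf, δ/δΦ^*, δ/δf^*, δ/δΦ) ↦ (-δ/δf^*, δ/δΦ, δ/δf, -δ/δΦ^*)` on the fields. -/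
def poissonL (z G : ExtSpace ι N) : ExtSpace ι N := ⟨Theta z.l G.l, -G.fs, G.Phi, G.f, -G.Phis⟩

/-- The odd symplectic form `∑_i (f_i ∧ f_i^* - Φ_i ∧ Φ_i^*)` on tangent vectors. -/
def omega (h k : ExtSpace ι N) : Grass ι :=
  ∑ i, ((h.f i * k.fs i - k.f i * h.fs i) - (h.Phi i * k.Phis i - k.Phi i * h.Phis i)).berezin

/-! ### The Bäcklund transformation and the two dynamical systems -/

/-- `(l, f, Φ^*, f^*, Φ) ↦ (l + ∑_i (f_i D_θ^{-1} f_i^* + Φ_i D_θ^{-1} Φ_i^*), f, Φ^*, f^*, Φ)`. -/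
def backlund (z : ExtSpace ι N) : ExtSpace ι N :=
  ⟨z.l + ∑ i, (Op.dyad (z.f i) (z.fs i) + Op.dyad (z.Phi i) (z.Phis i)),
    z.f, z.Phis, z.fs, z.Phi⟩

/-- The Hamiltonian: `γ_n` evaluated at the operator component of the transformed point. -/
def hamiltonian (m n : ℕ) (z : ExtSpace ι N) : Grass ι := Op.gamma m n (backlund z).l

/-- `v` is the value at `z` of the Hamiltonian vector field `-(Θ ⊗ J) ∇F`. -/
def IsHamiltonianVector (m : ℕ) (F : ExtSpace ι N → Grass ι) (z v : ExtSpace ι N) : Prop :=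
  ∃ G, IsGradient m F z G ∧ v = -poissonL z G

/-- `w` is the value at `z` of the Lax flow `dl/dt_n = [∇γ_n(l)_+, l]`, extended by the evolutions
of eigenfunctions `du/dt_n = ∇γ_n(l)_+ u` (`u = f_i, Φ_i`) and of adjoint eigenfunctions
`du/dt_n = -∇γ_n(l)_+^* u` (`u = f_i^*, Φ_i^*`). -/
def IsLaxVector (m n : ℕ) (z w : ExtSpace ι N) : Prop :=
  ∃ X, IsOpGradient m (Op.gamma m n) z.l X ∧
    w = ⟨Op.comm X.pos z.l, fun i => X.actPos (z.f i), fun i => -X.adjPos (z.Phis i),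
      fun i => -X.adjPos (z.fs i), fun i => X.actPos (z.Phi i)⟩

/-- The curve `u` in `C^∞(𝕊¹) ⊗ Λ` is smooth near the time `t` and has derivative `v` there. -/
def HasGrassVelocity (u : ℝ → GrassFun ι) (v : GrassFun ι) (t : ℝ) : Prop :=
  ∃ (k : ℕ) (c : Fin k → ℝ → smoothCircle) (d : Fin k → smoothCircle) (w : Fin k → Grass ι),
    (∀ i, ContDiff ℝ ∞ (fun p : ℝ × ℝ => (c i p.1).1 p.2)) ∧
    (∀ i x, HasDerivAt (fun s => (c i s).1 x) ((d i).1 x) t) ∧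
    (∀ᶠ s in nhds t, u s = ∑ i, c i s ⊗ₜ[ℂ] w i) ∧ v = ∑ i, d i ⊗ₜ[ℂ] w i

/-- The same for curves of superfunctions. -/
def HasSFVelocity (u : ℝ → SF ι) (v : SF ι) (t : ℝ) : Prop :=
  HasGrassVelocity (fun s => (u s).1) v.1 t ∧ HasGrassVelocity (fun s => (u s).2) v.2 t

/-- The same for curves in the extended phase space. -/
def HasVelocity (c : ℝ → ExtSpace ι N) (v : ExtSpace ι N) (t : ℝ) : Prop :=
  (∀ j, HasSFVelocity (fun s => (c s).l.coeff j) (v.l.coeff j) t) ∧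
  ∀ i, HasSFVelocity (fun s => (c s).f i) (v.f i) t ∧
    HasSFVelocity (fun s => (c s).Phis i) (v.Phis i) t ∧
    HasSFVelocity (fun s => (c s).fs i) (v.fs i) t ∧
    HasSFVelocity (fun s => (c s).Phi i) (v.Phi i) t

end ExtSpace

end

end SuperLax

open SuperLax

/-!
The proof has three ingredients.

*The algebra of operators.* Write `T k` for the map `b ↦ D_θ^k ∘ b` given by the super-Leibniz rule.
Pascal's rule for the super-binomial coefficients says that `T (k + 1) b` is obtained from `T k b` by
the map `a ↦ D_θ ∘ a`, `(D_θ ∘ a)_r = D a_r + σ(a_{r-1})` (`dOp`), which is injective. The product is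
`a * b = ∑_i a_i (T i b)`, so `D_θ ∘ (b * c) = (D_θ ∘ b) * c` gives `T k (b * c) = T k b * c` for all
`k ∈ ℤ`, and this is associativity. Even operators are the fixed points of an automorphism `parOp`,
and they may be rotated through the supertrace `tr a = ∫ dx dθ a_{-1}` (`IsEven.isTracial`): it is
enough to check this for `D_θ`, where the difference is a total superderivative, and for
superfunctions, where it is supercommutativity. The statements on `[·, ·]_R` follow formally from the
splitting into the subalgebras of differential and of integral operators.

*The Casimir functionals.* The coefficients of the root `P = l^{1/m}` are found recursively, and so
are those of `P⁻¹`. Along a curve `l(ε)` the root is again differentiable, by the same recursion, and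
rotating factors through the trace gives `δγ_n = tr (P^n δP) = tr (X δl)` with
`X = (1/m) P^{n+1-m}` (`hasVariation_gamma`). This `X` commutes with `l`. Conversely the trace form
determines the coefficients `X_j`, `j ≥ -2m`, of a gradient. This uses that the Berezin pairing is
nondegenerate on superfunctions of a fixed parity (`SF.eq_zero_of_berezin_mul`), which needs infinitely
many Grassmann generators: a generator not occurring in `w` detects `w`. Coefficients of lower order
affect neither `X_+` nor `Θ(X)`.

*The Bäcklund transformation.* Modulo differential operators
`X_+ ∘ u D_θ^{-1} v = (X_+ u) D_θ^{-1} v` and `u D_θ^{-1} v ∘ X_+ = u D_θ^{-1} (X_+^* v)`. Taking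
residues, `(X, u D_θ^{-1} v) = ⟨X_+ u, v⟩ = ⟨u, X_+^* v⟩`, which with the chain rule yields the gradient
of the Hamiltonian. Moreover the integral part of `[X_+, ∑ (f D_θ^{-1} f^* + Φ D_θ^{-1} Φ^*)]` is the
derivative of that sum along the flow of the fields, and since `[X, l] = 0` this is exactly what turns
`[X_+, l̃] - [X, l̃]_+` into `[X_+, l]` (`backlundDeriv_hamiltonian`).
-/

namespace SuperLax

noncomputable section

open scoped TensorProduct ContDiff

/-! ### The ring of superfunctions -/

section GrassFun

variable {ι : Type*}

lemma parG_tmul (φ : smoothCircle) (w : Grass ι) :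
    parG ι (φ ⊗ₜ[ℂ] w) = φ ⊗ₜ[ℂ] CliffordAlgebra.involute w := rfl

lemma derivG_tmul (φ : smoothCircle) (w : Grass ι) :
    derivG ι (φ ⊗ₜ[ℂ] w) = circleDeriv φ ⊗ₜ[ℂ] w := rfl

lemma parG_parG (u : GrassFun ι) : parG ι (parG ι u) = u := by
  induction u using TensorProduct.induction_on with
  | zero => simp
  | tmul φ w => simp [parG_tmul]
  | add u v hu hv => rw [map_add, map_add, hu, hv]

lemma parG_derivG (u : GrassFun ι) : parG ι (derivG ι u) = derivG ι (parG ι u) := by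
  induction u using TensorProduct.induction_on with
  | zero => simp
  | tmul φ w => simp [parG_tmul, derivG_tmul]
  | add u v hu hv => rw [map_add, map_add, map_add, map_add, hu, hv]

lemma circleDeriv_mul (φ ψ : smoothCircle) :
    circleDeriv (φ * ψ) = circleDeriv φ * ψ + φ * circleDeriv ψ := by
  ext x
  exact deriv_mul (φ.2.1.differentiable (by simp) x) (ψ.2.1.differentiable (by simp) x)

lemma derivG_mul (u v : GrassFun ι) :
    derivG ι (u * v) = derivG ι u * v + u * derivG ι v := by
  induction u using TensorProduct.induction_on with
  | zero => simp
  | add u u' hu hu' => simp only [add_mul, map_add, hu, hu']; abel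
  | tmul φ w =>
    induction v using TensorProduct.induction_on with
    | zero => simp
    | add v v' hv hv' => simp only [mul_add, map_add, hv, hv']; abel
    | tmul ψ x =>
      simp only [Algebra.TensorProduct.tmul_mul_tmul, derivG_tmul, circleDeriv_mul,
        TensorProduct.add_tmul]

lemma circleDeriv_one : circleDeriv 1 = 0 := by
  ext x
  exact deriv_const x (1 : ℂ)

lemma derivG_one : derivG ι 1 = 0 := by
  rw [Algebra.TensorProduct.one_def, derivG_tmul, circleDeriv_one, TensorProduct.zero_tmul]

end GrassFun

namespace SF

variable {ι : Type*}

@[ext]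
lemma ext' {a b : SF ι} (h1 : a.1 = b.1) (h2 : a.2 = b.2) : a = b := Prod.ext h1 h2

@[simp] lemma add_fst (a b : SF ι) : (a + b).1 = a.1 + b.1 := rfl
@[simp] lemma add_snd (a b : SF ι) : (a + b).2 = a.2 + b.2 := rfl
@[simp] lemma neg_fst (a : SF ι) : (-a).1 = -a.1 := rfl
@[simp] lemma neg_snd (a : SF ι) : (-a).2 = -a.2 := rfl
@[simp] lemma sub_fst (a b : SF ι) : (a - b).1 = a.1 - b.1 := rfl
@[simp] lemma sub_snd (a b : SF ι) : (a - b).2 = a.2 - b.2 := rfl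
@[simp] lemma zero_fst : (0 : SF ι).1 = 0 := rfl
@[simp] lemma zero_snd : (0 : SF ι).2 = 0 := rfl
@[simp] lemma smul_fst (c : ℂ) (a : SF ι) : (c • a).1 = c • a.1 := rfl
@[simp] lemma smul_snd (c : ℂ) (a : SF ι) : (c • a).2 = c • a.2 := rfl
@[simp] lemma mul_fst (a b : SF ι) : (a * b).1 = a.1 * b.1 := rfl
@[simp] lemma mul_snd (a b : SF ι) : (a * b).2 = a.2 * b.1 + parG ι a.1 * b.2 := rfl
@[simp] lemma one_fst : (1 : SF ι).1 = 1 := rfl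
@[simp] lemma one_snd : (1 : SF ι).2 = 0 := rfl
@[simp] lemma par_fst (a : SF ι) : (par a).1 = parG ι a.1 := rfl
@[simp] lemma par_snd (a : SF ι) : (par a).2 = -parG ι a.2 := rfl
@[simp] lemma D_fst (a : SF ι) : (D a).1 = a.2 := rfl
@[simp] lemma D_snd (a : SF ι) : (D a).2 = derivG ι a.1 := rfl

/-- The ring of superfunctions, on the given additive and multiplicative structures. The instance
is local, so that the operations in statements about superfunctions remain the given ones. -/
local instance ring : Ring (SF ι) :=
  { (inferInstance : AddCommGroup (SF ι)), (inferInstance : Mul (SF ι)),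
    (inferInstance : One (SF ι)) with
    left_distrib := fun a b c => by
      ext
      · simp only [mul_fst, add_fst, mul_add]
      · simp only [mul_snd, add_fst, add_snd, mul_add]; abel
    right_distrib := fun a b c => by
      ext
      · simp only [mul_fst, add_fst, add_mul]
      · simp only [mul_snd, add_fst, add_snd, add_mul, map_add]; abel
    zero_mul := Op.SF_zero_mul
    mul_zero := Op.SF_mul_zero
    mul_assoc := fun a b c => by
      ext
      · simp only [mul_fst, mul_assoc]
      · simp only [mul_fst, mul_snd, mul_assoc, map_mul, mul_add, add_mul, add_assoc]
    one_mul := fun a => by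
      ext
      · simp only [mul_fst, one_fst, one_mul]
      · simp only [mul_snd, one_fst, one_snd, zero_mul, map_one, one_mul, zero_add]
    mul_one := fun a => by
      ext
      · simp only [mul_fst, one_fst, mul_one]
      · simp only [mul_snd, one_fst, one_snd, mul_zero, mul_one, add_zero]
    zsmul := fun n a => n • a
    zsmul_zero' := fun a => zero_zsmul a
    zsmul_succ' := fun n a => SubNegMonoid.zsmul_succ' n a
    zsmul_neg' := fun n a => SubNegMonoid.zsmul_neg' n a
    nsmul := fun n a => n • a
    nsmul_zero := fun a => zero_nsmul a
    nsmul_succ := fun n a => AddMonoid.nsmul_succ n a }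

instance : IsScalarTower ℂ (SF ι) (SF ι) := ⟨fun c a b => by
  ext
  · exact smul_mul_assoc c a.1 b.1
  · simp only [smul_eq_mul, mul_snd, smul_fst, smul_snd, map_smul, smul_mul_assoc, smul_add]⟩

instance : SMulCommClass ℂ (SF ι) (SF ι) := ⟨fun c a b => by
  ext
  · exact (mul_smul_comm c a.1 b.1).symm
  · simp only [smul_eq_mul, mul_snd, smul_fst, smul_snd, mul_smul_comm, smul_add]⟩

/-- The parity automorphism as a linear map. -/
def parL : SF ι →ₗ[ℂ] SF ι where
  toFun := par
  map_add' a b := by ext <;> simp [add_comm]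
  map_smul' c a := by ext <;> simp

/-- The superderivative as a linear map. -/
def DL : SF ι →ₗ[ℂ] SF ι where
  toFun := D
  map_add' a b := by ext <;> simp
  map_smul' c a := by ext <;> simp

@[simp] lemma parL_apply (a : SF ι) : parL a = par a := rfl
@[simp] lemma DL_apply (a : SF ι) : DL a = D a := rfl

@[simp] lemma par_add (a b : SF ι) : par (a + b) = par a + par b := parL.map_add a b
@[simp] lemma par_neg (a : SF ι) : par (-a) = -par a := parL.map_neg a
@[simp] lemma par_sub (a b : SF ι) : par (a - b) = par a - par b := parL.map_sub a b
@[simp] lemma par_smul (c : ℂ) (a : SF ι) : par (c • a) = c • par a := parL.map_smul c a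
@[simp] lemma par_zsmul (c : ℤ) (a : SF ι) : par (c • a) = c • par a := map_zsmul parL c a
@[simp] lemma par_zero : par (0 : SF ι) = 0 := parL.map_zero
@[simp] lemma D_add (a b : SF ι) : D (a + b) = D a + D b := DL.map_add a b
@[simp] lemma D_neg (a : SF ι) : D (-a) = -D a := DL.map_neg a
@[simp] lemma D_zsmul (c : ℤ) (a : SF ι) : D (c • a) = c • D a := map_zsmul DL c a
@[simp] lemma D_zero : D (0 : SF ι) = 0 := DL.map_zero

lemma par_sum {α : Type*} (s : Finset α) (f : α → SF ι) :
    par (∑ i ∈ s, f i) = ∑ i ∈ s, par (f i) := map_sum parL f s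

lemma D_sum {α : Type*} (s : Finset α) (f : α → SF ι) :
    D (∑ i ∈ s, f i) = ∑ i ∈ s, D (f i) := map_sum DL f s

@[simp] lemma par_par (a : SF ι) : par (par a) = a := by
  ext <;> simp [parG_parG]

@[simp] lemma par_one : par (1 : SF ι) = 1 := by ext <;> simp

lemma par_mul (a b : SF ι) : par (a * b) = par a * par b := by
  ext
  · simp
  · simp only [par_snd, mul_snd, par_fst, map_add, map_mul, neg_add, neg_mul, mul_neg]

/-- The superderivative is an odd derivation. -/
lemma D_mul (a b : SF ι) : D (a * b) = D a * b + par a * D b := by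
  ext
  · simp
  · simp only [D_snd, D_fst, mul_fst, mul_snd, add_snd, par_fst, par_snd, derivG_mul, parG_parG,
      neg_mul]
    abel

lemma D_par (a : SF ι) : D (par a) = -par (D a) := by
  ext <;> simp [parG_derivG]

@[simp] lemma D_one : D (1 : SF ι) = 0 := by ext <;> simp [derivG_one]

lemma iterate_D_eq (j : ℕ) : (D^[j] : SF ι → SF ι) = (DL ^ j : SF ι →ₗ[ℂ] SF ι) := by
  induction j with
  | zero => rfl
  | succ j ih =>
    funext u
    rw [Function.iterate_succ_apply', ih, pow_succ', Module.End.mul_apply, DL_apply]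

lemma par_iterate_D (j : ℕ) (a : SF ι) : par (D^[j] a) = (-1 : ℤ) ^ j • D^[j] (par a) := by
  induction j with
  | zero => simp
  | succ j ih =>
    rw [Function.iterate_succ_apply', Function.iterate_succ_apply', ← neg_eq_iff_eq_neg.2 (D_par _),
      ih, D_zsmul, pow_succ]
    simp

end SF

attribute [local instance] SF.ring

/-! ### Supercommutativity -/

section Supercomm

variable {ι : Type*}

lemma grass_mul_gen (x : Grass ι) (v : ι →₀ ℂ) :
    x * ExteriorAlgebra.ι ℂ v = ExteriorAlgebra.ι ℂ v * CliffordAlgebra.involute x := by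
  induction x using CliffordAlgebra.induction with
  | algebraMap r =>
    rw [AlgHom.commutes]
    exact Algebra.commutes _ _
  | ι w =>
    rw [CliffordAlgebra.involute_ι]
    have h := ExteriorAlgebra.ι_add_mul_swap (R := ℂ) w v
    rw [mul_neg]
    exact eq_neg_of_add_eq_zero_left h
  | mul a b ha hb => rw [mul_assoc, hb, ← mul_assoc, ha, map_mul, mul_assoc]
  | add a b ha hb => rw [add_mul, ha, hb, map_add, mul_add]

lemma grass_even_comm {x : Grass ι} (hx : CliffordAlgebra.involute x = x) (y : Grass ι) :
    x * y = y * x := by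
  induction y using CliffordAlgebra.induction with
  | algebraMap r => exact (Algebra.commutes _ _).symm
  | ι w =>
    have := grass_mul_gen x w
    rwa [hx] at this
  | mul a b ha hb => rw [← mul_assoc, ha, mul_assoc, hb, mul_assoc]
  | add a b ha hb => rw [add_mul, ← ha, ← hb, mul_add]

lemma grass_odd_comm {x : Grass ι} (hx : CliffordAlgebra.involute x = -x) (y : Grass ι) :
    x * y = CliffordAlgebra.involute y * x := by
  induction y using CliffordAlgebra.induction with
  | algebraMap r =>
    rw [AlgHom.commutes]
    exact (Algebra.commutes _ _).symm
  | ι w =>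
    have := grass_mul_gen x w
    rw [CliffordAlgebra.involute_ι]
    rw [hx, mul_neg] at this
    rw [neg_mul]
    exact this
  | mul a b ha hb => rw [← mul_assoc, ha, mul_assoc, hb, map_mul, mul_assoc]
  | add a b ha hb => rw [mul_add, ha, hb, map_add, add_mul]

lemma grassFun_even_part_comm (u y : GrassFun ι) :
    (u + parG ι u) * y = y * (u + parG ι u) := by
  induction u using TensorProduct.induction_on with
  | zero => simp
  | add u u' hu hu' =>
    rw [map_add, add_add_add_comm, add_mul, hu, hu', ← mul_add]
  | tmul φ w =>
    induction y using TensorProduct.induction_on with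
    | zero => simp
    | add y y' hy hy' => rw [mul_add, hy, hy', add_mul]
    | tmul ψ x =>
      rw [parG_tmul, ← TensorProduct.tmul_add, Algebra.TensorProduct.tmul_mul_tmul,
        Algebra.TensorProduct.tmul_mul_tmul, grass_even_comm, mul_comm φ]
      simp [add_comm]

lemma grassFun_odd_part_comm (u y : GrassFun ι) :
    (u - parG ι u) * y = parG ι y * (u - parG ι u) := by
  induction u using TensorProduct.induction_on with
  | zero => simp
  | add u u' hu hu' =>
    rw [map_add, add_sub_add_comm, add_mul, hu, hu', mul_add]
  | tmul φ w =>
    induction y using TensorProduct.induction_on with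
    | zero => simp
    | add y y' hy hy' => rw [mul_add, hy, hy', map_add, add_mul]
    | tmul ψ x =>
      rw [parG_tmul, parG_tmul, ← TensorProduct.tmul_sub, Algebra.TensorProduct.tmul_mul_tmul,
        Algebra.TensorProduct.tmul_mul_tmul, grass_odd_comm, mul_comm φ]
      simp

lemma grassFun_even_comm {u : GrassFun ι} (hu : parG ι u = u) (y : GrassFun ι) :
    u * y = y * u := by
  have h := grassFun_even_part_comm u y
  rw [hu, ← two_smul ℂ u, smul_mul_assoc, mul_smul_comm] at h
  exact smul_right_injective _ (two_ne_zero (α := ℂ)) h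

lemma grassFun_odd_comm {u : GrassFun ι} (hu : parG ι u = -u) (y : GrassFun ι) :
    u * y = parG ι y * u := by
  have h := grassFun_odd_part_comm u y
  rw [hu, sub_neg_eq_add, ← two_smul ℂ u, smul_mul_assoc, mul_smul_comm] at h
  exact smul_right_injective _ (two_ne_zero (α := ℂ)) h

namespace SF

lemma even_comm {u : SF ι} (hu : par u = u) (w : SF ι) : u * w = w * u := by
  have h0 : parG ι u.1 = u.1 := congrArg Prod.fst hu
  have h1 : parG ι u.2 = -u.2 := neg_eq_iff_eq_neg.1 (congrArg Prod.snd hu)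
  ext
  · exact grassFun_even_comm h0 _
  · rw [mul_snd, mul_snd, h0, grassFun_odd_comm h1, grassFun_even_comm h0, add_comm]

lemma odd_comm {u : SF ι} (hu : par u = -u) (w : SF ι) : u * w = par w * u := by
  have h0 : parG ι u.1 = -u.1 := congrArg Prod.fst hu
  have h1 : parG ι u.2 = u.2 := neg_inj.1 (congrArg Prod.snd hu)
  ext
  · exact grassFun_odd_comm h0 _
  · rw [mul_snd, mul_snd, h0, grassFun_even_comm h1, neg_mul, grassFun_odd_comm h0, par_snd,
      par_fst, parG_parG, neg_mul, add_comm]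

end SF

end Supercomm

/-! ### The Berezin integral -/

namespace SF

variable {ι : Type*}

/-- Integration over the circle of functions with values in the Grassmann algebra. -/
def integralG : GrassFun ι →ₗ[ℂ] Grass ι :=
  (TensorProduct.lid ℂ (Grass ι)).toLinearMap ∘ₗ circleIntegral.rTensor (Grass ι)

lemma integralG_tmul (φ : smoothCircle) (w : Grass ι) :
    integralG (φ ⊗ₜ[ℂ] w) = circleIntegral φ • w := rfl

/-- The Berezin integral as a linear map. -/
def berezinL : SF ι →ₗ[ℂ] Grass ι where
  toFun := berezin
  map_add' a b := (integralG (ι := ι)).map_add a.2 b.2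
  map_smul' c a := (integralG (ι := ι)).map_smul c a.2

@[simp] lemma berezinL_apply (a : SF ι) : berezinL a = berezin a := rfl

lemma berezin_eq (a : SF ι) : berezin a = integralG a.2 := rfl

lemma circleIntegral_circleDeriv (φ : smoothCircle) : circleIntegral (circleDeriv φ) = 0 := by
  have h : ∫ x in (0 : ℝ)..(2 * Real.pi), deriv φ.1 x = φ.1 (2 * Real.pi) - φ.1 0 :=
    intervalIntegral.integral_deriv_eq_sub (fun x _ => φ.2.1.differentiable (by simp) x)
      (((contDiff_infty_iff_deriv.1 φ.2.1).2.continuous).intervalIntegrable _ _)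
  refine h.trans ?_
  have := φ.2.2 0
  rw [zero_add] at this
  rw [this, sub_self]

/-- Total superderivatives integrate to zero. -/
lemma berezin_D (a : SF ι) : berezin (D a) = 0 := by
  rw [berezin_eq, D_snd]
  induction a.1 using TensorProduct.induction_on with
  | zero => simp
  | tmul φ w => rw [derivG_tmul, integralG_tmul, circleIntegral_circleDeriv, zero_smul]
  | add u v hu hv => rw [map_add, map_add, hu, hv, add_zero]

end SF

/-! ### Nondegeneracy of the Berezin integral -/

namespace SF

variable {ι : Type*}

/-- The complex conjugate of a smooth function on the circle. -/
def circleConj (φ : smoothCircle) : smoothCircle :=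
  ⟨fun x => starRingEnd ℂ (φ.1 x), Complex.conjCLE.contDiff.comp φ.2.1,
    fun x => congrArg (starRingEnd ℂ) (φ.2.2 x)⟩

lemma eq_zero_of_circleIntegral_conj_mul {φ : smoothCircle}
    (h : circleIntegral (circleConj φ * φ) = 0) : φ = 0 := by
  have h1 : ∫ x in (0 : ℝ)..(2 * Real.pi), ((Complex.normSq (φ.1 x) : ℝ) : ℂ) = 0 := by
    refine Eq.trans ?_ h
    refine intervalIntegral.integral_congr fun x _ => ?_
    exact Complex.normSq_eq_conj_mul_self
  rw [intervalIntegral.integral_ofReal, Complex.ofReal_eq_zero] at h1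
  have hpi : 0 < 2 * Real.pi := by positivity
  have hc : Continuous fun x => Complex.normSq (φ.1 x) :=
    Complex.continuous_normSq.comp φ.2.1.continuous
  have h0 : ∀ x ∈ Set.Icc (0 : ℝ) (2 * Real.pi), φ.1 x = 0 := by
    by_contra! hne
    obtain ⟨x, hx, hx0⟩ := hne
    have := intervalIntegral.integral_pos hpi hc.continuousOn
      (fun y _ => Complex.normSq_nonneg _) ⟨x, hx, Complex.normSq_pos.2 hx0⟩
    exact this.ne' h1
  ext x
  obtain ⟨y, hy, hxy⟩ := φ.2.2.exists_mem_Ico₀ hpi x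
  rw [hxy]
  exact h0 y ⟨hy.1, hy.2.le⟩

open Classical in
/-- Proved by testing each component in a basis of the Grassmann algebra against its conjugate. -/
lemma integralG_mul_left_nondegenerate {g : GrassFun ι}
    (h : ∀ φ : smoothCircle, integralG (φ ⊗ₜ[ℂ] (1 : Grass ι) * g) = 0) : g = 0 := by
  let b := Module.Basis.ofVectorSpace ℂ (Grass ι)
  have key : ∀ (φ : smoothCircle) (u : GrassFun ι) i,
      b.coord i (integralG (φ ⊗ₜ[ℂ] (1 : Grass ι) * u)) =
        circleIntegral (φ * TensorProduct.equivFinsuppOfBasisRight b u i) := by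
    intro φ u i
    induction u using TensorProduct.induction_on with
    | zero => simp
    | add u v hu hv => rw [mul_add, map_add, map_add, hu, hv, map_add, Finsupp.add_apply, mul_add,
        map_add]
    | tmul ψ w =>
      rw [Algebra.TensorProduct.tmul_mul_tmul, one_mul, integralG_tmul,
        TensorProduct.equivFinsuppOfBasisRight_apply_tmul_apply, mul_smul_comm, map_smul, map_smul,
        smul_eq_mul, smul_eq_mul, mul_comm, Module.Basis.coord_apply]
  refine (TensorProduct.equivFinsuppOfBasisRight b).injective ?_
  rw [map_zero]
  ext1 i
  refine eq_zero_of_circleIntegral_conj_mul ?_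
  rw [← key, h, map_zero]

/-- Contraction with the `i`-th coordinate functional, on functions with values in the Grassmann
algebra: the left derivative in the `i`-th Grassmann generator. -/
def contractG (i : ι) : GrassFun ι →ₗ[ℂ] GrassFun ι :=
  (CliffordAlgebra.contractLeft (Q := (0 : QuadraticForm ℂ (ι →₀ ℂ)))
    (Finsupp.lapply i)).lTensor smoothCircle

lemma contractG_tmul (i : ι) (φ : smoothCircle) (w : Grass ι) :
    contractG i (φ ⊗ₜ[ℂ] w) = φ ⊗ₜ[ℂ] (CliffordAlgebra.contractLeft
      (Q := (0 : QuadraticForm ℂ (ι →₀ ℂ))) (Finsupp.lapply i) w : Grass ι) := rfl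

/-- The `i`-th Grassmann generator. -/
def gen (i : ι) : Grass ι := ExteriorAlgebra.ι ℂ (Finsupp.single i 1)

lemma contractG_gen_mul (i : ι) (g : GrassFun ι) :
    contractG i ((1 : smoothCircle) ⊗ₜ[ℂ] gen i * g) =
      g - (1 : smoothCircle) ⊗ₜ[ℂ] gen i * contractG i g := by
  induction g using TensorProduct.induction_on with
  | zero => simp
  | add u v hu hv => rw [mul_add, map_add, hu, hv, map_add, mul_add]; abel
  | tmul φ w =>
    rw [Algebra.TensorProduct.tmul_mul_tmul, contractG_tmul, contractG_tmul,
      Algebra.TensorProduct.tmul_mul_tmul, one_mul, ← TensorProduct.tmul_sub]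
    congr 1
    refine (CliffordAlgebra.contractLeft_ι_mul _ _ _).trans ?_
    simp [gen]

/-- A function with values in the Grassmann algebra involves only finitely many generators. -/
lemma finite_contractG_ne_zero (g : GrassFun ι) : {i | contractG i g ≠ 0}.Finite := by
  induction g using TensorProduct.induction_on with
  | zero => simp
  | add u v hu hv =>
    refine (hu.union hv).subset fun i hi => ?_
    by_contra hcon
    simp only [Set.mem_union, Set.mem_ofPred_eq, not_or, not_not] at hcon
    exact hi (by rw [map_add, hcon.1, hcon.2, add_zero])
  | tmul φ w =>
    have hw : {i | CliffordAlgebra.contractLeft (Q := (0 : QuadraticForm ℂ (ι →₀ ℂ)))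
        (Finsupp.lapply i) w ≠ 0}.Finite := by
      induction w using CliffordAlgebra.left_induction with
      | algebraMap r => simp
      | add x y hx hy =>
        refine (hx.union hy).subset fun i hi => ?_
        by_contra hcon
        simp only [Set.mem_union, Set.mem_ofPred_eq, not_or, not_not] at hcon
        exact hi (by rw [map_add, hcon.1, hcon.2, add_zero])
      | ι_mul x v hx =>
        refine (hx.union v.support.finite_toSet).subset fun i hi => ?_
        by_contra hcon
        simp only [Set.mem_union, Set.mem_ofPred_eq, not_or, not_not, Finset.mem_coe,
          Finsupp.mem_support_iff] at hcon
        refine hi ?_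
        rw [CliffordAlgebra.contractLeft_ι_mul, hcon.1, mul_zero, sub_zero, Finsupp.lapply_apply,
          hcon.2, zero_smul]
    refine hw.subset fun i hi h0 => hi ?_
    rw [contractG_tmul]
    refine (congrArg (fun y : Grass ι => φ ⊗ₜ[ℂ] y) h0).trans (TensorProduct.tmul_zero _ _)

/-- With infinitely many generators, nothing but zero is annihilated by all of them. -/
lemma eq_zero_of_gen_mul [Infinite ι] {g : GrassFun ι}
    (h : ∀ i, (1 : smoothCircle) ⊗ₜ[ℂ] gen i * g = 0) : g = 0 := by
  obtain ⟨i, hi⟩ := (finite_contractG_ne_zero g).exists_notMem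
  rw [Set.mem_ofPred_eq, not_not] at hi
  have h1 := contractG_gen_mul i g
  rw [h i, hi, mul_zero, sub_zero, map_zero] at h1
  exact h1.symm

/-- The superfunction `a + θ b`. -/
def mk (a b : GrassFun ι) : SF ι := (a, b)

@[simp] lemma mk_fst (a b : GrassFun ι) : (mk a b).1 = a := rfl
@[simp] lemma mk_snd (a b : GrassFun ι) : (mk a b).2 = b := rfl

lemma hasParity_iff {p : ℤ} {a : SF ι} : HasParity p a ↔ par a = p.negOnePow • a := by
  unfold HasParity
  split_ifs with h
  · rw [Int.negOnePow_even p h, one_smul]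
  · rw [Int.negOnePow_odd p (Int.not_even_iff_odd.1 h), Units.neg_smul, one_smul]

lemma involute_gen (i : ι) : CliffordAlgebra.involute (gen i) = -gen i :=
  CliffordAlgebra.involute_ι _

/-- The Berezin pairing of superfunctions of a fixed parity with arbitrary superfunctions
separates points. -/
lemma eq_zero_of_berezin_mul [Infinite ι] {w : SF ι} (p : ℤ)
    (h : ∀ v : SF ι, v.HasParity p → berezin (v * w) = 0) : w = 0 := by
  have hgen : ∀ g : GrassFun ι, (∀ i (φ : smoothCircle),
      integralG (φ ⊗ₜ[ℂ] gen i * g) = 0) → g = 0 := fun g hg =>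
    eq_zero_of_gen_mul fun i => integralG_mul_left_nondegenerate fun φ => by
      rw [← mul_assoc, Algebra.TensorProduct.tmul_mul_tmul, mul_one, one_mul]
      exact hg i φ
  rcases Int.even_or_odd p with hp | hp
  -- even test functions: `φ` detects `w.2`, and `θ ξ φ` with a generator `ξ` detects `w.1`
  · have hpar : ∀ v : SF ι, v.HasParity p ↔ par v = v := fun v => by
      rw [hasParity_iff, Int.negOnePow_even p hp, one_smul]
    have h2 : w.2 = 0 := integralG_mul_left_nondegenerate fun φ => by
      have hv := h (mk (φ ⊗ₜ[ℂ] (1 : Grass ι)) 0)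
        ((hpar _).2 (by ext <;> simp [parG_tmul]))
      simpa [berezin_eq, parG_tmul] using hv
    have h1 : w.1 = 0 := hgen _ fun i φ => by
      have hv := h (mk 0 (φ ⊗ₜ[ℂ] gen i))
        ((hpar _).2 (by ext <;> simp [parG_tmul, involute_gen, TensorProduct.tmul_neg]))
      simpa [berezin_eq, parG_tmul] using hv
    exact ext' h1 h2
  -- odd test functions: `θ φ` detects `w.1`, and `ξ φ` detects `w.2`
  · have hpar : ∀ v : SF ι, v.HasParity p ↔ par v = -v := fun v => by
      rw [hasParity_iff, Int.negOnePow_odd p hp, Units.neg_smul, one_smul]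
    have h1 : w.1 = 0 := integralG_mul_left_nondegenerate fun φ => by
      have hv := h (mk 0 (φ ⊗ₜ[ℂ] (1 : Grass ι)))
        ((hpar _).2 (by ext <;> simp [parG_tmul]))
      simpa [berezin_eq, parG_tmul] using hv
    have h2 : w.2 = 0 := hgen _ fun i φ => by
      have hv := h (mk (φ ⊗ₜ[ℂ] gen i) 0)
        ((hpar _).2 (by ext <;> simp [parG_tmul, involute_gen, TensorProduct.tmul_neg]))
      simpa [berezin_eq, parG_tmul, involute_gen, TensorProduct.tmul_neg] using hv
    exact ext' h1 h2

end SF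

/-! ### The ring of super-integro-differential operators -/

namespace Op

variable {ι : Type*}

@[ext]
lemma ext' {a b : Op ι} (h : ∀ j, a.coeff j = b.coeff j) : a = b := Subtype.ext (funext h)

@[simp] lemma coeff_add (a b : Op ι) (j : ℤ) : (a + b).coeff j = a.coeff j + b.coeff j := rfl
@[simp] lemma coeff_sub (a b : Op ι) (j : ℤ) : (a - b).coeff j = a.coeff j - b.coeff j := rfl
@[simp] lemma coeff_neg (a : Op ι) (j : ℤ) : (-a).coeff j = -a.coeff j := rfl
@[simp] lemma coeff_zero (j : ℤ) : (0 : Op ι).coeff j = 0 := rfl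
@[simp] lemma coeff_smul (c : ℂ) (a : Op ι) (j : ℤ) : (c • a).coeff j = c • a.coeff j := rfl
lemma coeff_mono (u : SF ι) (k j : ℤ) : (mono u k).coeff j = if j = k then u else 0 := rfl
@[simp] lemma coeff_mono_self (u : SF ι) (k : ℤ) : (mono u k).coeff k = u := if_pos rfl
lemma coeff_one (j : ℤ) : (1 : Op ι).coeff j = if j = 0 then 1 else 0 := rfl

/-- The coefficient at `D_θ^j` as a linear map. -/
def coeffL (j : ℤ) : Op ι →ₗ[ℂ] SF ι where
  toFun a := a.coeff j
  map_add' _ _ := rfl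
  map_smul' _ _ := rfl

lemma coeff_sum {α : Type*} (s : Finset α) (f : α → Op ι) (j : ℤ) :
    (∑ i ∈ s, f i).coeff j = ∑ i ∈ s, (f i).coeff j := map_sum (coeffL j) f s

/-- `a` has order at most `M` in `D_θ`. -/
def OrdLE (M : ℤ) (a : Op ι) : Prop := ∀ j, M < j → a.coeff j = 0

lemma exists_ordLE (a : Op ι) : ∃ M, OrdLE M a := a.2

lemma exists_ordLE_two (a b : Op ι) : ∃ M, OrdLE M a ∧ OrdLE M b := by
  obtain ⟨M, hM⟩ := exists_ordLE a
  obtain ⟨K, hK⟩ := exists_ordLE b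
  exact ⟨max M K, fun j hj => hM j ((le_max_left _ _).trans_lt hj),
    fun j hj => hK j ((le_max_right _ _).trans_lt hj)⟩

namespace OrdLE

variable {M K : ℤ} {a b : Op ι}

lemma weaken (h : OrdLE M a) (hMK : M ≤ K) : OrdLE K a := fun j hj => h j (hMK.trans_lt hj)

lemma add (ha : OrdLE M a) (hb : OrdLE M b) : OrdLE M (a + b) := fun j hj => by
  rw [coeff_add, ha j hj, hb j hj, add_zero]

lemma sub (ha : OrdLE M a) (hb : OrdLE M b) : OrdLE M (a - b) := fun j hj => by
  rw [coeff_sub, ha j hj, hb j hj, sub_zero]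

lemma smul (c : ℂ) (ha : OrdLE M a) : OrdLE M (c • a) := fun j hj => by
  rw [coeff_smul, ha j hj, smul_zero]

lemma zero : OrdLE M (0 : Op ι) := fun _ _ => rfl

lemma sum {α : Type*} {s : Finset α} {f : α → Op ι} (h : ∀ i ∈ s, OrdLE M (f i)) :
    OrdLE M (∑ i ∈ s, f i) := fun j hj => by
  rw [coeff_sum, Finset.sum_eq_zero fun i hi => h i hi j hj]

lemma mono (u : SF ι) (k : ℤ) : OrdLE k (mono u k) := fun _ hj => if_neg hj.ne'

lemma one : OrdLE 0 (1 : Op ι) := OrdLE.mono 1 0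

end OrdLE

/-! #### Left multiplication by `D_θ^k` -/

/-- The `k`-th power of the parity automorphism. -/
def parPow (k : ℤ) (u : SF ι) : SF ι := if Even k then u else u.par

lemma par_parPow (k : ℤ) (u : SF ι) : (parPow k u).par = parPow (k + 1) u := by
  by_cases h : Even k
  · have h' : ¬Even (k + 1) := by rw [Int.even_add_one]; exact not_not.2 h
    rw [parPow, parPow, if_pos h, if_neg h']
  · have h' : Even (k + 1) := by rw [Int.even_add_one]; exact h
    rw [parPow, parPow, if_neg h, if_pos h', SF.par_par]

lemma parPow_par (k : ℤ) (u : SF ι) : parPow k u.par = (parPow k u).par := by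
  unfold parPow; split_ifs <;> rfl

/-- The parity power as a linear map. -/
def parPowL (k : ℤ) : SF ι →ₗ[ℂ] SF ι := if Even k then LinearMap.id else SF.parL

lemma parPowL_apply (k : ℤ) (u : SF ι) : parPowL k u = parPow k u := by
  unfold parPow parPowL; split_ifs <;> rfl

lemma leibniz_eq (k : ℤ) (j : ℕ) (u : SF ι) :
    leibniz k j u = superChoose k j • SF.D^[j] (parPow (k - j) u) := rfl

/-- The coefficient `leibniz k j` as a linear map. -/
def leibnizL (k : ℤ) (j : ℕ) : SF ι →ₗ[ℂ] SF ι :=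
  superChoose k j • ((SF.DL ^ j : SF ι →ₗ[ℂ] SF ι) ∘ₗ parPowL (k - j))

lemma leibnizL_apply (k : ℤ) (j : ℕ) (u : SF ι) : leibnizL k j u = leibniz k j u := by
  rw [leibniz_eq, SF.iterate_D_eq, ← parPowL_apply]
  rfl

/-- Pascal's rule for the super-binomial coefficients. -/
lemma superChoose_succ_succ (k : ℤ) (j : ℕ) :
    superChoose (k + 1) (j + 1) = superChoose k j + (-1) ^ (j + 1) * superChoose k (j + 1) := by
  unfold superChoose
  rcases Int.even_or_odd k with hk | hk <;> rcases Nat.even_or_odd j with hj | hj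
  · have hk' : ¬Even (k + 1) := by rw [Int.even_add_one]; exact not_not.2 hk
    rw [if_neg (fun h => hk' h.1), if_neg (fun h => Nat.not_odd_iff_even.2 hj h.2),
      if_pos ⟨hk, hj.add_one⟩]
    obtain ⟨a, rfl⟩ := hk
    obtain ⟨b, rfl⟩ := hj
    rw [show (a + a + 1) / 2 = (a + a) / 2 by omega, show (b + b + 1) / 2 = (b + b) / 2 by omega]
    simp
  · have hk' : ¬Even (k + 1) := by rw [Int.even_add_one]; exact not_not.2 hk
    have hj' : Even (j + 1) := hj.add_one
    rw [if_neg (fun h => hk' h.1), if_pos ⟨hk, hj⟩,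
      if_neg (fun h => Nat.not_odd_iff_even.2 hj' h.2), hj'.neg_one_pow]
    obtain ⟨a, rfl⟩ := hk
    rw [show (a + a + 1) / 2 = (a + a) / 2 by omega]
    simp
  · have hk' : ¬Even k := Int.not_even_iff_odd.2 hk
    have hj' : Odd (j + 1) := hj.add_one
    rw [if_pos ⟨hk.add_one, hj'⟩, if_neg (fun h => hk' h.1), if_neg (fun h => hk' h.1),
      hj'.neg_one_pow]
    obtain ⟨b, rfl⟩ := hj
    rw [show (b + b + 1) / 2 = (b + b) / 2 by omega]
    simp
  · have hk' : ¬Even k := Int.not_even_iff_odd.2 hk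
    have hj' : Even (j + 1) := hj.add_one
    rw [if_neg (fun h => Nat.not_odd_iff_even.2 hj' h.2), if_neg (fun h => hk' h.1),
      if_neg (fun h => hk' h.1), hj'.neg_one_pow]
    obtain ⟨a, rfl⟩ := hk
    obtain ⟨b, rfl⟩ := hj
    rw [show (2 * a + 1 + 1) / 2 = a + 1 by omega, show (2 * b + 1 + 1) / 2 = b + 1 by omega,
      show (2 * a + 1) / 2 = a by omega, show (2 * b + 1) / 2 = b by omega,
      Ring.choose_succ_succ, one_mul]

lemma superChoose_zero_right (k : ℤ) : superChoose k 0 = 1 := by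
  simp [superChoose]

lemma superChoose_eq_zero_of_lt {k : ℤ} {j : ℕ} (hk : 0 ≤ k) (h : k < j) :
    superChoose k j = 0 := by
  lift k to ℕ using hk
  unfold superChoose
  split_ifs with hp
  · rfl
  · have : (k : ℤ) / 2 = ((k / 2 : ℕ) : ℤ) := by omega
    rw [this, Ring.choose_natCast, Nat.choose_eq_zero_of_lt, Nat.cast_zero]
    rw [Int.even_coe_nat] at hp
    by_contra hlt
    refine hp ⟨?_, ?_⟩
    · rw [Nat.even_iff]; omega
    · rw [Nat.odd_iff]; omega

lemma superChoose_self (k : ℕ) : superChoose k k = 1 := by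
  unfold superChoose
  rw [if_neg]
  · have : (k : ℤ) / 2 = ((k / 2 : ℕ) : ℤ) := by omega
    rw [this, Ring.choose_natCast, Nat.choose_self, Nat.cast_one]
  · rintro ⟨h1, h2⟩
    exact Nat.not_odd_iff_even.2 ((Int.even_coe_nat k).1 h1) h2

lemma leibniz_zero_right (k : ℤ) (u : SF ι) : leibniz k 0 u = parPow k u := by
  rw [leibniz_eq, superChoose_zero_right, one_smul]
  simp

lemma leibniz_succ_succ (k : ℤ) (j : ℕ) (u : SF ι) :
    leibniz (k + 1) (j + 1) u = SF.D (leibniz k j u) + (leibniz k (j + 1) u).par := by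
  have h1 : (k + 1 - ((j + 1 : ℕ) : ℤ)) = k - j := by push_cast; ring
  have h2 : (parPow (k - ((j + 1 : ℕ) : ℤ)) u).par = parPow (k - j) u := by
    rw [par_parPow]; congr 1; push_cast; ring
  rw [leibniz_eq, leibniz_eq, leibniz_eq, h1, superChoose_succ_succ, SF.D_zsmul, SF.par_zsmul,
    SF.par_iterate_D, h2, smul_smul, add_smul, mul_comm, Function.iterate_succ_apply']

lemma leibniz_succ_zero (k : ℤ) (u : SF ι) : leibniz (k + 1) 0 u = (leibniz k 0 u).par := by
  rw [leibniz_zero_right, leibniz_zero_right, par_parPow]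

/-- Left multiplication by `D_θ^k`, given by the super-Leibniz rule. -/
def T (k : ℤ) (b : Op ι) : Op ι :=
  ⟨fun r => ∑ᶠ j : ℕ, leibniz k j (b.coeff (r - k + j)), by
    obtain ⟨K, hK⟩ := exists_ordLE b
    refine ⟨k + K, fun r hr => finsum_eq_zero_of_forall_eq_zero fun j => ?_⟩
    rw [hK _ (by omega), leibniz_zero]⟩

lemma coeff_T {K : ℤ} {b : Op ι} (hb : OrdLE K b) (k r : ℤ) {n : ℕ} (hn : K < r - k + n) :
    (T k b).coeff r = ∑ j ∈ Finset.range n, leibniz k j (b.coeff (r - k + j)) := by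
  refine finsum_eq_sum_of_support_subset _ fun j hj => ?_
  rw [Finset.coe_range, Set.mem_Iio]
  by_contra hjn
  refine hj ?_
  dsimp only
  rw [hb _ (by omega), leibniz_zero]

lemma OrdLE.T {K : ℤ} {b : Op ι} (hb : OrdLE K b) (k : ℤ) : OrdLE (k + K) (T k b) :=
  fun r hr => finsum_eq_zero_of_forall_eq_zero fun j => by
    rw [hb _ (by omega), leibniz_zero]

lemma exists_nat_gt_sub (K x : ℤ) : ∃ n : ℕ, K < x + n := ⟨(K - x + 1).toNat, by omega⟩

lemma T_add (k : ℤ) (a b : Op ι) : T k (a + b) = T k a + T k b := by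
  obtain ⟨M, ha, hb⟩ := exists_ordLE_two a b
  ext1 r
  obtain ⟨n, hn⟩ := exists_nat_gt_sub M (r - k)
  rw [coeff_add, coeff_T ha k r hn, coeff_T hb k r hn, coeff_T (ha.add hb) k r hn,
    ← Finset.sum_add_distrib]
  refine Finset.sum_congr rfl fun j _ => ?_
  rw [coeff_add, ← leibnizL_apply, map_add, leibnizL_apply, leibnizL_apply]

lemma T_smul (k : ℤ) (c : ℂ) (a : Op ι) : T k (c • a) = c • T k a := by
  obtain ⟨M, ha⟩ := exists_ordLE a
  ext1 r
  obtain ⟨n, hn⟩ := exists_nat_gt_sub M (r - k)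
  rw [coeff_smul, coeff_T ha k r hn, coeff_T (ha.smul c) k r hn, Finset.smul_sum]
  refine Finset.sum_congr rfl fun j _ => ?_
  rw [coeff_smul, ← leibnizL_apply, map_smul, leibnizL_apply]

lemma coeff_T_mono (u : SF ι) (k l : ℤ) (j : ℕ) :
    (T k (mono u l)).coeff (k + l - j) = leibniz k j u := by
  rw [coeff_T (OrdLE.mono u l) k _ (n := j + 1) (by push_cast; omega)]
  rw [Finset.sum_range_succ, Finset.sum_eq_zero, zero_add]
  · rw [coeff_mono, if_pos (by ring)]
  · intro i hi
    rw [Finset.mem_range] at hi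
    rw [coeff_mono, if_neg (by omega), leibniz_zero]

/-- Left multiplication by `D_θ`. -/
def dOp (a : Op ι) : Op ι :=
  ⟨fun r => SF.D (a.coeff r) + (a.coeff (r - 1)).par, by
    obtain ⟨K, hK⟩ := exists_ordLE a
    refine ⟨K + 1, fun r hr => ?_⟩
    dsimp only
    rw [hK _ (by omega), hK _ (by omega), SF.D_zero, SF.par_zero, add_zero]⟩

lemma coeff_dOp (a : Op ι) (r : ℤ) :
    (dOp a).coeff r = SF.D (a.coeff r) + (a.coeff (r - 1)).par := rfl

lemma dOp_injective : Function.Injective (dOp : Op ι → Op ι) := by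
  intro x y hxy
  have hz : ∀ r, SF.D ((x - y).coeff r) + ((x - y).coeff (r - 1)).par = 0 := fun r => by
    have h := congrArg (fun a => coeff a r) hxy
    simp only [coeff_dOp] at h
    rw [coeff_sub, coeff_sub, sub_eq_add_neg, sub_eq_add_neg, SF.D_add, SF.par_add, SF.D_neg,
      SF.par_neg, add_add_add_comm, h]
    abel
  obtain ⟨M, hM⟩ := exists_ordLE (x - y)
  have h0 : ∀ n : ℕ, (x - y).coeff (M + 1 - n) = 0 := fun n => by
    induction n with
    | zero => exact hM _ (by simp)
    | succ n ih =>
      have h := hz (M + 1 - n)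
      rw [ih, SF.D_zero, zero_add] at h
      rw [show M + 1 - ((n + 1 : ℕ) : ℤ) = M + 1 - n - 1 by push_cast; ring,
        ← SF.par_par (coeff _ _), h, SF.par_zero]
  ext1 r
  rw [← sub_eq_zero, ← coeff_sub]
  by_cases hr : M < r
  · exact hM r hr
  · have := h0 (M + 1 - r).toNat
    rwa [show M + 1 - ((M + 1 - r).toNat : ℤ) = r by omega] at this

lemma T_zero (b : Op ι) : T 0 b = b := by
  obtain ⟨K, hK⟩ := exists_ordLE b
  ext1 r
  obtain ⟨n, hn⟩ := exists_nat_gt_sub K (r - 0)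
  rw [coeff_T hK 0 r (n := n + 1) (by omega), Finset.sum_range_succ', Finset.sum_eq_zero, zero_add,
    leibniz_zero_right]
  · simp [parPow]
  · intro j _
    rw [leibniz_eq, superChoose_eq_zero_of_lt le_rfl (by positivity), zero_smul]

lemma dOp_T (k : ℤ) (b : Op ι) : dOp (T k b) = T (k + 1) b := by
  obtain ⟨K, hK⟩ := exists_ordLE b
  ext1 r
  obtain ⟨n, hn⟩ := exists_nat_gt_sub K (r - k)
  rw [coeff_dOp, coeff_T hK k r hn, coeff_T hK k (r - 1) (n := n + 1) (by push_cast; omega),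
    coeff_T hK (k + 1) r (n := n + 1) (by push_cast; omega), Finset.sum_range_succ',
    Finset.sum_range_succ', SF.par_add, SF.par_sum, SF.D_sum, ← add_assoc,
    ← Finset.sum_add_distrib, leibniz_succ_zero]
  congr 1
  · refine Finset.sum_congr rfl fun j _ => ?_
    rw [show r - 1 - k + ((j + 1 : ℕ) : ℤ) = r - k + j by push_cast; ring,
      show r - (k + 1) + ((j + 1 : ℕ) : ℤ) = r - k + j by push_cast; ring, leibniz_succ_succ]
  · rw [show r - 1 - k = r - (k + 1) by ring]

lemma iterate_dOp_T (n : ℕ) (k : ℤ) (b : Op ι) : dOp^[n] (T k b) = T (k + n) b := by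
  induction n with
  | zero => simp
  | succ n ih =>
    rw [Function.iterate_succ_apply', ih, dOp_T]
    congr 1
    push_cast; ring

/-! #### Associativity -/

lemma coeff_mul_eq {M K : ℤ} {a b : Op ι} (ha : OrdLE M a) (hb : OrdLE K b) {r lo hi : ℤ}
    (hlo : lo ≤ r - K) (hhi : M ≤ hi) :
    (a * b).coeff r = ∑ i ∈ Finset.Icc lo hi, a.coeff i * (T i b).coeff r := by
  obtain ⟨n, hn⟩ := exists_nat_gt_sub K (r - hi)
  have h1 : (a * b).coeff r = ∑ p ∈ Finset.Icc lo hi ×ˢ Finset.range n,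
      a.coeff p.1 * leibniz p.1 p.2 (b.coeff (r - p.1 + p.2)) := by
    refine finsum_eq_sum_of_support_subset _ fun p hp => ?_
    rw [Finset.coe_product, Set.mem_prod, Finset.mem_coe, Finset.mem_coe, Finset.mem_Icc,
      Finset.mem_range]
    by_contra hcon
    refine hp ?_
    by_cases hM : M < p.1
    · dsimp only
      rw [ha _ hM, zero_mul]
    · dsimp only
      rw [hb _ (by omega), leibniz_zero, mul_zero]
  rw [h1, Finset.sum_product]
  refine Finset.sum_congr rfl fun i hi' => ?_
  rw [Finset.mem_Icc] at hi'
  rw [coeff_T hb i r (n := n) (by omega), Finset.mul_sum]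

lemma OrdLE.mul {M K : ℤ} {a b : Op ι} (ha : OrdLE M a) (hb : OrdLE K b) :
    OrdLE (M + K) (a * b) := fun r hr => by
  rw [coeff_mul_eq ha hb le_rfl le_rfl]
  exact Finset.sum_eq_zero fun i hi => by
    rw [Finset.mem_Icc] at hi
    omega

lemma dOp_mul (b c : Op ι) : dOp (b * c) = dOp b * c := by
  obtain ⟨M, hM⟩ := exists_ordLE b
  obtain ⟨K, hK⟩ := exists_ordLE c
  have hd : OrdLE (M + 1) (dOp b) := fun r hr => by
    rw [coeff_dOp, hM _ (by omega), hM _ (by omega), SF.D_zero, SF.par_zero, add_zero]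
  ext1 r
  -- the terms `σ(b_i) D_θ^{i+1} ∘ c`, reindexed; the extra term at the lower end vanishes
  have e1 : ∑ i ∈ Finset.Icc (r - K - 1) M, (b.coeff i).par * (T (i + 1) c).coeff r =
      ∑ i ∈ Finset.Icc (r - K - 1) (M + 1), (b.coeff (i - 1)).par * (T i c).coeff r := by
    have : ∑ i ∈ Finset.Icc (r - K - 1) M, (b.coeff i).par * (T (i + 1) c).coeff r =
        ∑ i ∈ Finset.Icc (r - K - 1 + 1) (M + 1), (b.coeff (i - 1)).par * (T i c).coeff r := by
      rw [← Finset.map_add_right_Icc, Finset.sum_map]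
      simp
    rw [this]
    refine Finset.sum_subset (Finset.Icc_subset_Icc_left (by omega)) fun i hi hi' => ?_
    rw [Finset.mem_Icc] at hi hi'
    rw [hK.T i r (by omega), mul_zero]
  have e2 : ∑ i ∈ Finset.Icc (r - K - 1) M, SF.D (b.coeff i) * (T i c).coeff r =
      ∑ i ∈ Finset.Icc (r - K - 1) (M + 1), SF.D (b.coeff i) * (T i c).coeff r := by
    refine Finset.sum_subset (Finset.Icc_subset_Icc_right (by omega)) fun i hi hi' => ?_
    rw [Finset.mem_Icc] at hi hi'
    rw [hM i (by omega), SF.D_zero, zero_mul]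
  rw [coeff_dOp, coeff_mul_eq hM hK (lo := r - K - 1) (by omega) le_rfl,
    coeff_mul_eq hM hK (lo := r - K - 1) (by omega) le_rfl,
    coeff_mul_eq hd hK (lo := r - K - 1) (by omega) le_rfl, SF.D_sum, SF.par_sum,
    ← Finset.sum_add_distrib]
  have e3 : ∀ i, SF.D (b.coeff i * (T i c).coeff r) + (b.coeff i * (T i c).coeff (r - 1)).par =
      SF.D (b.coeff i) * (T i c).coeff r + (b.coeff i).par * (T (i + 1) c).coeff r := fun i => by
    rw [SF.D_mul, SF.par_mul, ← dOp_T, coeff_dOp, mul_add, add_assoc]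
  simp only [e3]
  rw [Finset.sum_add_distrib, e1, e2, ← Finset.sum_add_distrib]
  exact Finset.sum_congr rfl fun i _ => by rw [coeff_dOp, add_mul]

lemma iterate_dOp_mul (n : ℕ) (b c : Op ι) : dOp^[n] (b * c) = dOp^[n] b * c := by
  induction n with
  | zero => rfl
  | succ n ih => rw [Function.iterate_succ_apply', ih, dOp_mul, Function.iterate_succ_apply']

lemma T_mul (k : ℤ) (b c : Op ι) : T k (b * c) = T k b * c := by
  rcases Int.eq_nat_or_neg k with ⟨n, rfl | rfl⟩
  · have h := iterate_dOp_mul n b c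
    have h1 := iterate_dOp_T n 0 (b * c)
    have h2 := iterate_dOp_T n 0 b
    rw [zero_add, T_zero] at h1 h2
    rw [← h1, ← h2, h]
  · refine dOp_injective.iterate n ?_
    rw [iterate_dOp_mul, iterate_dOp_T, iterate_dOp_T, neg_add_cancel, T_zero, T_zero]

lemma op_mul_assoc (a b c : Op ι) : a * b * c = a * (b * c) := by
  obtain ⟨M, hM⟩ := exists_ordLE a
  obtain ⟨K, hK⟩ := exists_ordLE b
  obtain ⟨L, hL⟩ := exists_ordLE c
  ext1 r
  rw [coeff_mul_eq (hM.mul hK) hL le_rfl le_rfl,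
    coeff_mul_eq hM (hK.mul hL) (lo := r - L - K) (by omega) le_rfl]
  have h1 : ∀ l ∈ Finset.Icc (r - L) (M + K), (a * b).coeff l * (T l c).coeff r =
      ∑ i ∈ Finset.Icc (r - L - K) M, a.coeff i * ((T i b).coeff l * (T l c).coeff r) := by
    intro l hl
    rw [Finset.mem_Icc] at hl
    rw [coeff_mul_eq hM hK (lo := r - L - K) (by omega) le_rfl, Finset.sum_mul]
    exact Finset.sum_congr rfl fun i _ => mul_assoc _ _ _
  rw [Finset.sum_congr rfl h1, Finset.sum_comm]
  refine Finset.sum_congr rfl fun i hi => ?_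
  rw [Finset.mem_Icc] at hi
  rw [T_mul, coeff_mul_eq (hK.T i) hL le_rfl (hi := M + K) (by omega), Finset.mul_sum]

lemma coeff_mono_mul (u : SF ι) (k : ℤ) (b : Op ι) (r : ℤ) :
    (mono u k * b).coeff r = u * (T k b).coeff r := by
  obtain ⟨K, hK⟩ := exists_ordLE b
  rw [coeff_mul_eq (OrdLE.mono u k) hK (min_le_right k (r - K)) le_rfl,
    Finset.sum_eq_single_of_mem k (Finset.mem_Icc.2 ⟨min_le_left _ _, le_rfl⟩), coeff_mono_self]
  intro i _ hi
  rw [coeff_mono, if_neg hi, zero_mul]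

lemma leibniz_one (k : ℤ) {j : ℕ} (hj : j ≠ 0) : leibniz k j (1 : SF ι) = 0 := by
  obtain ⟨i, rfl⟩ := Nat.exists_eq_succ_of_ne_zero hj
  have h1 : parPow (k - (i.succ : ℕ)) (1 : SF ι) = 1 := by
    unfold parPow; split_ifs <;> simp
  rw [leibniz_eq, h1, Function.iterate_succ_apply, SF.D_one, SF.iterate_D_eq, map_zero, smul_zero]

lemma T_mono_one (k l : ℤ) : T k (mono (1 : SF ι) l) = mono 1 (k + l) := by
  ext1 r
  by_cases hr : k + l < r
  · rw [(OrdLE.mono 1 l).T k r hr, OrdLE.mono 1 (k + l) r hr]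
  · obtain ⟨j, rfl⟩ : ∃ j : ℕ, r = k + l - j := ⟨(k + l - r).toNat, by omega⟩
    rw [coeff_T_mono, coeff_mono]
    by_cases hj : j = 0
    · subst hj
      rw [leibniz_zero_right, if_pos (by simp)]
      unfold parPow; split_ifs <;> simp
    · rw [leibniz_one k hj, if_neg (by omega)]

lemma op_mul_one (a : Op ι) : a * 1 = a := by
  obtain ⟨M, hM⟩ := exists_ordLE a
  ext1 r
  rw [coeff_mul_eq hM OrdLE.one (lo := r) (hi := max r M) (by omega) (le_max_right _ _),
    Finset.sum_eq_single_of_mem r (Finset.mem_Icc.2 ⟨le_rfl, le_max_left _ _⟩)]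
  · change _ * (T r (mono 1 0)).coeff r = _
    rw [T_mono_one, add_zero, coeff_mono_self, mul_one]
  · intro i _ hi
    change _ * (T i (mono 1 0)).coeff r = _
    rw [T_mono_one, add_zero, coeff_mono, if_neg hi.symm, mul_zero]

lemma op_one_mul (a : Op ι) : 1 * a = a := by
  ext1 r
  rw [show (1 : Op ι) = mono 1 0 from rfl, coeff_mono_mul, T_zero, one_mul]

lemma op_mul_add (a b c : Op ι) : a * (b + c) = a * b + a * c := by
  obtain ⟨M, hM⟩ := exists_ordLE a
  obtain ⟨K, hb, hc⟩ := exists_ordLE_two b c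
  ext1 r
  rw [coeff_add, coeff_mul_eq hM hb le_rfl le_rfl, coeff_mul_eq hM hc le_rfl le_rfl,
    coeff_mul_eq hM (hb.add hc) le_rfl le_rfl, ← Finset.sum_add_distrib]
  exact Finset.sum_congr rfl fun i _ => by rw [T_add, coeff_add, mul_add]

lemma op_add_mul (a b c : Op ι) : (a + b) * c = a * c + b * c := by
  obtain ⟨M, ha, hb⟩ := exists_ordLE_two a b
  obtain ⟨K, hc⟩ := exists_ordLE c
  ext1 r
  rw [coeff_add, coeff_mul_eq ha hc le_rfl le_rfl, coeff_mul_eq hb hc le_rfl le_rfl,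
    coeff_mul_eq (ha.add hb) hc le_rfl le_rfl, ← Finset.sum_add_distrib]
  exact Finset.sum_congr rfl fun i _ => by rw [coeff_add, add_mul]

lemma op_zero_mul (a : Op ι) : 0 * a = 0 := by
  have h := op_add_mul 0 0 a
  rw [add_zero] at h
  exact (add_eq_left (a := (0 * a : Op ι))).1 h.symm

lemma op_mul_zero (a : Op ι) : a * 0 = 0 := by
  have h := op_mul_add a 0 0
  rw [add_zero] at h
  exact (add_eq_left (a := (a * 0 : Op ι))).1 h.symm

/-- The ring of operators, on the given additive and multiplicative structures. The instance
is local, so that the operations in statements about operators remain the given ones. -/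
local instance ring : Ring (Op ι) :=
  { (inferInstance : AddCommGroup (Op ι)), (inferInstance : Mul (Op ι)),
    (inferInstance : One (Op ι)) with
    left_distrib := op_mul_add
    right_distrib := op_add_mul
    zero_mul := op_zero_mul
    mul_zero := op_mul_zero
    mul_assoc := op_mul_assoc
    one_mul := op_one_mul
    mul_one := op_mul_one
    zsmul := fun n a => n • a
    zsmul_zero' := fun a => zero_zsmul a
    zsmul_succ' := fun n a => SubNegMonoid.zsmul_succ' n a
    zsmul_neg' := fun n a => SubNegMonoid.zsmul_neg' n a
    nsmul := fun n a => n • a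
    nsmul_zero := fun a => zero_nsmul a
    nsmul_succ := fun n a => AddMonoid.nsmul_succ n a }

instance : IsScalarTower ℂ (Op ι) (Op ι) := ⟨fun c a b => by
  obtain ⟨M, ha⟩ := exists_ordLE a
  obtain ⟨K, hb⟩ := exists_ordLE b
  ext1 r
  rw [smul_eq_mul, smul_eq_mul, coeff_smul, coeff_mul_eq ha hb le_rfl le_rfl,
    coeff_mul_eq (ha.smul c) hb le_rfl le_rfl, Finset.smul_sum]
  exact Finset.sum_congr rfl fun i _ => by rw [coeff_smul, smul_mul_assoc]⟩

instance : SMulCommClass ℂ (Op ι) (Op ι) := ⟨fun c a b => by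
  obtain ⟨M, ha⟩ := exists_ordLE a
  obtain ⟨K, hb⟩ := exists_ordLE b
  ext1 r
  rw [smul_eq_mul, smul_eq_mul, coeff_smul, coeff_mul_eq ha hb le_rfl le_rfl,
    coeff_mul_eq ha (hb.smul c) le_rfl le_rfl, Finset.smul_sum]
  exact Finset.sum_congr rfl fun i _ => by rw [T_smul, coeff_smul, mul_smul_comm]⟩

lemma pow_eq (a : Op ι) (k : ℕ) : a.pow k = a ^ k := by
  induction k with
  | zero => rw [pow_zero]; rfl
  | succ k ih => rw [_root_.pow_succ, ← ih]; rfl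

/-- Left multiplication by `D_θ^k` is the product with the monomial `D_θ^k`. -/
lemma mono_one_mul (k : ℤ) (b : Op ι) : mono 1 k * b = T k b := by
  ext1 r
  rw [coeff_mono_mul, one_mul]

end Op

attribute [local instance] Op.ring

/-! ### Parity, supertrace, and the Lie-Poisson bracket -/

namespace Op

variable {ι : Type*}

lemma coeff_zsmul (n : ℤ) (a : Op ι) (j : ℤ) : (n • a).coeff j = n • a.coeff j :=
  map_zsmul (coeffL j) n a

/-- The sign `(-1)^j`. -/
def eps (j : ℤ) : ℤ := j.negOnePow

lemma eps_add (i j : ℤ) : eps (i + j) = eps i * eps j := by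
  simp [eps, Int.negOnePow_add]

lemma eps_mul_self (i : ℤ) : eps i * eps i = 1 := by
  rw [← eps_add, eps, Int.negOnePow_even _ ⟨i, rfl⟩, Units.val_one]

lemma eps_sub (i j : ℤ) : eps (i - j) = eps i * eps j := by
  rw [eps, Int.negOnePow_sub, Units.val_mul, eps, eps]

lemma eps_natCast (j : ℕ) : eps j = (-1) ^ j := by
  simp [eps, Int.negOnePow_def]

lemma eps_even {j : ℤ} (h : Even j) : eps j = 1 := by rw [eps, Int.negOnePow_even j h, Units.val_one]

lemma eps_odd {j : ℤ} (h : Odd j) : eps j = -1 := by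
  rw [eps, Int.negOnePow_odd j h, Units.val_neg, Units.val_one]

lemma _root_.SuperLax.SF.hasParity_iff_eps {p : ℤ} {a : SF ι} :
    a.HasParity p ↔ a.par = eps p • a := SF.hasParity_iff

lemma par_leibniz (k : ℤ) (j : ℕ) (u : SF ι) :
    (leibniz k j u).par = eps j • leibniz k j u.par := by
  rw [leibniz_eq, SF.par_zsmul, SF.par_iterate_D, ← parPow_par, leibniz_eq, eps_natCast,
    smul_comm]

/-- The parity automorphism of the algebra of operators (`D_θ` is odd). -/
def parOp (a : Op ι) : Op ι :=
  ⟨fun j => eps j • (a.coeff j).par, by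
    obtain ⟨K, hK⟩ := exists_ordLE a
    refine ⟨K, fun r hr => ?_⟩
    dsimp only
    rw [hK _ hr, SF.par_zero, smul_zero]⟩

lemma coeff_parOp (a : Op ι) (j : ℤ) : (parOp a).coeff j = eps j • (a.coeff j).par := rfl

lemma OrdLE.parOp {K : ℤ} {a : Op ι} (h : OrdLE K a) : OrdLE K (parOp a) := fun r hr => by
  rw [coeff_parOp, h _ hr, SF.par_zero, smul_zero]

lemma isEven_iff {a : Op ι} : a.IsEven ↔ parOp a = a := by
  constructor
  · intro h
    ext1 j
    rw [coeff_parOp, SF.hasParity_iff_eps.1 (h j), smul_smul, eps_mul_self, one_smul]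
  · intro h j
    have hj := congrArg (fun b => coeff b j) h
    simp only [coeff_parOp] at hj
    rw [SF.hasParity_iff_eps]
    calc (a.coeff j).par = (eps j * eps j) • (a.coeff j).par := by rw [eps_mul_self, one_smul]
      _ = eps j • a.coeff j := by rw [mul_smul, hj]

lemma parOp_parOp (a : Op ι) : parOp (parOp a) = a := by
  ext1 j
  rw [coeff_parOp, coeff_parOp, SF.par_zsmul, smul_smul, eps_mul_self, one_smul, SF.par_par]

lemma parOp_add (a b : Op ι) : parOp (a + b) = parOp a + parOp b := by
  ext1 j
  rw [coeff_add, coeff_parOp, coeff_parOp, coeff_parOp, coeff_add, SF.par_add, smul_add]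

lemma parOp_smul (c : ℂ) (a : Op ι) : parOp (c • a) = c • parOp a := by
  ext1 j
  rw [coeff_smul, coeff_parOp, coeff_parOp, coeff_smul, SF.par_smul, smul_comm]

/-- The parity automorphism as a linear map. -/
def parOpL : Op ι →ₗ[ℂ] Op ι where
  toFun := parOp
  map_add' := parOp_add
  map_smul' := parOp_smul

@[simp] lemma parOpL_apply (a : Op ι) : parOpL a = parOp a := rfl

lemma parOp_T (k : ℤ) (b : Op ι) : parOp (T k b) = eps k • T k (parOp b) := by
  obtain ⟨K, hK⟩ := exists_ordLE b
  ext1 r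
  obtain ⟨n, hn⟩ := exists_nat_gt_sub K (r - k)
  rw [coeff_parOp, coeff_zsmul, coeff_T hK k r hn, coeff_T hK.parOp k r hn, SF.par_sum,
    Finset.smul_sum, Finset.smul_sum]
  refine Finset.sum_congr rfl fun j _ => ?_
  rw [par_leibniz, coeff_parOp, ← leibnizL_apply k j (eps _ • _), map_zsmul, leibnizL_apply,
    smul_smul, smul_smul]
  congr 1
  rw [eps_add, eps_sub]
  linear_combination (-eps r * eps j) * eps_mul_self k

lemma parOp_mul (a b : Op ι) : parOp (a * b) = parOp a * parOp b := by
  obtain ⟨M, ha⟩ := exists_ordLE a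
  obtain ⟨K, hb⟩ := exists_ordLE b
  ext1 r
  rw [coeff_parOp, coeff_mul_eq ha hb le_rfl le_rfl, coeff_mul_eq ha.parOp hb.parOp le_rfl le_rfl,
    SF.par_sum, Finset.smul_sum]
  refine Finset.sum_congr rfl fun i _ => ?_
  have h := congrArg (fun x => coeff x r) (parOp_T i b)
  simp only [coeff_parOp, coeff_zsmul] at h
  rw [SF.par_mul, ← mul_smul_comm, h, coeff_parOp, smul_mul_assoc, mul_smul_comm]

lemma parOp_one : parOp (1 : Op ι) = 1 := by
  ext1 j
  rw [coeff_parOp, coeff_one]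
  split_ifs with h
  · rw [h, SF.par_one, eps_even (by decide), one_smul]
  · rw [SF.par_zero, smul_zero]

lemma parOp_pow (a : Op ι) (k : ℕ) : parOp (a ^ k) = parOp a ^ k := by
  induction k with
  | zero => rw [_root_.pow_zero, _root_.pow_zero, parOp_one]
  | succ k ih => rw [_root_.pow_succ, _root_.pow_succ, parOp_mul, ih]

namespace IsEven

variable {a b : Op ι}

lemma add (ha : a.IsEven) (hb : b.IsEven) : (a + b).IsEven := by
  rw [isEven_iff] at *; rw [parOp_add, ha, hb]

lemma neg (ha : a.IsEven) : (-a).IsEven := by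
  rw [isEven_iff] at *; rw [← parOpL_apply, map_neg, parOpL_apply, ha]

lemma sub (ha : a.IsEven) (hb : b.IsEven) : (a - b).IsEven := by
  rw [sub_eq_add_neg]; exact ha.add hb.neg

lemma smul (c : ℂ) (ha : a.IsEven) : (c • a).IsEven := by
  rw [isEven_iff] at *; rw [parOp_smul, ha]

lemma mul (ha : a.IsEven) (hb : b.IsEven) : (a * b).IsEven := by
  rw [isEven_iff] at *; rw [parOp_mul, ha, hb]

lemma pow (ha : a.IsEven) (k : ℕ) : (a ^ k).IsEven := by
  rw [isEven_iff] at *; rw [parOp_pow, ha]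

lemma comm (ha : a.IsEven) (hb : b.IsEven) : (comm a b).IsEven := (ha.mul hb).sub (hb.mul ha)

lemma sum {α : Type*} {s : Finset α} {f : α → Op ι} (h : ∀ i ∈ s, (f i).IsEven) :
    (∑ i ∈ s, f i).IsEven := by
  rw [isEven_iff, ← parOpL_apply, map_sum]
  exact Finset.sum_congr rfl fun i hi => isEven_iff.1 (h i hi)

lemma mono {u : SF ι} {k : ℤ} (h : u.HasParity k) : (mono u k).IsEven := fun j => by
  rw [coeff_mono]
  split_ifs with hj
  · rw [hj]; exact h
  · rw [SF.hasParity_iff_eps, SF.par_zero, smul_zero]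

end IsEven

/-! #### The supertrace -/

/-- The supertrace `∫ dx dθ res a`. -/
def tr : Op ι →ₗ[ℂ] Grass ι := SF.berezinL ∘ₗ coeffL (-1)

lemma tr_apply (a : Op ι) : tr a = (a.coeff (-1)).berezin := rfl

lemma form_eq (a b : Op ι) : form a b = tr (a * b) := rfl

lemma tr_eq_zero_of_ordLE {K : ℤ} {a : Op ι} (h : OrdLE K a) (hK : K < -1) : tr a = 0 := by
  rw [tr_apply, h _ hK]
  exact SF.berezinL.map_zero

lemma mono_mul_mono_one (u : SF ι) (k l : ℤ) : mono u k * mono 1 l = mono u (k + l) := by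
  ext1 r
  rw [coeff_mono_mul, T_mono_one, coeff_mono, coeff_mono, mul_ite, mul_one, mul_zero]

lemma coeff_mul_mono_one (a : Op ι) (k r : ℤ) : (a * mono 1 k).coeff r = a.coeff (r - k) := by
  obtain ⟨M, hM⟩ := exists_ordLE a
  rw [coeff_mul_eq hM (OrdLE.mono 1 k) le_rfl (le_max_right (r - k) M),
    Finset.sum_eq_single_of_mem (r - k) (Finset.mem_Icc.2 ⟨le_rfl, le_max_left _ _⟩)]
  · rw [T_mono_one, sub_add_cancel, coeff_mono_self, mul_one]
  · intro i _ hi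
    rw [T_mono_one, coeff_mono, if_neg (by omega), mul_zero]

lemma coeff_neg_one_mul_fun (y : Op ι) (u : SF ι) :
    (y * mono u 0).coeff (-1) = y.coeff (-1) * u.par := by
  obtain ⟨M, hM⟩ := exists_ordLE y
  rw [coeff_mul_eq hM (OrdLE.mono u 0) le_rfl (le_max_right (-1) M),
    Finset.sum_eq_single_of_mem (-1) (Finset.mem_Icc.2 ⟨by simp, le_max_left _ _⟩)]
  · have := coeff_T_mono u (-1) 0 0
    rw [show (-1 : ℤ) + 0 - (0 : ℕ) = -1 by simp] at this
    rw [this, leibniz_zero_right, parPow, if_neg (by decide)]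
  · intro i hi hi'
    rw [Finset.mem_Icc] at hi
    have h0 : 0 ≤ i := by omega
    lift i to ℕ using h0
    have := coeff_T_mono u i 0 (i + 1)
    rw [show (i : ℤ) + 0 - ((i + 1 : ℕ) : ℤ) = -1 by push_cast; ring] at this
    rw [this, leibniz_eq, superChoose_eq_zero_of_lt (by positivity) (by push_cast; omega),
      zero_smul, mul_zero]

/-- Rotating `D_θ` through the supertrace. -/
lemma tr_D_mul (y : Op ι) : tr (mono 1 1 * y) = tr (parOp y * mono 1 1) := by
  rw [tr_apply, tr_apply, mono_one_mul, coeff_mul_mono_one, coeff_parOp]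
  have h := dOp_T 0 y
  rw [T_zero, zero_add] at h
  rw [← h, coeff_dOp, eps_even (by decide), one_smul]
  change SF.berezinL _ = _
  rw [map_add, SF.berezinL_apply, SF.berezin_D, zero_add]
  rfl

lemma tr_fun_mul_of_even {u : SF ι} (hu : u.par = u) (y : Op ι) :
    tr (mono u 0 * y) = tr (y * mono u 0) := by
  rw [tr_apply, tr_apply, coeff_neg_one_mul_fun, coeff_mono_mul, T_zero, hu, SF.even_comm hu]

lemma tr_fun_mul_of_odd {u : SF ι} (hu : u.par = -u) (y : Op ι) :
    tr (mono u 0 * y) = tr (parOp y * mono u 0) := by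
  rw [tr_apply, tr_apply, coeff_neg_one_mul_fun, coeff_mono_mul, T_zero, hu, SF.odd_comm hu,
    coeff_parOp, eps_odd (by decide), neg_one_smul, neg_mul_neg]

lemma parOp_mono (u : SF ι) (k : ℤ) : parOp (mono u k) = eps k • mono u.par k := by
  ext1 j
  rw [coeff_parOp, coeff_zsmul, coeff_mono, coeff_mono]
  split_ifs with h
  · rw [h]
  · rw [SF.par_zero, smul_zero, smul_zero]

/-- `x` may be rotated through the supertrace. -/
def IsTracial (x : Op ι) : Prop := ∀ y, tr (x * y) = tr (y * x)

lemma IsTracial.mul {x x' : Op ι} (h : IsTracial x) (h' : IsTracial x') :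
    IsTracial (x * x') := fun y => by
  rw [mul_assoc, h, mul_assoc, h', mul_assoc]

lemma isTracial_mono_even {u : SF ι} (hu : u.par = u) : IsTracial (mono u 0) :=
  tr_fun_mul_of_even hu

lemma isTracial_mono_odd {u : SF ι} (hu : u.par = -u) : IsTracial (mono u 1) := fun y => by
  have hm : mono u 1 = mono u 0 * mono 1 1 := by rw [mono_mul_mono_one, zero_add]
  have hneg : mono (-u) 0 = -mono u 0 := by
    ext1 j
    rw [coeff_neg, coeff_mono, coeff_mono]
    split_ifs <;> simp
  rw [hm, mul_assoc, tr_fun_mul_of_odd hu, parOp_mul, parOp_mono, eps_odd (by decide), neg_one_smul,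
    SF.par_one, neg_mul, neg_mul, map_neg, mul_assoc, tr_D_mul, parOp_mul, parOp_parOp, parOp_mono,
    eps_even (by decide), one_smul, hu, hneg, mul_neg, neg_mul, map_neg, neg_neg, mul_assoc]

lemma isTracial_D_two : IsTracial (mono (1 : SF ι) 2) := fun y => by
  have hm : mono (1 : SF ι) 2 = mono 1 1 * mono 1 1 := by rw [mono_mul_mono_one]; norm_num
  have h1 : parOp (mono (1 : SF ι) 1) = -mono 1 1 := by
    rw [parOp_mono, eps_odd (by decide), neg_one_smul, SF.par_one]
  rw [hm, mul_assoc, tr_D_mul, parOp_mul, h1, neg_mul, neg_mul, map_neg, mul_assoc, tr_D_mul,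
    parOp_mul, parOp_parOp, h1, mul_neg, neg_mul, map_neg, neg_neg, mul_assoc]

lemma isTracial_D_neg_two : IsTracial (mono (1 : SF ι) (-2)) := fun y => by
  have e1 : mono (1 : SF ι) 2 * mono 1 (-2) = 1 := by rw [mono_mul_mono_one]; rfl
  have e2 : mono (1 : SF ι) (-2) * mono 1 2 = 1 := by rw [mono_mul_mono_one]; rfl
  have h := isTracial_D_two (mono (1 : SF ι) (-2) * y * mono 1 (-2))
  rw [← mul_assoc, ← mul_assoc, e1, one_mul, mul_assoc _ (mono 1 (-2)), e2, mul_one] at h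
  exact h.symm

lemma isTracial_D_even (k : ℤ) : IsTracial (mono (1 : SF ι) (2 * k)) := by
  induction k using Int.induction_on with
  | zero => exact isTracial_mono_even SF.par_one
  | succ n ih =>
    have h := ih.mul isTracial_D_two
    rwa [mono_mul_mono_one, ← mul_add_one] at h
  | pred n ih =>
    have h := ih.mul isTracial_D_neg_two
    rwa [mono_mul_mono_one, ← sub_eq_add_neg, ← mul_sub_one] at h

lemma isTracial_mono {u : SF ι} {k : ℤ} (h : u.HasParity k) : IsTracial (mono u k) := by
  rw [SF.hasParity_iff_eps] at h
  rcases Int.even_or_odd' k with ⟨j, hj | hj⟩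
  · rw [eps_even ⟨j, by rw [hj]; ring⟩, one_smul] at h
    have := (isTracial_mono_even h).mul (isTracial_D_even j)
    rwa [mono_mul_mono_one, zero_add, ← hj] at this
  · rw [eps_odd ⟨j, hj⟩, neg_one_smul] at h
    have := (isTracial_mono_odd h).mul (isTracial_D_even j)
    rwa [mono_mul_mono_one, add_comm, ← hj] at this

/-- The supertrace property: even operators may be rotated through the supertrace. -/
lemma IsEven.isTracial {x : Op ι} (hx : x.IsEven) : IsTracial x := fun y => by
  obtain ⟨M, hM⟩ := exists_ordLE x
  obtain ⟨K, hK⟩ := exists_ordLE y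
  -- below the order `-1 - K` the coefficients of `x` do not contribute to either trace
  set s := ∑ i ∈ Finset.Icc (-1 - K) M, Op.mono (x.coeff i) i with hs
  have hrest : OrdLE (-2 - K) (x - s) := fun r hr => by
    have hsr : s.coeff r = ∑ i ∈ Finset.Icc (-1 - K) M, if r = i then x.coeff i else 0 := by
      rw [hs, coeff_sum]; rfl
    rw [coeff_sub, hsr, Finset.sum_ite_eq]
    split_ifs with h
    · exact sub_self _
    · rw [Finset.mem_Icc] at h
      rw [hM r (by omega), sub_zero]
  have hsum : tr (s * y) = tr (y * s) := by
    rw [hs, Finset.sum_mul, Finset.mul_sum, map_sum, map_sum]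
    exact Finset.sum_congr rfl fun i _ => isTracial_mono (hx i) y
  have h1 : tr ((x - s) * y) = 0 := tr_eq_zero_of_ordLE (hrest.mul hK) (by omega)
  have h2 : tr (y * (x - s)) = 0 := tr_eq_zero_of_ordLE (hK.mul hrest) (by omega)
  rw [sub_mul, map_sub, sub_eq_zero] at h1
  rw [mul_sub, map_sub, sub_eq_zero] at h2
  rw [h1, h2, hsum]

/-! #### The subalgebras of differential and of integral operators -/

lemma coeff_pos (a : Op ι) (j : ℤ) : a.pos.coeff j = if 0 ≤ j then a.coeff j else 0 := rfl

lemma coeff_neg_part (a : Op ι) (j : ℤ) : a.neg.coeff j = if 0 ≤ j then 0 else a.coeff j := by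
  rw [neg, coeff_sub, coeff_pos]
  split_ifs <;> simp

lemma pos_add_neg (a : Op ι) : a.pos + a.neg = a := add_sub_cancel _ _

lemma ordLE_neg (a : Op ι) : OrdLE (-1) a.neg := fun j hj => by
  rw [coeff_neg_part, if_pos (by omega)]

/-- `a` is a differential operator. -/
def IsDiff (a : Op ι) : Prop := ∀ j < 0, a.coeff j = 0

lemma isDiff_pos (a : Op ι) : IsDiff a.pos := fun j hj => by
  rw [coeff_pos, if_neg (by omega)]

lemma IsDiff.pos_eq {a : Op ι} (h : IsDiff a) : a.pos = a := by
  ext1 j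
  rw [coeff_pos]
  split_ifs with hj
  · rfl
  · rw [h j (by omega)]

lemma OrdLE.pos_eq {K : ℤ} {a : Op ι} (h : OrdLE K a) (hK : K ≤ -1) : a.pos = 0 := by
  ext1 j
  rw [coeff_pos, coeff_zero]
  split_ifs with hj
  · exact h j (by omega)
  · rfl

lemma IsDiff.sub {a b : Op ι} (ha : IsDiff a) (hb : IsDiff b) : IsDiff (a - b) := fun j hj => by
  rw [coeff_sub, ha j hj, hb j hj, sub_zero]

lemma IsDiff.mul {a b : Op ι} (ha : IsDiff a) (hb : IsDiff b) : IsDiff (a * b) := fun r hr => by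
  obtain ⟨M, hM⟩ := exists_ordLE a
  obtain ⟨K, hK⟩ := exists_ordLE b
  rw [coeff_mul_eq hM hK le_rfl le_rfl]
  refine Finset.sum_eq_zero fun i _ => ?_
  by_cases hi : i < 0
  · rw [ha i hi, zero_mul]
  · obtain ⟨n, hn⟩ := exists_nat_gt_sub K (r - i)
    rw [coeff_T hK i r hn, Finset.sum_eq_zero, mul_zero]
    intro j _
    by_cases hj : r - i + j < 0
    · rw [hb _ hj, leibniz_zero]
    · rw [leibniz_eq, superChoose_eq_zero_of_lt (by omega) (by omega), zero_smul]

lemma IsDiff.comm {a b : Op ι} (ha : IsDiff a) (hb : IsDiff b) : IsDiff (comm a b) :=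
  (ha.mul hb).sub (hb.mul ha)

lemma OrdLE.comm {M K : ℤ} {a b : Op ι} (ha : OrdLE M a) (hb : OrdLE K b) :
    OrdLE (M + K) (comm a b) :=
  (ha.mul hb).sub ((hb.mul ha).weaken (by omega))

lemma IsEven.pos {a : Op ι} (ha : a.IsEven) : a.pos.IsEven := fun j => by
  rw [coeff_pos]
  split_ifs
  · exact ha j
  · rw [SF.hasParity_iff_eps, SF.par_zero, smul_zero]

lemma IsEven.negPart {a : Op ι} (ha : a.IsEven) : a.neg.IsEven := ha.sub ha.pos

lemma IsEven.R {a : Op ι} (ha : a.IsEven) : (R a).IsEven := (ha.pos.sub ha.negPart).smul _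

lemma tr_isDiff {a : Op ι} (h : IsDiff a) : tr a = 0 := by
  rw [tr_apply, h _ (by norm_num)]
  exact SF.berezinL.map_zero

/-! #### The bracket `[·, ·]_R` -/

/-- The `R`-bracket is the difference of the brackets of the two subalgebras. -/
lemma commR_eq (a b : Op ι) : commR a b = comm a.pos b.pos - comm a.neg b.neg := by
  have hR : ∀ x y : Op ι, comm (R x) y = (1 / 2 : ℂ) • comm (x.pos - x.neg) y ∧
      comm y (R x) = (1 / 2 : ℂ) • comm y (x.pos - x.neg) := fun x y => by
    simp only [comm, R, smul_mul_assoc, mul_smul_comm, ← smul_sub, and_self]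
  have h : comm (a.pos - a.neg) (b.pos + b.neg) + comm (a.pos + a.neg) (b.pos - b.neg) =
      (2 : ℂ) • (comm a.pos b.pos - comm a.neg b.neg) := by
    rw [two_smul]
    unfold comm
    noncomm_ring
  rw [pos_add_neg, pos_add_neg] at h
  rw [commR, (hR a b).1, (hR b a).2, ← smul_add, h, smul_smul]
  norm_num

lemma pos_commR (a b : Op ι) : (commR a b).pos = comm a.pos b.pos := by
  ext1 j
  have h1 := (isDiff_pos a).comm (isDiff_pos b)
  have h2 := (ordLE_neg a).comm (ordLE_neg b)
  rw [coeff_pos, commR_eq, coeff_sub]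
  split_ifs with hj
  · rw [h2 j (by omega), sub_zero]
  · rw [h1 j (by omega)]

lemma neg_commR (a b : Op ι) : (commR a b).neg = -comm a.neg b.neg := by
  rw [neg, pos_commR, commR_eq]
  abel

lemma commR_jacobi (a b c : Op ι) :
    commR a (commR b c) + commR b (commR c a) + commR c (commR a b) = 0 := by
  simp only [commR_eq a (commR b c), commR_eq b (commR c a), commR_eq c (commR a b), pos_commR,
    neg_commR]
  unfold comm
  noncomm_ring

/-- `P_+` and `P_-` are adjoint to each other with respect to the trace form. -/
lemma form_R_right (a b : Op ι) : form a (R b) = -form (R a) b := by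
  have h1 : tr (a.pos * b.pos) = 0 := tr_isDiff ((isDiff_pos a).mul (isDiff_pos b))
  have h2 : tr (a.neg * b.neg) = 0 :=
    tr_eq_zero_of_ordLE ((ordLE_neg a).mul (ordLE_neg b)) (by norm_num)
  rw [form_eq, form_eq, R, R, mul_smul_comm, smul_mul_assoc, map_smul, map_smul, ← smul_neg]
  congr 1
  nth_rewrite 1 [← pos_add_neg a]
  nth_rewrite 3 [← pos_add_neg b]
  simp only [add_mul, mul_sub, sub_mul, mul_add, map_add, map_sub, h1, h2]
  abel

lemma form_comm_left {a l : Op ι} (ha : a.IsEven) (b : Op ι) :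
    form l (comm a b) = form (comm l a) b := by
  rw [form_eq, form_eq, comm, comm, mul_sub, sub_mul, map_sub, map_sub, mul_assoc, mul_assoc a,
    ha.isTracial (l * b), mul_assoc]

lemma form_commR {l a b : Op ι} (ha : a.IsEven) :
    form l (commR a b) = form (ExtSpace.Theta l a) b := by
  have hTheta : comm l (R a) - R (comm l a) = ExtSpace.Theta l a := by
    have e1 : ∀ x : Op ι, R x = x.pos - (1 / 2 : ℂ) • x := fun x => by
      have : x.pos - x.neg = (2 : ℂ) • x.pos - x := by
        rw [neg, two_smul]; abel
      rw [R, this, smul_sub, smul_smul]; norm_num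
    rw [e1, e1, ExtSpace.Theta]
    simp only [comm, mul_sub, sub_mul, mul_smul_comm, smul_mul_assoc, smul_sub]
    abel
  rw [← hTheta, commR]
  have e2 : form l (comm (R a) b + comm a (R b)) =
      form l (comm (R a) b) + form l (comm a (R b)) := by
    rw [form_eq, mul_add, map_add]; rfl
  rw [e2, form_comm_left ha.R, form_comm_left ha, form_R_right, form_eq, form_eq, form_eq, sub_mul,
    map_sub, sub_eq_add_neg]

end Op

/-! ### Roots and inverses of monic operators -/

namespace Op

variable {ι : Type*}

/-- `a = ∂^k + ∑_{j < 2k} a_j D_θ^j`, with no condition on parities. -/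
def IsLead (k : ℤ) (a : Op ι) : Prop := OrdLE (2 * k) a ∧ a.coeff (2 * k) = 1

lemma isMonic_iff {m : ℕ} {a : Op ι} : a.IsMonic m ↔ a.IsEven ∧ IsLead m a :=
  ⟨fun h => ⟨h.1, h.2.2, h.2.1⟩, fun h => ⟨h.1, h.2.2, h.2.1⟩⟩

lemma coeff_mul_top {M K : ℤ} {a b : Op ι} (ha : OrdLE M a) (hb : OrdLE K b) :
    (a * b).coeff (M + K) = a.coeff M * parPow M (b.coeff K) := by
  rw [coeff_mul_eq ha hb (lo := M) (by omega) le_rfl, Finset.Icc_self, Finset.sum_singleton,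
    coeff_T hb M (M + K) (n := 1) (by push_cast; omega), Finset.sum_range_one, leibniz_zero_right]
  simp

lemma parPow_one_right (k : ℤ) : parPow k (1 : SF ι) = 1 := by
  unfold parPow; split_ifs <;> simp

lemma parPow_even {k : ℤ} (hk : Even k) (u : SF ι) : parPow k u = u := if_pos hk

namespace IsLead

variable {k k' : ℤ} {a b : Op ι}

lemma coeff_mul_top_left (ha : IsLead k a) {K : ℤ} (hb : OrdLE K b) :
    (a * b).coeff (2 * k + K) = b.coeff K := by
  rw [coeff_mul_top ha.1 hb, ha.2, one_mul, parPow_even (even_two_mul k)]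

lemma coeff_mul_top_right (hb : IsLead k b) {M : ℤ} (ha : OrdLE M a) :
    (a * b).coeff (M + 2 * k) = a.coeff M := by
  rw [coeff_mul_top ha hb.1, hb.2, parPow_one_right, mul_one]

lemma mul (ha : IsLead k a) (hb : IsLead k' b) : IsLead (k + k') (a * b) := by
  refine ⟨(ha.1.mul hb.1).weaken (by linarith), ?_⟩
  rw [mul_add, ha.coeff_mul_top_left hb.1, hb.2]

lemma one : IsLead 0 (1 : Op ι) := ⟨OrdLE.one, rfl⟩

lemma pow (ha : IsLead k a) (n : ℕ) : IsLead (n * k) (a ^ n) := by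
  induction n with
  | zero =>
    rw [_root_.pow_zero, Nat.cast_zero, zero_mul]
    exact one
  | succ n ih =>
    rw [_root_.pow_succ, Nat.cast_succ, add_one_mul]
    exact ih.mul ha

lemma add_ordLE (ha : IsLead k a) {M : ℤ} (hb : OrdLE M b) (hM : M < 2 * k) :
    IsLead k (a + b) :=
  ⟨ha.1.add (hb.weaken hM.le), by rw [coeff_add, ha.2, hb _ hM, add_zero]⟩

end IsLead

/-- The first coefficient at which the `m`-th powers of two operators `∂ + ...` differ. -/
lemma pow_sub_pow {P Q : Op ι} (hP : IsLead 1 P) (hQ : IsLead 1 Q) {j : ℤ}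
    (h : OrdLE j (Q - P)) (m : ℕ) : OrdLE (2 * m - 2 + j) (Q ^ m - P ^ m) ∧
      (Q ^ m - P ^ m).coeff (2 * m - 2 + j) = (m : ℂ) • (Q - P).coeff j := by
  induction m with
  | zero =>
    rw [_root_.pow_zero, _root_.pow_zero, sub_self, Nat.cast_zero (R := ℂ), zero_smul]
    exact ⟨OrdLE.zero, rfl⟩
  | succ m ih =>
    have e : Q ^ (m + 1) - P ^ (m + 1) = (Q ^ m - P ^ m) * Q + P ^ m * (Q - P) := by
      rw [_root_.pow_succ, _root_.pow_succ]; noncomm_ring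
    have hPm := hP.pow m
    have h1 : (2 * ((m + 1 : ℕ) : ℤ) - 2 + j) = (2 * m - 2 + j) + 2 * 1 := by push_cast; ring
    have h2 : (2 * ((m + 1 : ℕ) : ℤ) - 2 + j) = 2 * (m * 1) + j := by push_cast; ring
    rw [e]
    constructor
    · refine OrdLE.add ?_ ?_
      · rw [h1]; exact ih.1.mul hQ.1
      · rw [h2]; exact hPm.1.mul h
    · rw [coeff_add]
      nth_rewrite 1 [h1]
      rw [h2, hQ.coeff_mul_top_right ih.1, hPm.coeff_mul_top_left h, ih.2, Nat.cast_succ, add_smul,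
        one_smul]

/-- The part of `a` of order greater than `j`. -/
def trunc (j : ℤ) (a : Op ι) : Op ι :=
  ⟨fun r => if j < r then a.coeff r else 0, by
    obtain ⟨K, hK⟩ := exists_ordLE a
    refine ⟨K, fun r hr => ?_⟩
    dsimp only
    rw [hK _ hr, ite_self]⟩

lemma coeff_trunc (j : ℤ) (a : Op ι) (r : ℤ) :
    (trunc j a).coeff r = if j < r then a.coeff r else 0 := rfl

lemma sub_trunc (j : ℤ) (a : Op ι) :
    OrdLE j (a - trunc j a) ∧ (a - trunc j a).coeff j = a.coeff j :=
  ⟨fun r hr => by rw [coeff_sub, coeff_trunc, if_pos hr, sub_self], by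
    rw [coeff_sub, coeff_trunc, if_neg (lt_irrefl j), sub_zero]⟩

lemma OrdLE.trunc {K : ℤ} {a : Op ι} (h : OrdLE K a) (j : ℤ) : OrdLE K (trunc j a) :=
  fun r hr => by rw [coeff_trunc, h _ hr, ite_self]

lemma IsLead.trunc {k : ℤ} {a : Op ι} (h : IsLead k a) {j : ℤ} (hj : j < 2 * k) :
    IsLead k (trunc j a) :=
  ⟨h.1.trunc j, by rw [coeff_trunc, if_pos hj, h.2]⟩

/-- Operators may be defined by recursion over their coefficients, from the top downwards. -/
lemma exists_recursive (M : ℤ) (F : ℤ → Op ι → SF ι) :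
    ∃ Q : Op ι, OrdLE M Q ∧ ∀ j ≤ M, Q.coeff j = F j (trunc j Q) := by
  let A : ℕ → Op ι := fun k => Nat.rec 0 (fun k a => a + mono (F (M - k) a) (M - k)) k
  have hA : ∀ k : ℕ, A (k + 1) = A k + mono (F (M - k) (A k)) (M - k) := fun k => rfl
  let Q : Op ι := ⟨fun j => if j ≤ M then F j (A (M - j).toNat) else 0, M,
    fun j hj => if_neg (by omega)⟩
  have hQ : ∀ j, Q.coeff j = if j ≤ M then F j (A (M - j).toNat) else 0 := fun j => rfl
  have hAQ : ∀ k : ℕ, A k = trunc (M - k) Q := fun k => by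
    induction k with
    | zero =>
      ext1 j
      rw [coeff_trunc, hQ]
      split_ifs with h1 h2
      · exact absurd h2 (by push_cast at h1; omega)
      · rfl
      · rfl
    | succ k ih =>
      ext1 j
      rw [hA, coeff_add]
      nth_rewrite 1 [ih]
      rw [coeff_trunc, coeff_trunc, coeff_mono]
      rcases lt_trichotomy j (M - k) with h | h | h
      · rw [if_neg (by omega), if_neg (by omega), if_neg (by push_cast; omega), add_zero]
      · rw [if_neg (by omega), if_pos h, if_pos (by push_cast; omega), zero_add, hQ,
          if_pos (by omega), h]
        congr 2
        omega
      · rw [if_pos (by omega), if_neg (by omega), if_pos (by push_cast; omega), add_zero]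
  refine ⟨Q, fun j hj => if_neg (by omega), fun j hj => ?_⟩
  have h := hAQ (M - j).toNat
  rw [show M - ((M - j).toNat : ℤ) = j by omega] at h
  rw [hQ, if_pos hj, h]

lemma IsLead.exists_right_inverse {k : ℤ} {x : Op ι} (hx : IsLead k x) :
    ∃ Q, IsLead (-k) Q ∧ x * Q = 1 := by
  obtain ⟨Q, hQ, hrec⟩ := exists_recursive (2 * -k)
    fun j A => if j = 2 * -k then 1 else -(x * A).coeff (2 * k + j)
  have hlead : IsLead (-k) Q := ⟨hQ, by rw [hrec _ le_rfl, if_pos rfl]⟩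
  refine ⟨Q, hlead, ?_⟩
  have hmul := hx.mul hlead
  rw [add_neg_cancel] at hmul
  ext1 r
  rcases lt_trichotomy 0 r with h | h | h
  · rw [hmul.1 r (by simpa using h), OrdLE.one r h]
  · subst h
    exact hmul.2.trans rfl
  · obtain ⟨j, rfl⟩ : ∃ j, r = 2 * k + j := ⟨r - 2 * k, by ring⟩
    obtain ⟨h1, h2⟩ := sub_trunc j Q
    have e : x * Q = x * Op.trunc j Q + x * (Q - Op.trunc j Q) := by rw [← mul_add, add_sub_cancel]
    rw [e, coeff_add, hx.coeff_mul_top_left h1, h2, hrec j (by omega), if_neg (by omega),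
      add_neg_cancel, coeff_one, if_neg (by omega)]

/-- Monic operators are invertible. -/
lemma IsLead.exists_inverse {k : ℤ} {x : Op ι} (hx : IsLead k x) :
    ∃ Q, x * Q = 1 ∧ Q * x = 1 := by
  obtain ⟨Q, hQ, h⟩ := hx.exists_right_inverse
  obtain ⟨y, -, hy⟩ := hQ.exists_right_inverse
  have : x = y := left_inv_eq_right_inv h hy
  exact ⟨Q, h, this ▸ hy⟩

/-- The recursion for the coefficients of an `m`-th root. -/
lemma coeff_root {m : ℕ} (hm : 1 ≤ m) {P : Op ι} (hP : IsLead 1 P) {j : ℤ} (hj : j < 2) :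
    P.coeff j = (1 / (m : ℂ)) •
      ((P ^ m).coeff (2 * m - 2 + j) - (trunc j P ^ m).coeff (2 * m - 2 + j)) := by
  have hm0 : (m : ℂ) ≠ 0 := by exact_mod_cast (by omega : m ≠ 0)
  obtain ⟨h1, h2⟩ := sub_trunc j P
  have h := (pow_sub_pow (hP.trunc (by omega)) hP h1 m).2
  rw [coeff_sub, h2] at h
  rw [h, smul_smul, one_div, inv_mul_cancel₀ hm0, one_smul]

lemma root_unique {m : ℕ} (hm : 1 ≤ m) {P Q : Op ι} (hP : IsLead 1 P) (hQ : IsLead 1 Q)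
    (h : P ^ m = Q ^ m) : P = Q := by
  have hm0 : (m : ℂ) ≠ 0 := by exact_mod_cast (by omega : m ≠ 0)
  have hord : ∀ n : ℕ, OrdLE (2 - n) (Q - P) := fun n => by
    induction n with
    | zero =>
      rw [Nat.cast_zero, sub_zero]
      exact hQ.1.sub hP.1
    | succ n ih =>
      have h2 := (pow_sub_pow hP hQ ih m).2
      rw [h, sub_self, coeff_zero] at h2
      have h0 := (smul_eq_zero.1 h2.symm).resolve_left hm0
      intro r hr
      push_cast at hr
      rcases eq_or_lt_of_le (show 2 - (n : ℤ) ≤ r by omega) with h3 | h3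
      · rw [← h3]; exact h0
      · exact ih r h3
  ext1 r
  have := hord (3 - r).toNat r (by omega)
  rw [coeff_sub, sub_eq_zero] at this
  exact this.symm

lemma exists_root {m : ℕ} (hm : 1 ≤ m) {l : Op ι} (hl : IsLead m l) :
    ∃ P, IsLead 1 P ∧ P ^ m = l := by
  have hm0 : (m : ℂ) ≠ 0 := by exact_mod_cast (by omega : m ≠ 0)
  obtain ⟨P, hP, hrec⟩ := exists_recursive (2 * 1) fun j A => if j = 2 * 1 then 1 else
    (1 / (m : ℂ)) • (l.coeff (2 * m - 2 + j) - (A ^ m).coeff (2 * m - 2 + j))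
  have hlead : IsLead 1 P := ⟨hP, by rw [hrec _ le_rfl, if_pos rfl]⟩
  refine ⟨P, hlead, ?_⟩
  have hpow := hlead.pow m
  rw [mul_one] at hpow
  ext1 r
  rcases lt_trichotomy (2 * (m : ℤ)) r with h | h | h
  · rw [hpow.1 r h, hl.1 r h]
  · rw [← h, hpow.2, hl.2]
  · obtain ⟨j, rfl⟩ : ∃ j, r = 2 * m - 2 + j := ⟨r - (2 * m - 2), by ring⟩
    have h1 := coeff_root hm hlead (j := j) (by omega)
    have h2 := hrec j (by omega)
    rw [if_neg (by omega), h1] at h2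
    have h3 := smul_right_injective _ (one_div_ne_zero hm0) h2
    exact sub_left_injective h3

lemma IsLead.parOp {k : ℤ} {a : Op ι} (h : IsLead k a) : IsLead k (parOp a) :=
  ⟨h.1.parOp, by rw [coeff_parOp, h.2, SF.par_one, eps_even (even_two_mul k), one_smul]⟩

lemma isRoot_iff {m : ℕ} {l P : Op ι} : IsRoot m l P ↔ P.IsEven ∧ IsLead 1 P ∧ P ^ m = l := by
  rw [IsRoot, isMonic_iff, pow_eq, and_assoc]
  rfl

/-- A monic operator has exactly one monic `m`-th root; it is even because its image under the
parity automorphism is a root as well. -/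
lemma existsUnique_isRoot {m : ℕ} (hm : 1 ≤ m) {l : Op ι} (hl : l.IsMonic m) :
    ∃! P, IsRoot m l P := by
  rw [isMonic_iff] at hl
  obtain ⟨P, hP, h⟩ := exists_root hm hl.2
  refine ⟨P, isRoot_iff.2 ⟨isEven_iff.2 ?_, hP, h⟩, fun Q hQ => ?_⟩
  · refine root_unique hm hP.parOp hP ?_
    rw [← parOp_pow, h, isEven_iff.1 hl.1]
  · replace hQ := isRoot_iff.1 hQ
    exact root_unique hm hQ.2.1 hP (hQ.2.2.trans h.symm)

lemma isRoot_root {m : ℕ} (hm : 1 ≤ m) {l : Op ι} (hl : l.IsMonic m) : IsRoot m l (root m l) := by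
  have h := (existsUnique_isRoot hm hl).exists
  rw [root, dif_pos h]
  exact h.choose_spec

end Op

/-! ### Calculus of curves -/

section TwoVariables

variable {F : ℝ × ℝ → ℂ}

lemma hasDerivAt_fst (hF : ContDiff ℝ ∞ F) (s x : ℝ) :
    HasDerivAt (fun s => F (s, x)) (fderiv ℝ F (s, x) (1, 0)) s :=
  HasFDerivAt.comp_hasDerivAt (l := F) (f := fun s => (s, x)) s
    (hF.differentiable (by simp) (s, x)).hasFDerivAt
    ((hasDerivAt_id s).prodMk (hasDerivAt_const s x))

lemma hasDerivAt_snd (hF : ContDiff ℝ ∞ F) (s x : ℝ) :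
    HasDerivAt (fun x => F (s, x)) (fderiv ℝ F (s, x) (0, 1)) x :=
  HasFDerivAt.comp_hasDerivAt (l := F) (f := fun x => (s, x)) x
    (hF.differentiable (by simp) (s, x)).hasFDerivAt
    ((hasDerivAt_const x s).prodMk (hasDerivAt_id x))

/-- Mixed partial derivatives commute. -/
lemma fderiv_fderiv_swap (hF : ContDiff ℝ ∞ F) (p a b : ℝ × ℝ) :
    fderiv ℝ (fun q => fderiv ℝ F q a) p b = fderiv ℝ (fun q => fderiv ℝ F q b) p a := by
  have h1 : ContDiff ℝ ∞ (fderiv ℝ F) := hF.fderiv_right (by simp)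
  have h2 : DifferentiableAt ℝ (fderiv ℝ F) p := h1.differentiable (by simp) p
  rw [fderiv_clm_apply h2 (differentiableAt_const a),
    fderiv_clm_apply h2 (differentiableAt_const b)]
  simp only [fderiv_fun_const, Pi.zero_apply, ContinuousLinearMap.comp_zero, zero_add,
    ContinuousLinearMap.flip_apply]
  exact (hF.contDiffAt (x := p)).isSymmSndFDerivAt
    (by simpa using WithTop.coe_le_coe.2 (le_top : (2 : ℕ∞) ≤ ⊤)) b a

end TwoVariables

/-- `c` is a smooth family of smooth functions on the circle, with derivative `d` at the
time `t`. -/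
def SmoothFamily (c : ℝ → smoothCircle) (d : smoothCircle) (t : ℝ) : Prop :=
  ContDiff ℝ ∞ (fun p : ℝ × ℝ => (c p.1).1 p.2) ∧
    ∀ x, HasDerivAt (fun s => (c s).1 x) (d.1 x) t

namespace SmoothFamily

variable {c c' : ℝ → smoothCircle} {d d' : smoothCircle} {t : ℝ}

lemma mul (h : SmoothFamily c d t) (h' : SmoothFamily c' d' t) :
    SmoothFamily (fun s => c s * c' s) (d * c' t + c t * d') t :=
  ⟨h.1.mul h'.1, fun x => (h.2 x).mul (h'.2 x)⟩

lemma const (φ : smoothCircle) (t : ℝ) : SmoothFamily (fun _ => φ) 0 t :=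
  ⟨φ.2.1.comp contDiff_snd, fun x => hasDerivAt_const t (φ.1 x)⟩

lemma ofReal_smul (φ : smoothCircle) (t : ℝ) : SmoothFamily (fun s => (s : ℂ) • φ) φ t := by
  constructor
  · exact (Complex.ofRealCLM.contDiff.comp contDiff_fst).mul (φ.2.1.comp contDiff_snd)
  · intro x
    have := (Complex.ofRealCLM.hasDerivAt (x := t)).mul_const (φ.1 x)
    simpa using this

lemma circleDeriv (h : SmoothFamily c d t) :
    SmoothFamily (fun s => circleDeriv (c s)) (circleDeriv d) t := by
  set F : ℝ × ℝ → ℂ := fun p => (c p.1).1 p.2 with hF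
  have hF' : ∀ a, ContDiff ℝ ∞ fun p => fderiv ℝ F p a := fun a =>
    (h.1.fderiv_right (by simp)).clm_apply contDiff_const
  have e1 : ∀ s x, (SuperLax.circleDeriv (c s)).1 x = fderiv ℝ F (s, x) (0, 1) := fun s x =>
    (hasDerivAt_snd h.1 s x).deriv
  have e2 : d.1 = fun x => fderiv ℝ F (t, x) (1, 0) := funext fun x =>
    (h.2 x).unique (hasDerivAt_fst h.1 t x)
  constructor
  · have : (fun p : ℝ × ℝ => (SuperLax.circleDeriv (c p.1)).1 p.2) =
        fun p => fderiv ℝ F p (0, 1) := funext fun p => e1 p.1 p.2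
    rw [this]
    exact hF' _
  · intro x
    have h1 := hasDerivAt_fst (hF' (0, 1)) t x
    have h2 := hasDerivAt_snd (hF' (1, 0)) t x
    have e3 : (SuperLax.circleDeriv d).1 x =
        fderiv ℝ (fun p => fderiv ℝ F p (1, 0)) (t, x) (0, 1) := by
      change deriv d.1 x = _
      rw [e2]
      exact h2.deriv
    rw [e3, fderiv_fderiv_swap h.1]
    simp only [e1]
    exact h1

/-- Differentiation under the integral sign. -/
lemma hasDerivAt_circleIntegral (h : SmoothFamily c d t) :
    HasDerivAt (fun s => circleIntegral (c s)) (circleIntegral d) t := by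
  set F : ℝ × ℝ → ℂ := fun p => (c p.1).1 p.2 with hF
  have hF' : Continuous fun p => fderiv ℝ F p (1, 0) :=
    (h.1.continuous_fderiv (by simp)).clm_apply continuous_const
  have hder : ∀ s x : ℝ, HasDerivAt (fun s => (c s).1 x) (fderiv ℝ F (s, x) (1, 0)) s := fun s x =>
    hasDerivAt_fst h.1 s x
  have e2 : d.1 = fun x => fderiv ℝ F (t, x) (1, 0) := funext fun x =>
    (h.2 x).unique (hder t x)
  obtain ⟨C, hC⟩ := ((isCompact_Icc (a := t - 1) (b := t + 1)).prod
    (isCompact_uIcc (a := (0 : ℝ)) (b := 2 * Real.pi))).exists_bound_of_continuousOn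
      hF'.continuousOn
  have key := (intervalIntegral.hasDerivAt_integral_of_dominated_loc_of_deriv_le
    (μ := MeasureTheory.volume) (a := 0) (b := 2 * Real.pi) (F := fun s x => (c s).1 x)
    (F' := fun s x => fderiv ℝ F (s, x) (1, 0)) (x₀ := t) (bound := fun _ => C)
    (Icc_mem_nhds (show t - 1 < t by linarith) (show t < t + 1 by linarith))
    (Filter.Eventually.of_forall fun s => (c s).2.1.continuous.aestronglyMeasurable)
    ((c t).2.1.continuous.intervalIntegrable _ _)
    (hF'.comp (by fun_prop : Continuous fun x : ℝ => (t, x))).aestronglyMeasurable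
    (Filter.Eventually.of_forall fun x hx s hs =>
      hC (s, x) ⟨hs, Set.uIoc_subset_uIcc hx⟩)
    intervalIntegrable_const
    (Filter.Eventually.of_forall fun x _ s _ => hder s x)).2
  have e3 : circleIntegral d = ∫ x in (0 : ℝ)..(2 * Real.pi), fderiv ℝ F (t, x) (1, 0) := by
    change ∫ x in (0 : ℝ)..(2 * Real.pi), d.1 x = _
    rw [e2]
  rw [e3]
  exact key

end SmoothFamily

namespace ExtSpace

variable {ι : Type*}

namespace HasGrassVelocity

variable {u u' : ℝ → GrassFun ι} {v v' : GrassFun ι} {t : ℝ}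

lemma of_fintype {κ : Type*} [Fintype κ] {c : κ → ℝ → smoothCircle} {d : κ → smoothCircle}
    {w : κ → Grass ι} (h : ∀ i, SmoothFamily (c i) (d i) t)
    (hu : ∀ᶠ s in nhds t, u s = ∑ i, c i s ⊗ₜ[ℂ] w i) (hv : v = ∑ i, d i ⊗ₜ[ℂ] w i) :
    HasGrassVelocity u v t := by
  let e := (Fintype.equivFin κ).symm
  refine ⟨Fintype.card κ, fun i => c (e i), fun i => d (e i), fun i => w (e i),
    fun i => (h (e i)).1, fun i => (h (e i)).2, ?_, ?_⟩
  · filter_upwards [hu] with s hs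
    rw [hs, ← Equiv.sum_comp e]
  · rw [hv, ← Equiv.sum_comp e]

lemma exists_family (h : HasGrassVelocity u v t) : ∃ (k : ℕ) (c : Fin k → ℝ → smoothCircle)
    (d : Fin k → smoothCircle) (w : Fin k → Grass ι), (∀ i, SmoothFamily (c i) (d i) t) ∧
    (∀ᶠ s in nhds t, u s = ∑ i, c i s ⊗ₜ[ℂ] w i) ∧ v = ∑ i, d i ⊗ₜ[ℂ] w i := by
  obtain ⟨k, c, d, w, h1, h2, h3, h4⟩ := h
  exact ⟨k, c, d, w, fun i => ⟨h1 i, h2 i⟩, h3, h4⟩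

lemma tmul {c : ℝ → smoothCircle} {d : smoothCircle} (h : SmoothFamily c d t) (w : Grass ι) :
    HasGrassVelocity (fun s => c s ⊗ₜ[ℂ] w) (d ⊗ₜ[ℂ] w) t :=
  of_fintype (κ := Unit) (c := fun _ => c) (d := fun _ => d) (w := fun _ => w) (fun _ => h)
    (Filter.Eventually.of_forall fun s => by simp) (by simp)

lemma zero (t : ℝ) : HasGrassVelocity (fun _ => (0 : GrassFun ι)) 0 t :=
  of_fintype (κ := Empty) (c := nofun) (d := nofun) (w := nofun) nofun
    (Filter.Eventually.of_forall fun s => by simp) (by simp)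

lemma add (h : HasGrassVelocity u v t) (h' : HasGrassVelocity u' v' t) :
    HasGrassVelocity (fun s => u s + u' s) (v + v') t := by
  obtain ⟨k, c, d, w, h1, h2, h3⟩ := h.exists_family
  obtain ⟨k', c', d', w', h1', h2', h3'⟩ := h'.exists_family
  refine of_fintype (κ := Fin k ⊕ Fin k') (c := Sum.elim c c') (d := Sum.elim d d')
    (w := Sum.elim w w') ?_ ?_ ?_
  · rintro (i | i)
    exacts [h1 i, h1' i]
  · filter_upwards [h2, h2'] with s hs hs'
    simp [hs, hs']
  · simp [h3, h3']

lemma const (g : GrassFun ι) (t : ℝ) : HasGrassVelocity (fun _ => g) 0 t := by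
  induction g using TensorProduct.induction_on with
  | zero => exact zero t
  | tmul φ w =>
    have := tmul (SmoothFamily.const φ t) w
    rwa [TensorProduct.zero_tmul] at this
  | add g g' h h' =>
    have := h.add h'
    rwa [add_zero] at this

lemma ofReal_smul (g : GrassFun ι) (t : ℝ) :
    HasGrassVelocity (fun s => (s : ℂ) • g) g t := by
  induction g using TensorProduct.induction_on with
  | zero => simpa using zero t
  | tmul φ w => exact tmul (SmoothFamily.ofReal_smul φ t) w
  | add g g' h h' =>
    simp only [smul_add]
    exact h.add h'

lemma mul (h : HasGrassVelocity u v t) (h' : HasGrassVelocity u' v' t) :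
    HasGrassVelocity (fun s => u s * u' s) (v * u' t + u t * v') t := by
  obtain ⟨k, c, d, w, h1, h2, h3⟩ := h.exists_family
  obtain ⟨k', c', d', w', h1', h2', h3'⟩ := h'.exists_family
  refine of_fintype (κ := Fin k × Fin k') (c := fun p s => c p.1 s * c' p.2 s)
    (d := fun p => d p.1 * c' p.2 t + c p.1 t * d' p.2)
    (w := fun p => w p.1 * w' p.2) (fun p => (h1 p.1).mul (h1' p.2)) ?_ ?_
  · filter_upwards [h2, h2'] with s hs hs'
    rw [hs, hs', Finset.sum_mul_sum, Fintype.sum_prod_type]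
    simp only [Algebra.TensorProduct.tmul_mul_tmul]
  · rw [h2.self_of_nhds, h2'.self_of_nhds, h3, h3', Finset.sum_mul_sum, Finset.sum_mul_sum,
      Fintype.sum_prod_type, ← Finset.sum_add_distrib]
    refine Finset.sum_congr rfl fun i _ => ?_
    rw [← Finset.sum_add_distrib]
    refine Finset.sum_congr rfl fun j _ => ?_
    rw [Algebra.TensorProduct.tmul_mul_tmul, Algebra.TensorProduct.tmul_mul_tmul,
      TensorProduct.add_tmul]

lemma map (h : HasGrassVelocity u v t) {A : smoothCircle →ₗ[ℂ] smoothCircle}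
    (hA : ∀ {c d}, SmoothFamily c d t → SmoothFamily (fun s => A (c s)) (A d) t)
    (B : Grass ι →ₗ[ℂ] Grass ι) :
    HasGrassVelocity (fun s => TensorProduct.map A B (u s)) (TensorProduct.map A B v) t := by
  obtain ⟨k, c, d, w, h1, h2, h3⟩ := h.exists_family
  refine of_fintype (c := fun i s => A (c i s)) (d := fun i => A (d i)) (w := fun i => B (w i))
    (fun i => hA (h1 i)) ?_ ?_
  · filter_upwards [h2] with s hs
    simp [hs]
  · simp [h3]

lemma smul (h : HasGrassVelocity u v t) (a : ℂ) :
    HasGrassVelocity (fun s => a • u s) (a • v) t := by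
  have h1 := h.map (A := LinearMap.id) (fun h => h) (a • LinearMap.id)
  simpa only [TensorProduct.map_smul_right, TensorProduct.map_id, LinearMap.smul_apply,
    LinearMap.id_apply] using h1

lemma parG (h : HasGrassVelocity u v t) :
    HasGrassVelocity (fun s => parG ι (u s)) (SuperLax.parG ι v) t :=
  h.map (A := LinearMap.id) (fun h => h) CliffordAlgebra.involute.toLinearMap

lemma derivG (h : HasGrassVelocity u v t) :
    HasGrassVelocity (fun s => derivG ι (u s)) (SuperLax.derivG ι v) t :=
  h.map (A := SuperLax.circleDeriv) (fun h => h.circleDeriv) LinearMap.id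

lemma hasDerivAt_integralG (h : HasGrassVelocity u v t) (φ : Module.Dual ℂ (Grass ι)) :
    HasDerivAt (fun s => φ (SF.integralG (u s))) (φ (SF.integralG v)) t := by
  obtain ⟨k, c, d, w, h1, h2, h3⟩ := h.exists_family
  have h4 : HasDerivAt (fun s => ∑ i, circleIntegral (c i s) * φ (w i))
      (∑ i, circleIntegral (d i) * φ (w i)) t :=
    HasDerivAt.fun_sum fun i _ => (h1 i).hasDerivAt_circleIntegral.mul_const _
  have h5 : φ (SF.integralG v) = ∑ i, circleIntegral (d i) * φ (w i) := by
    rw [h3, map_sum, map_sum]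
    exact Finset.sum_congr rfl fun i _ => by
      rw [SF.integralG_tmul, map_smul, smul_eq_mul]
  rw [h5]
  refine h4.congr_of_eventuallyEq ?_
  filter_upwards [h2] with s hs
  rw [hs, map_sum, map_sum]
  exact Finset.sum_congr rfl fun i _ => by
    rw [SF.integralG_tmul, map_smul, smul_eq_mul]

end HasGrassVelocity

namespace HasSFVelocity

variable {u u' : ℝ → SF ι} {v v' : SF ι} {t : ℝ}

lemma const (a : SF ι) (t : ℝ) : HasSFVelocity (fun _ => a) 0 t :=
  ⟨HasGrassVelocity.const a.1 t, HasGrassVelocity.const a.2 t⟩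

lemma add (h : HasSFVelocity u v t) (h' : HasSFVelocity u' v' t) :
    HasSFVelocity (fun s => u s + u' s) (v + v') t := ⟨h.1.add h'.1, h.2.add h'.2⟩

lemma smul (h : HasSFVelocity u v t) (a : ℂ) : HasSFVelocity (fun s => a • u s) (a • v) t :=
  ⟨h.1.smul a, h.2.smul a⟩

lemma neg (h : HasSFVelocity u v t) : HasSFVelocity (fun s => -u s) (-v) t := by
  have := h.smul (-1)
  simpa using this

lemma sub (h : HasSFVelocity u v t) (h' : HasSFVelocity u' v' t) :
    HasSFVelocity (fun s => u s - u' s) (v - v') t := by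
  simpa only [sub_eq_add_neg] using h.add h'.neg

lemma zsmul (h : HasSFVelocity u v t) (n : ℤ) : HasSFVelocity (fun s => n • u s) (n • v) t := by
  have := h.smul (n : ℂ)
  simpa only [Int.cast_smul_eq_zsmul] using this

lemma par (h : HasSFVelocity u v t) : HasSFVelocity (fun s => (u s).par) v.par t := by
  refine ⟨h.1.parG, ?_⟩
  have := h.2.parG.smul (-1)
  simpa using this

lemma D (h : HasSFVelocity u v t) : HasSFVelocity (fun s => (u s).D) v.D t :=
  ⟨h.2, h.1.derivG⟩

lemma mul (h : HasSFVelocity u v t) (h' : HasSFVelocity u' v' t) :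
    HasSFVelocity (fun s => u s * u' s) (v * u' t + u t * v') t := by
  refine ⟨h.1.mul h'.1, ?_⟩
  have h1 := (h.2.mul h'.1).add (h.1.parG.mul h'.2)
  have e : (v * u' t + u t * v').2 = v.2 * (u' t).1 + (u t).2 * v'.1 +
      (parG ι v.1 * (u' t).2 + parG ι (u t).1 * v'.2) := by
    simp only [SF.add_snd, SF.mul_snd]
    abel
  rw [e]
  exact h1

lemma sum {α : Type*} {s : Finset α} {u : α → ℝ → SF ι} {v : α → SF ι}
    (h : ∀ i ∈ s, HasSFVelocity (u i) (v i) t) :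
    HasSFVelocity (fun r => ∑ i ∈ s, u i r) (∑ i ∈ s, v i) t := by
  classical
  induction s using Finset.induction_on with
  | empty => simpa using const 0 t
  | insert a s ha ih =>
    simp only [Finset.sum_insert ha]
    exact (h a (Finset.mem_insert_self _ _)).add
      (ih fun i hi => h i (Finset.mem_insert_of_mem hi))

lemma leibniz (h : HasSFVelocity u v t) (k : ℤ) (j : ℕ) :
    HasSFVelocity (fun s => Op.leibniz k j (u s)) (Op.leibniz k j v) t := by
  have h1 : HasSFVelocity (fun s => Op.parPow (k - j) (u s)) (Op.parPow (k - j) v) t := by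
    unfold Op.parPow
    split_ifs
    exacts [h, h.par]
  have h2 : HasSFVelocity (fun s => SF.D^[j] (Op.parPow (k - j) (u s)))
      (SF.D^[j] (Op.parPow (k - j) v)) t := by
    generalize (k - j : ℤ) = i at h1
    clear h
    induction j with
    | zero => exact h1
    | succ j ih =>
      simp only [Function.iterate_succ_apply']
      exact ih.D
  exact h2.zsmul _

lemma ofReal_smul (a : SF ι) (t : ℝ) : HasSFVelocity (fun s => (s : ℂ) • a) a t :=
  ⟨HasGrassVelocity.ofReal_smul a.1 t, HasGrassVelocity.ofReal_smul a.2 t⟩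

lemma hasDerivAt_berezin (h : HasSFVelocity u v t) (φ : Module.Dual ℂ (Grass ι)) :
    HasDerivAt (fun s => φ (u s).berezin) (φ v.berezin) t := h.2.hasDerivAt_integralG φ

end HasSFVelocity

end ExtSpace

/-! ### The variation of the Casimir functionals -/

namespace Op

open ExtSpace

variable {ι : Type*}

/-- The curve `a` of operators of order at most `M` has velocity `v` at the time `t`. -/
structure HasOpVelocity (M : ℤ) (a : ℝ → Op ι) (v : Op ι) (t : ℝ) : Prop where
  ordLE : ∀ s, OrdLE M (a s)
  ordLE_velocity : OrdLE M v
  coeff : ∀ j, HasSFVelocity (fun s => (a s).coeff j) (v.coeff j) t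

namespace HasOpVelocity

variable {M K : ℤ} {a b : ℝ → Op ι} {v w : Op ι} {t : ℝ}

lemma const {x : Op ι} (hx : OrdLE M x) (t : ℝ) : HasOpVelocity M (fun _ => x) 0 t :=
  ⟨fun _ => hx, OrdLE.zero, fun j => HasSFVelocity.const (x.coeff j) t⟩

lemma ofReal_smul {x : Op ι} (hx : OrdLE M x) (t : ℝ) :
    HasOpVelocity M (fun s => (s : ℂ) • x) x t :=
  ⟨fun s => hx.smul s, hx, fun j => HasSFVelocity.ofReal_smul (x.coeff j) t⟩

lemma weaken (h : HasOpVelocity M a v t) (hMK : M ≤ K) : HasOpVelocity K a v t :=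
  ⟨fun s => (h.ordLE s).weaken hMK, h.ordLE_velocity.weaken hMK, h.coeff⟩

lemma add (h : HasOpVelocity M a v t) (h' : HasOpVelocity M b w t) :
    HasOpVelocity M (fun s => a s + b s) (v + w) t :=
  ⟨fun s => (h.ordLE s).add (h'.ordLE s), h.ordLE_velocity.add h'.ordLE_velocity,
    fun j => (h.coeff j).add (h'.coeff j)⟩

lemma sum {α : Type*} {s : Finset α} {a : α → ℝ → Op ι} {v : α → Op ι}
    (h : ∀ i ∈ s, HasOpVelocity M (a i) (v i) t) :
    HasOpVelocity M (fun r => ∑ i ∈ s, a i r) (∑ i ∈ s, v i) t :=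
  ⟨fun r => OrdLE.sum fun i hi => (h i hi).ordLE r,
    OrdLE.sum fun i hi => (h i hi).ordLE_velocity, fun j => by
      simp only [coeff_sum]
      exact HasSFVelocity.sum fun i hi => (h i hi).coeff j⟩

lemma T (h : HasOpVelocity M a v t) (k : ℤ) :
    HasOpVelocity (k + M) (fun s => T k (a s)) (T k v) t :=
  ⟨fun s => (h.ordLE s).T k, h.ordLE_velocity.T k, fun r => by
    obtain ⟨n, hn⟩ := exists_nat_gt_sub M (r - k)
    rw [coeff_T h.ordLE_velocity k r hn]
    simp only [fun s => coeff_T (h.ordLE s) k r hn]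
    exact HasSFVelocity.sum fun j _ => (h.coeff _).leibniz k j⟩

lemma mul (h : HasOpVelocity M a v t) (h' : HasOpVelocity K b w t) :
    HasOpVelocity (M + K) (fun s => a s * b s) (v * b t + a t * w) t :=
  ⟨fun s => (h.ordLE s).mul (h'.ordLE s),
    (h.ordLE_velocity.mul (h'.ordLE t)).add ((h.ordLE t).mul h'.ordLE_velocity), fun r => by
      rw [coeff_add, coeff_mul_eq h.ordLE_velocity (h'.ordLE t) le_rfl le_rfl,
        coeff_mul_eq (h.ordLE t) h'.ordLE_velocity le_rfl le_rfl, ← Finset.sum_add_distrib]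
      simp only [fun s => coeff_mul_eq (h.ordLE s) (h'.ordLE s) (le_refl (r - K)) le_rfl]
      exact HasSFVelocity.sum fun i _ => (h.coeff i).mul ((h'.T i).coeff r)⟩

lemma exists_pow (h : HasOpVelocity M a v t) (n : ℕ) :
    ∃ w, HasOpVelocity (n * M) (fun s => a s ^ n) w t := by
  induction n with
  | zero =>
    simp only [_root_.pow_zero]
    exact ⟨0, (const OrdLE.one t).weaken (by simp)⟩
  | succ n ih =>
    obtain ⟨w, hw⟩ := ih
    simp only [_root_.pow_succ]
    exact ⟨_, (hw.mul h).weaken (by push_cast; linarith)⟩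

lemma hasDerivAt_tr (h : HasOpVelocity M a v t) (φ : Module.Dual ℂ (Grass ι)) :
    HasDerivAt (fun s => φ (tr (a s))) (φ (tr v)) t := (h.coeff (-1)).hasDerivAt_berezin φ

end HasOpVelocity

/-- The product rule for powers under the trace: for `Y` commuting with the even operator `P`, the
`k` terms of `δ(P^k)` contribute equally to `tr (Y δ(P^k))`. -/
lemma HasOpVelocity.exists_pow_tr {M : ℤ} {P : ℝ → Op ι} {p : Op ι} {t : ℝ}
    (h : HasOpVelocity M P p t) (hP : (P t).IsEven) (k : ℕ) :
    ∃ V, HasOpVelocity (k * M) (fun s => P s ^ k) V t ∧ ∀ Y, Y * P t = P t * Y →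
      tr (Y * V) = (k : ℂ) • tr (Y * P t ^ (k - 1) * p) := by
  induction k with
  | zero =>
    simp only [_root_.pow_zero]
    refine ⟨0, (HasOpVelocity.const OrdLE.one t).weaken (by simp), fun Y _ => ?_⟩
    rw [mul_zero, map_zero, Nat.cast_zero (R := ℂ), zero_smul]
  | succ k ih =>
    obtain ⟨V, hV, hVtr⟩ := ih
    simp only [_root_.pow_succ]
    refine ⟨_, (hV.mul h).weaken (by push_cast; linarith), fun Y hY => ?_⟩
    have hPY : P t * Y * P t = P t * (P t * Y) := by rw [mul_assoc, hY]
    rw [mul_add, map_add, ← mul_assoc, ← hP.isTracial, ← mul_assoc, ← mul_assoc, hVtr _ hPY,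
      Nat.cast_succ, add_smul, one_smul, Nat.add_sub_cancel]
    congr 1
    cases k with
    | zero => simp
    | succ k =>
      rw [Nat.add_sub_cancel, ← hY, mul_assoc Y, ← _root_.pow_succ']

/-- The root of a curve of monic operators has a velocity, by recursion over its coefficients. -/
lemma exists_root_velocity {m : ℕ} (hm : 1 ≤ m) {P : ℝ → Op ι} (hP : ∀ s, IsLead 1 (P s))
    {v : Op ι} {t : ℝ} (h : HasOpVelocity (2 * m) (fun s => P s ^ m) v t) :
    ∃ p, HasOpVelocity (2 * 1) P p t := by
  have main : ∀ n : ℕ, ∀ j : ℤ, 2 - n ≤ j →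
      ∃ q, HasSFVelocity (fun s => (P s).coeff j) q t := by
    intro n
    induction n with
    | zero =>
      intro j hj
      rw [Nat.cast_zero, sub_zero] at hj
      rcases eq_or_lt_of_le hj with rfl | hj
      · have : ∀ s, (P s).coeff 2 = 1 := fun s => (hP s).2
        simp only [this]
        exact ⟨0, HasSFVelocity.const 1 t⟩
      · have : ∀ s, (P s).coeff j = 0 := fun s => (hP s).1 j (by simpa using hj)
        simp only [this]
        exact ⟨0, HasSFVelocity.const 0 t⟩
    | succ n ih =>
      intro j hj
      push_cast at hj
      by_cases hj' : 2 - (n : ℤ) ≤ j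
      · exact ih j hj'
      · have hj2 : j < 2 := by omega
        choose q hq using fun i : {i // j < i} => ih i.1 (by have := i.2; omega)
        -- the coefficient at `D_θ^j` is a polynomial in the coefficients above it
        let p : Op ι := ⟨fun i => if hi : j < i ∧ i ≤ 2 then q ⟨i, hi.1⟩ else 0, 2,
          fun i hi => dif_neg (by omega)⟩
        have hp : ∀ i, p.coeff i = if hi : j < i ∧ i ≤ 2 then q ⟨i, hi.1⟩ else 0 := fun i => rfl
        have htr : HasOpVelocity 2 (fun s => trunc j (P s)) p t := by
          refine ⟨fun s => (hP s).1.trunc j, fun i hi => dif_neg (by omega), fun i => ?_⟩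
          rw [hp]
          simp only [coeff_trunc]
          split_ifs with h1 h2 h2
          · exact hq ⟨i, h1⟩
          · have h3 : ∀ s, (P s).coeff i = 0 := fun s => (hP s).1 i (by omega)
            simp only [h3]
            exact HasSFVelocity.const 0 t
          · exact absurd h2.1 h1
          · exact HasSFVelocity.const 0 t
        obtain ⟨w, hw⟩ := htr.exists_pow m
        simp only [fun s => coeff_root hm (hP s) hj2]
        exact ⟨_, ((h.coeff _).sub (hw.coeff _)).smul _⟩
  choose q hq using fun j : ℤ => main (2 - j).toNat j (by omega)
  refine ⟨⟨fun j => if j ≤ 2 then q j else 0, 2, fun j hj => if_neg (by omega)⟩,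
    fun s => (hP s).1, fun j hj => if_neg (by omega), fun j => ?_⟩
  change HasSFVelocity _ (if j ≤ 2 then q j else 0) t
  split_ifs with hj
  · exact hq j
  · have h3 : ∀ s, (P s).coeff j = 0 := fun s => (hP s).1 j (by omega)
    simp only [h3]
    exact HasSFVelocity.const 0 t

/-- The gradient `(1/m) l^{(n+1-m)/m}` of `γ_n`, characterized without negative powers. -/
def IsCasimirGradient (m n : ℕ) (l X : Op ι) : Prop :=
  X.IsEven ∧ X * root m l = root m l * X ∧
    (m : ℂ) • (X * root m l ^ (m - 1)) = root m l ^ n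

lemma exists_isCasimirGradient {m : ℕ} (hm : 1 ≤ m) (n : ℕ) {l : Op ι} (hl : l.IsMonic m) :
    ∃ X, IsCasimirGradient m n l X := by
  have hm0 : (m : ℂ) ≠ 0 := by exact_mod_cast (by omega : m ≠ 0)
  obtain ⟨hPe, hP, -⟩ := isRoot_iff.1 (isRoot_root hm hl)
  unfold IsCasimirGradient
  set P := root m l
  obtain ⟨Q, h1, h2⟩ := hP.exists_inverse
  have hQe : Q.IsEven := by
    rw [isEven_iff]
    have h3 := congrArg parOp h2
    rw [parOp_mul, parOp_one, isEven_iff.1 hPe] at h3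
    exact left_inv_eq_right_inv h3 h1
  have hc : Commute Q P := h2.trans h1.symm
  have hQP : Q ^ (m - 1) * P ^ (m - 1) = 1 := by
    rw [← hc.mul_pow, h2, one_pow]
  refine ⟨(1 / (m : ℂ)) • (P ^ n * Q ^ (m - 1)), ((hPe.pow n).mul (hQe.pow _)).smul _, ?_, ?_⟩
  · rw [smul_mul_assoc, mul_smul_comm]
    congr 1
    exact ((Commute.refl P).pow_left n).mul_left (hc.pow_left _)
  · rw [smul_mul_assoc, smul_smul, mul_one_div_cancel hm0, one_smul, mul_assoc, hQP, mul_one]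

lemma IsCasimirGradient.comm_eq_zero {m n : ℕ} (hm : 1 ≤ m) {l X : Op ι} (hl : l.IsMonic m)
    (hX : IsCasimirGradient m n l X) : comm l X = 0 := by
  obtain ⟨-, -, h⟩ := isRoot_iff.1 (isRoot_root hm hl)
  have hc : Commute X (root m l) := hX.2.1
  have := (hc.pow_right m).eq
  rw [h] at this
  rw [comm, this, sub_self]

/-- The chain rule for `γ_n` along a curve of monic operators. -/
theorem hasVariation_gamma {m : ℕ} (hm : 1 ≤ m) (n : ℕ) {L : ℝ → Op ι}
    (hL : ∀ s, (L s).IsMonic m) {v : Op ι} (h : HasOpVelocity (2 * m) L v 0) {X : Op ι}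
    (hX : IsCasimirGradient m n (L 0) X) :
    HasVariation (fun ε => gamma m n (L ε)) (form X v) := by
  intro φ
  have hm0 : (m : ℂ) ≠ 0 := by exact_mod_cast (by omega : m ≠ 0)
  have hn0 : (n : ℂ) + 1 ≠ 0 := by exact_mod_cast Nat.succ_ne_zero n
  obtain ⟨P, hPdef⟩ : ∃ P : ℝ → Op ι, ∀ s, root m (L s) = P s := ⟨_, fun _ => rfl⟩
  have hroot : ∀ s, (P s).IsEven ∧ IsLead 1 (P s) ∧ P s ^ m = L s := fun s => by
    rw [← hPdef]; exact isRoot_iff.1 (isRoot_root hm (hL s))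
  obtain ⟨-, hXP, hXm⟩ := hX
  rw [hPdef] at hXP hXm
  have hPL : ∀ s, P s ^ m = L s := fun s => (hroot s).2.2
  obtain ⟨p, hp⟩ := exists_root_velocity hm (fun s => (hroot s).2.1) (v := v) (t := 0)
    (by simpa only [hPL] using h)
  obtain ⟨V, hV, hVtr⟩ := hp.exists_pow_tr (hroot 0).1 (n + 1)
  obtain ⟨W, hW, hWtr⟩ := hp.exists_pow_tr (hroot 0).1 m
  obtain ⟨K, hK⟩ := exists_ordLE X
  -- both expressions are derivatives of `tr (X * L)`
  have d1 := ((HasOpVelocity.const hK 0).mul hW).hasDerivAt_tr φ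
  have d2 := ((HasOpVelocity.const hK 0).mul h).hasDerivAt_tr φ
  simp only [hPL] at d1
  have key := d1.unique d2
  rw [zero_mul, zero_add, zero_add, hWtr X hXP, ← map_smul, ← smul_mul_assoc, hXm] at key
  have d3 := (hV.hasDerivAt_tr φ).const_mul (1 / ((n : ℂ) + 1))
  have e1 : tr V = ((n : ℂ) + 1) • tr (P 0 ^ n * p) := by
    have := hVtr 1 (by rw [mul_one, one_mul])
    rwa [one_mul, one_mul, Nat.add_sub_cancel, Nat.cast_succ] at this
  rw [e1, map_smul, smul_eq_mul, ← mul_assoc, one_div_mul_cancel hn0, one_mul, key] at d3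
  refine d3.congr_of_eventuallyEq (Filter.Eventually.of_forall fun s => ?_)
  change φ (gamma m n (L s)) = _
  rw [gamma, hPdef, map_smul, smul_eq_mul, form_eq, pow_eq, ← _root_.pow_succ']

lemma OrdLE.hasOpVelocity_line {M : ℤ} {l h : Op ι} (hl : OrdLE M l) (hh : OrdLE M h) :
    HasOpVelocity M (fun ε : ℝ => l + (ε : ℂ) • h) h 0 := by
  have := (HasOpVelocity.const hl 0).add (HasOpVelocity.ofReal_smul hh 0)
  rwa [zero_add] at this

lemma IsVariation.ordLE {m : ℕ} {h : Op ι} (hh : h.IsVariation m) : OrdLE (2 * m - 1) h :=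
  fun j hj => hh.2 j (by omega)

lemma isVariation_iff {m : ℕ} {h : Op ι} : h.IsVariation m ↔ h.IsEven ∧ OrdLE (2 * m - 1) h :=
  ⟨fun hh => ⟨hh.1, hh.ordLE⟩, fun hh => ⟨hh.1, fun j hj => hh.2 j (by omega)⟩⟩

lemma IsMonic.add_variation {m : ℕ} {l h : Op ι} (hl : l.IsMonic m) (hh : h.IsVariation m) :
    (l + h).IsMonic m := by
  rw [isMonic_iff] at hl ⊢
  exact ⟨hl.1.add hh.1, hl.2.add_ordLE hh.ordLE (by omega)⟩

lemma IsVariation.smul {m : ℕ} {h : Op ι} (hh : h.IsVariation m) (c : ℂ) :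
    (c • h).IsVariation m := isVariation_iff.2 ⟨hh.1.smul c, hh.ordLE.smul c⟩

lemma IsCasimirGradient.isOpGradient {m n : ℕ} (hm : 1 ≤ m) {l X : Op ι} (hl : l.IsMonic m)
    (hX : IsCasimirGradient m n l X) : IsOpGradient m (gamma m n) l X := by
  refine ⟨hX.1, fun h hh => ?_⟩
  refine hasVariation_gamma hm n (L := fun ε : ℝ => l + (ε : ℂ) • h)
    (fun s => hl.add_variation (hh.smul s))
    ((isMonic_iff.1 hl).2.1.hasOpVelocity_line (hh.ordLE.weaken (by omega))) ?_
  simpa using hX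

/-- A gradient is determined by the functional at the coefficients of `D_θ^j`, `j ≥ -2m`. -/
lemma coeff_eq_of_form_eq [Infinite ι] {m : ℕ} {X Y : Op ι} (hX : X.IsEven) (hY : Y.IsEven)
    (h : ∀ δ : Op ι, δ.IsVariation m → form X δ = form Y δ) {j : ℤ} (hj : -(2 * m) ≤ j) :
    X.coeff j = Y.coeff j := by
  have hZ := hX.sub hY
  have hform : ∀ δ : Op ι, δ.IsVariation m → form δ (X - Y) = 0 := fun δ hδ => by
    rw [form_eq, ← hZ.isTracial, sub_mul, map_sub, sub_eq_zero]
    exact h δ hδ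
  obtain ⟨M, hM⟩ := exists_ordLE (X - Y)
  have hcoeff : ∀ n : ℕ, OrdLE (max (-(2 * m) - 1) (M - n)) (X - Y) := fun n => by
    induction n with
    | zero => exact hM.weaken (by simp)
    | succ n ih =>
      intro r hr
      push_cast at hr
      by_cases hr' : max (-(2 * (m : ℤ)) - 1) (M - n) < r
      · exact ih r hr'
      have hrn : OrdLE r (X - Y) := ih.weaken (by omega)
      -- `(u D_θ^k, X - Y)` with `k = -1 - r` sees only the top coefficient at `D_θ^r`; the bound
      -- `k < 2m`, which makes `u D_θ^k` a variation, is `r ≥ -2m`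
      have h1 : (T (-1 - r) (X - Y)).coeff (-1) = 0 := by
        refine SF.eq_zero_of_berezin_mul (-1 - r) fun u hu => ?_
        have h2 := hform (mono u (-1 - r))
          (isVariation_iff.2 ⟨IsEven.mono hu, (OrdLE.mono u _).weaken (by omega)⟩)
        rwa [form_eq, tr_apply, coeff_mono_mul] at h2
      rw [coeff_T hrn (-1 - r) (-1) (n := 1) (by push_cast; omega), Finset.sum_range_one,
        leibniz_zero_right] at h1
      have h3 : (X - Y).coeff r = parPow (-1 - r) (parPow (-1 - r)
          ((X - Y).coeff (-1 - (-1 - r) + ((0 : ℕ) : ℤ)))) := by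
        rw [show -1 - (-1 - r) + ((0 : ℕ) : ℤ) = r by push_cast; ring]
        unfold parPow
        split_ifs <;> simp
      rw [h3, h1]
      unfold parPow
      split_ifs <;> simp
  have := hcoeff (M + 2 * m + 1).toNat j (by omega)
  rwa [coeff_sub, sub_eq_zero] at this

end Op

/-! ### The operators `u D_θ^{-1} v` -/

namespace Op

open ExtSpace

variable {ι : Type*}

lemma mono_add (u v : SF ι) (k : ℤ) : mono (u + v) k = mono u k + mono v k := by
  ext1 j
  rw [coeff_add, coeff_mono, coeff_mono, coeff_mono]
  split_ifs <;> simp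

/-- The monomial `u D_θ^k` as an additive function of `u`. -/
def monoHom (k : ℤ) : SF ι →+ Op ι := AddMonoidHom.mk' (fun u => mono u k) fun u v => mono_add u v k

lemma mono_zero (k : ℤ) : mono (0 : SF ι) k = 0 := (monoHom k).map_zero
lemma mono_neg (u : SF ι) (k : ℤ) : mono (-u) k = -mono u k := (monoHom k).map_neg u
lemma mono_zsmul (n : ℤ) (u : SF ι) (k : ℤ) : mono (n • u) k = n • mono u k :=
  map_zsmul (monoHom k) n u
lemma mono_sum {α : Type*} (s : Finset α) (f : α → SF ι) (k : ℤ) :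
    mono (∑ i ∈ s, f i) k = ∑ i ∈ s, mono (f i) k := map_sum (monoHom k) f s

lemma fun_mul_mono (u v : SF ι) (k : ℤ) : mono u 0 * mono v k = mono (u * v) k := by
  ext1 r
  rw [coeff_mono_mul, T_zero, coeff_mono, coeff_mono, mul_ite, mul_zero]

lemma dyad_eq (u v : SF ι) : dyad u v = mono u (-1) * mono v 0 := by
  rw [dyad, mono_mul_mono_one, zero_add]

lemma ordLE_dyad (u v : SF ι) : OrdLE (-1) (dyad u v) := by
  rw [dyad_eq]
  exact (OrdLE.mono u (-1)).mul (OrdLE.mono v 0)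

lemma dyad_neg_right (u v : SF ι) : dyad u (-v) = -dyad u v := by
  rw [dyad, dyad, mono_neg, mul_neg]

lemma dyad_zero_left (v : SF ι) : dyad 0 v = 0 := by
  rw [dyad, mono_zero, zero_mul, zero_mul]

lemma dyad_zero_right (u : SF ι) : dyad u 0 = 0 := by
  rw [dyad, mono_zero, mul_zero]

lemma isEven_dyad {p q : ℤ} {u v : SF ι} (hu : u.HasParity p) (hv : v.HasParity q)
    (h : Odd (p + q)) : (dyad u v).IsEven := by
  rw [SF.hasParity_iff_eps] at hu hv
  rw [isEven_iff, dyad_eq, parOp_mul, parOp_mono, parOp_mono, hu, hv, mono_zsmul, mono_zsmul,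
    smul_smul, smul_smul, smul_mul_smul_comm, ← eps_add, ← eps_add, ← eps_add,
    eps_even (by rw [show -1 + p + (0 + q) = -1 + (p + q) by ring]; exact Odd.add_odd (by decide) h),
    one_smul]

lemma pair_eq_tr (u v : SF ι) : pair u v = tr (dyad u v) := by
  rw [pair, form_eq, one_mul]

lemma pair_eq (u v : SF ι) : pair u v = (u * v.par).berezin := by
  rw [pair_eq_tr, tr_apply, dyad_eq, coeff_neg_one_mul_fun, coeff_mono_self]

lemma pair_zero_left (v : SF ι) : pair 0 v = 0 := by
  rw [pair_eq_tr, dyad_zero_left, map_zero]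

lemma pair_zero_right (u : SF ι) : pair u 0 = 0 := by
  rw [pair_eq_tr, dyad_zero_right, map_zero]

lemma IsDiff.add {a b : Op ι} (ha : IsDiff a) (hb : IsDiff b) : IsDiff (a + b) := fun j hj => by
  rw [coeff_add, ha j hj, hb j hj, add_zero]

lemma IsDiff.sum {α : Type*} {s : Finset α} {f : α → Op ι} (h : ∀ i ∈ s, IsDiff (f i)) :
    IsDiff (∑ i ∈ s, f i) := fun j hj => by
  rw [coeff_sum, Finset.sum_eq_zero fun i hi => h i hi j hj]

lemma isDiff_mono (u : SF ι) {k : ℤ} (hk : 0 ≤ k) : IsDiff (mono u k) := fun j hj => by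
  rw [coeff_mono, if_neg (by omega)]

lemma pos_eq_sum {M : ℤ} {X : Op ι} (hX : OrdLE M X) {n : ℕ} (hn : M < n) :
    X.pos = ∑ j ∈ Finset.range n, mono (X.coeff j) j := by
  ext1 r
  rw [coeff_pos, coeff_sum]
  simp only [coeff_mono]
  split_ifs with h
  · lift r to ℕ using h
    rw [Finset.sum_eq_single r, if_pos rfl]
    · intro j _ hj
      rw [if_neg (by exact_mod_cast hj.symm)]
    · intro hr
      rw [Finset.mem_range, not_lt] at hr
      rw [if_pos rfl, hX _ (by omega)]
  · exact (Finset.sum_eq_zero fun j _ => if_neg (by omega)).symm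

lemma actPos_eq {M : ℤ} {X : Op ι} (hX : OrdLE M X) {n : ℕ} (hn : M < n) (u : SF ι) :
    X.actPos u = ∑ j ∈ Finset.range n, X.coeff j * SF.D^[j] u := by
  refine finsum_eq_sum_of_support_subset _ fun j hj => ?_
  rw [Finset.coe_range, Set.mem_Iio]
  by_contra hjn
  refine hj ?_
  dsimp only
  rw [hX _ (by omega), zero_mul]

lemma adjPos_eq {M : ℤ} {X : Op ι} (hX : OrdLE M X) {n : ℕ} (hn : M < n) (v : SF ι) :
    X.adjPos v = ∑ j ∈ Finset.range n, (-1 : ℤ) ^ (j * (j + 1) / 2) •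
      SF.D^[j] ((if Even j then X.coeff j else (X.coeff j).par) * v) := by
  refine finsum_eq_sum_of_support_subset _ fun j hj => ?_
  rw [Finset.coe_range, Set.mem_Iio]
  by_contra hjn
  refine hj ?_
  dsimp only
  rw [hX _ (by omega), SF.par_zero, ite_self, zero_mul, SF.iterate_D_eq, map_zero, smul_zero]

lemma exists_ordLE_nat (X : Op ι) : ∃ M : ℤ, OrdLE M X ∧ ∃ n : ℕ, M < n := by
  obtain ⟨M, hM⟩ := exists_ordLE X
  exact ⟨M, hM, (M + 1).toNat, by omega⟩

/-- `(a D_θ^j ∘ u D_θ^{-1})_- = a (D_θ^j u) D_θ^{-1}`. -/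
lemma isDiff_mono_mul_mono_neg_one (a u : SF ι) (j : ℕ) :
    IsDiff (mono a j * mono u (-1) - mono (a * SF.D^[j] u) (-1)) := fun r hr => by
  obtain ⟨i, rfl⟩ : ∃ i : ℕ, r = j + -1 - ((j + i : ℕ) : ℤ) :=
    ⟨(-1 - r).toNat, by push_cast; omega⟩
  rw [coeff_sub, coeff_mono_mul, coeff_T_mono, coeff_mono, leibniz_eq]
  cases i with
  | zero =>
    rw [add_zero, superChoose_self, one_smul, sub_self, parPow_even (by decide),
      if_pos (by ring), sub_self]
  | succ i =>
    rw [superChoose_eq_zero_of_lt (by positivity) (by push_cast; omega), zero_smul, mul_zero,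
      if_neg (by push_cast; omega), sub_zero]

/-- The integral part of `X_+ ∘ u D_θ^{-1} v` is `(X_+ u) D_θ^{-1} v`. -/
lemma isDiff_pos_mul_dyad (X : Op ι) (u v : SF ι) :
    IsDiff (X.pos * dyad u v - dyad (X.actPos u) v) := by
  obtain ⟨M, hM, n, hn⟩ := exists_ordLE_nat X
  have e : X.pos * dyad u v - dyad (X.actPos u) v = (∑ j ∈ Finset.range n,
      (mono (X.coeff j) j * mono u (-1) - mono (X.coeff j * SF.D^[j] u) (-1))) * mono v 0 := by
    rw [pos_eq_sum hM hn, actPos_eq hM hn, dyad_eq, dyad_eq, mono_sum, Finset.sum_sub_distrib,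
      sub_mul, ← Finset.sum_mul, mul_assoc]
  rw [e]
  exact (IsDiff.sum fun j _ => isDiff_mono_mul_mono_neg_one _ _ j).mul (isDiff_mono v le_rfl)

/-- `D_θ^{-1} ∘ w D_θ^j` and `D_θ^{-1} ∘ ((σ ∘ D_θ)^j w)` have the same integral part, where `σ` is
the parity automorphism: integrate by parts `j` times. -/
lemma isDiff_D_inv_mul_mono (j : ℕ) (w : SF ι) : IsDiff (mono 1 (-1) * mono w j -
    mono 1 (-1) * mono ((fun x : SF ι => (SF.D x).par)^[j] w) 0) := by
  induction j generalizing w with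
  | zero =>
    rw [Nat.cast_zero, Function.iterate_zero, id, sub_self]
    exact fun _ _ => rfl
  | succ j ih =>
    have h1 : mono 1 1 * mono w.par 0 = mono (SF.D w.par) 0 + mono w 1 := by
      have h := dOp_T 0 (mono w.par 0)
      rw [T_zero, zero_add] at h
      rw [mono_one_mul, ← h]
      ext1 r
      rw [coeff_dOp, coeff_add, coeff_mono, coeff_mono, coeff_mono, coeff_mono]
      rcases eq_or_ne r 0 with rfl | h0
      · simp
      · rcases eq_or_ne r 1 with rfl | h1
        · simp
        · rw [if_neg h0, if_neg (by omega), if_neg h0, if_neg h1, SF.D_zero, SF.par_zero]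
    have h2 : mono 1 (-1) * mono w 1 =
        mono w.par 0 + mono 1 (-1) * mono (SF.D w).par 0 := by
      have h3 : mono (1 : SF ι) (-1) * mono 1 1 = 1 := by rw [mono_mul_mono_one]; rfl
      have h4 := congrArg (fun x => mono 1 (-1) * x) h1
      rw [← mul_assoc, h3, one_mul, SF.D_par, mono_neg, mul_add, mul_neg] at h4
      rw [h4]
      abel
    have h5 : mono w ((j + 1 : ℕ) : ℤ) = mono w 1 * mono 1 j := by
      rw [mono_mul_mono_one]; congr 1; push_cast; ring
    rw [h5, ← mul_assoc, h2, add_mul, mul_assoc, mono_mul_mono_one, mono_mul_mono_one, zero_add,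
      Function.iterate_succ_apply, add_sub_assoc]
    exact (isDiff_mono _ (by positivity)).add (ih _)

lemma iterate_par_D (j : ℕ) (w : SF ι) : (fun x : SF ι => (SF.D x).par)^[j] w =
    (-1 : ℤ) ^ (j * (j + 1) / 2) • SF.D^[j] (parPow j w) := by
  induction j with
  | zero => simp [parPow]
  | succ j ih =>
    have hs : (j + 1) * (j + 1 + 1) / 2 = j * (j + 1) / 2 + (j + 1) := by
      rw [show (j + 1) * (j + 1 + 1) = j * (j + 1) + (j + 1) * 2 by ring,
        Nat.add_mul_div_right _ _ two_pos]
    rw [Function.iterate_succ_apply', ih, SF.D_zsmul, SF.par_zsmul,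
      ← Function.iterate_succ_apply' SF.D, SF.par_iterate_D, par_parPow, smul_smul, hs, ← pow_add, Nat.cast_succ]

/-- The integral part of `u D_θ^{-1} v ∘ X_+` is `u D_θ^{-1} (X_+^* v)`. -/
lemma isDiff_dyad_mul_pos {X : Op ι} (hX : X.IsEven) (u v : SF ι) :
    IsDiff (dyad u v * X.pos - dyad u (X.adjPos v)) := by
  obtain ⟨M, hM, n, hn⟩ := exists_ordLE_nat X
  have hterm : ∀ j : ℕ, (-1 : ℤ) ^ (j * (j + 1) / 2) •
      SF.D^[j] ((if Even j then X.coeff j else (X.coeff j).par) * v) =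
      (fun x : SF ι => (SF.D x).par)^[j] (v * X.coeff j) := fun j => by
    rw [iterate_par_D]
    congr 2
    have hp := SF.hasParity_iff_eps.1 (hX j)
    unfold parPow
    rcases Nat.even_or_odd j with hj | hj
    · have hj' : Even (j : ℤ) := by exact_mod_cast hj
      rw [eps_even hj', one_smul] at hp
      rw [if_pos hj, if_pos hj', SF.even_comm hp]
    · have hj' : Odd (j : ℤ) := by exact_mod_cast hj
      rw [eps_odd hj', neg_one_smul] at hp
      rw [if_neg (Nat.not_even_iff_odd.2 hj), if_neg (Int.not_even_iff_odd.2 hj'), SF.par_mul, hp,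
        neg_mul, mul_neg, SF.odd_comm hp]
  have e : dyad u v * X.pos - dyad u (X.adjPos v) = mono u 0 * ∑ j ∈ Finset.range n,
      (mono 1 (-1) * mono (v * X.coeff j) j -
        mono 1 (-1) * mono ((fun x : SF ι => (SF.D x).par)^[j] (v * X.coeff j)) 0) := by
    rw [pos_eq_sum hM hn, adjPos_eq hM hn, Finset.sum_congr rfl fun j _ => hterm j, dyad, dyad,
      mono_sum, Finset.sum_sub_distrib, ← Finset.mul_sum, ← Finset.mul_sum, mul_sub, mul_assoc,
      mul_assoc, mul_assoc, Finset.mul_sum _ _ (mono v 0)]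
    simp only [fun_mul_mono]
  rw [e]
  exact (isDiff_mono u le_rfl).mul (IsDiff.sum fun j _ => isDiff_D_inv_mul_mono j _)

lemma form_dyad_eq_pair_actPos (X : Op ι) (u v : SF ι) :
    form X (dyad u v) = pair (X.actPos u) v := by
  have h1 := tr_isDiff (isDiff_pos_mul_dyad X u v)
  rw [map_sub, sub_eq_zero] at h1
  have h2 : tr (X.neg * dyad u v) = 0 :=
    tr_eq_zero_of_ordLE ((ordLE_neg X).mul (ordLE_dyad u v)) (by norm_num)
  rw [form_eq, ← pos_add_neg X, add_mul, map_add, h1, h2, add_zero, pos_add_neg, pair_eq_tr]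

lemma form_dyad_eq_pair_adjPos {X : Op ι} (hX : X.IsEven) (u v : SF ι) :
    form X (dyad u v) = pair u (X.adjPos v) := by
  have h1 := tr_isDiff (isDiff_dyad_mul_pos hX u v)
  rw [map_sub, sub_eq_zero] at h1
  have h2 : tr (dyad u v * X.neg) = 0 :=
    tr_eq_zero_of_ordLE ((ordLE_dyad u v).mul (ordLE_neg X)) (by norm_num)
  rw [form_eq, hX.isTracial, ← pos_add_neg X, mul_add, map_add, h1, h2, add_zero, pos_add_neg,
    pair_eq_tr]

lemma hasParity_actPos {X : Op ι} (hX : X.IsEven) {p : ℤ} {u : SF ι} (hu : u.HasParity p) :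
    (X.actPos u).HasParity p := by
  obtain ⟨M, hM, n, hn⟩ := exists_ordLE_nat X
  rw [SF.hasParity_iff_eps] at hu ⊢
  rw [actPos_eq hM hn, SF.par_sum, Finset.smul_sum]
  refine Finset.sum_congr rfl fun j _ => ?_
  rw [SF.par_mul, SF.par_iterate_D, SF.hasParity_iff_eps.1 (hX j), hu, ← eps_natCast,
    SF.iterate_D_eq, map_zsmul, smul_mul_assoc, mul_smul_comm, mul_smul_comm, smul_smul,
    eps_mul_self, one_smul]

lemma hasParity_adjPos {X : Op ι} (hX : X.IsEven) {p : ℤ} {u : SF ι} (hu : u.HasParity p) :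
    (X.adjPos u).HasParity p := by
  obtain ⟨M, hM, n, hn⟩ := exists_ordLE_nat X
  rw [SF.hasParity_iff_eps] at hu ⊢
  rw [adjPos_eq hM hn, SF.par_sum, Finset.smul_sum]
  refine Finset.sum_congr rfl fun j _ => ?_
  have hp : (if Even j then X.coeff j else (X.coeff j).par).par =
      eps j • (if Even j then X.coeff j else (X.coeff j).par) := by
    split_ifs
    · exact SF.hasParity_iff_eps.1 (hX j)
    · rw [← SF.par_zsmul, ← SF.hasParity_iff_eps.1 (hX j)]
  rw [SF.par_zsmul, SF.par_iterate_D, SF.par_mul, hp, hu, ← eps_natCast j, SF.iterate_D_eq,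
    smul_mul_assoc, mul_smul_comm, map_zsmul, map_zsmul, smul_smul (eps j) (eps j), eps_mul_self,
    one_smul, smul_comm]

lemma actPos_congr {X Y : Op ι} (h : X.pos = Y.pos) (u : SF ι) : X.actPos u = Y.actPos u := by
  refine finsum_congr fun j => ?_
  have := congrArg (fun a => coeff a (j : ℤ)) h
  simp only [coeff_pos, Int.natCast_nonneg, if_true] at this
  rw [this]

lemma adjPos_congr {X Y : Op ι} (h : X.pos = Y.pos) (u : SF ι) : X.adjPos u = Y.adjPos u := by
  refine finsum_congr fun j => ?_
  have := congrArg (fun a => coeff a (j : ℤ)) h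
  simp only [coeff_pos, Int.natCast_nonneg, if_true] at this
  rw [this]

lemma pos_add (a b : Op ι) : (a + b).pos = a.pos + b.pos := by
  ext1 j
  rw [coeff_add, coeff_pos, coeff_pos, coeff_pos, coeff_add]
  split_ifs <;> simp

lemma pos_neg (a : Op ι) : (-a).pos = -a.pos := by
  ext1 j
  rw [coeff_neg, coeff_pos, coeff_pos, coeff_neg]
  split_ifs <;> simp

lemma HasOpVelocity.mono {u : ℝ → SF ι} {v : SF ι} {t : ℝ} (h : HasSFVelocity u v t) (k : ℤ) :
    HasOpVelocity k (fun s => Op.mono (u s) k) (Op.mono v k) t :=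
  ⟨fun s => OrdLE.mono (u s) k, OrdLE.mono v k, fun j => by
    simp only [coeff_mono]
    split_ifs
    · exact h
    · exact HasSFVelocity.const 0 t⟩

lemma HasOpVelocity.dyad {u w : ℝ → SF ι} {u' w' : SF ι} {t : ℝ} (h : HasSFVelocity u u' t)
    (h' : HasSFVelocity w w' t) : HasOpVelocity (-1) (fun s => Op.dyad (u s) (w s))
      (Op.dyad u' (w t) + Op.dyad (u t) w') t := by
  have := (HasOpVelocity.mono h (-1)).mul (HasOpVelocity.mono h' 0)
  simpa only [dyad_eq, add_zero] using this

end Op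

/-! ### The Bäcklund transformation and the two vector fields -/

namespace ExtSpace

open Op

variable {ι : Type*} {N : ℕ}

/-- The sum `∑_i (f_i D_θ^{-1} f_i^* + Φ_i D_θ^{-1} Φ_i^*)` added by the Bäcklund transformation. -/
def dyads (z : ExtSpace ι N) : Op ι := ∑ i, (dyad (z.f i) (z.fs i) + dyad (z.Phi i) (z.Phis i))

/-- The derivative of `dyads` at `z` in the direction `v`. -/
def dyadsDeriv (z v : ExtSpace ι N) : Op ι :=
  ∑ i, ((dyad (v.f i) (z.fs i) + dyad (z.f i) (v.fs i)) +
    (dyad (v.Phi i) (z.Phis i) + dyad (z.Phi i) (v.Phis i)))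

/-- The derivative of the Bäcklund transformation at `z` in the direction `v`. -/
def backlundDeriv (z v : ExtSpace ι N) : ExtSpace ι N :=
  ⟨v.l + dyadsDeriv z v, v.f, v.Phis, v.fs, v.Phi⟩

lemma backlund_eq (z : ExtSpace ι N) :
    backlund z = ⟨z.l + dyads z, z.f, z.Phis, z.fs, z.Phi⟩ := rfl

lemma ordLE_dyads (z : ExtSpace ι N) : OrdLE (-1) (dyads z) :=
  OrdLE.sum fun _ _ => (ordLE_dyad _ _).add (ordLE_dyad _ _)

lemma HasFieldParities.isVariation_dyads {z : ExtSpace ι N} (hz : z.HasFieldParities) (m : ℕ) :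
    (dyads z).IsVariation m :=
  isVariation_iff.2 ⟨IsEven.sum fun i _ =>
    (isEven_dyad (hz i).1 (hz i).2.2.1 (by decide)).add
      (isEven_dyad (hz i).2.2.2 (hz i).2.1 (by decide)), (ordLE_dyads z).weaken (by omega)⟩

lemma IsPoint.backlund {m : ℕ} {z : ExtSpace ι N} (hz : z.IsPoint m) :
    (backlund z).IsPoint m :=
  ⟨hz.1.add_variation (hz.2.isVariation_dyads m), hz.2⟩

lemma backlund_bijOn (m : ℕ) :
    Set.BijOn (backlund (ι := ι) (N := N)) {z | z.IsPoint m} {z | z.IsPoint m} := by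
  refine ⟨fun z hz => IsPoint.backlund hz, fun z _ z' _ h => ?_, fun z hz => ?_⟩
  · obtain ⟨l, f, Ps, fs, P⟩ := z
    obtain ⟨l', f', Ps', fs', P'⟩ := z'
    simp only [backlund_eq, dyads, ExtSpace.mk.injEq] at h
    obtain ⟨h0, rfl, rfl, rfl, rfl⟩ := h
    rw [add_left_injective _ h0]
  · refine ⟨⟨z.l - dyads z, z.f, z.Phis, z.fs, z.Phi⟩, ⟨?_, hz.2⟩, ?_⟩
    · have := ((HasFieldParities.isVariation_dyads hz.2 m).smul (-1))
      rw [neg_one_smul] at this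
      have h := IsMonic.add_variation hz.1 this
      rwa [← sub_eq_add_neg] at h
    · rw [backlund_eq]
      change (⟨z.l - dyads z + dyads z, _, _, _, _⟩ : ExtSpace ι N) = z
      rw [sub_add_cancel]

lemma HasVelocity.dyads {c : ℝ → ExtSpace ι N} {v : ExtSpace ι N} {t : ℝ}
    (h : ∀ i, HasSFVelocity (fun s => (c s).f i) (v.f i) t ∧
      HasSFVelocity (fun s => (c s).Phis i) (v.Phis i) t ∧
      HasSFVelocity (fun s => (c s).fs i) (v.fs i) t ∧
      HasSFVelocity (fun s => (c s).Phi i) (v.Phi i) t) :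
    HasOpVelocity (-1) (fun s => dyads (c s)) (dyadsDeriv (c t) v) t :=
  HasOpVelocity.sum fun i _ => (HasOpVelocity.dyad (h i).1 (h i).2.2.1).add
    (HasOpVelocity.dyad (h i).2.2.2 (h i).2.1)

lemma HasVelocity.backlund {c : ℝ → ExtSpace ι N} {v : ExtSpace ι N} {t : ℝ}
    (h : HasVelocity c v t) :
    HasVelocity (fun s => backlund (c s)) (backlundDeriv (c t) v) t :=
  ⟨fun j => (h.1 j).add ((HasVelocity.dyads h.2).coeff j), h.2⟩

lemma HasVelocity.of_backlund {c : ℝ → ExtSpace ι N} {v : ExtSpace ι N} {t : ℝ}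
    (h : HasVelocity (fun s => SuperLax.ExtSpace.backlund (c s)) (backlundDeriv (c t) v) t) :
    HasVelocity c v t := by
  refine ⟨fun j => ?_, h.2⟩
  have h1 := (h.1 j).sub ((HasVelocity.dyads (c := c) (v := v) h.2).coeff j)
  have e1 : ∀ s, (SuperLax.ExtSpace.backlund (c s)).l.coeff j - (ExtSpace.dyads (c s)).coeff j =
      (c s).l.coeff j := fun s => add_sub_cancel_right _ _
  have e2 : (backlundDeriv (c t) v).l.coeff j - (dyadsDeriv (c t) v).coeff j = v.l.coeff j :=
    add_sub_cancel_right _ _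
  simpa only [e1, e2] using h1

lemma neg_Theta (l X : Op ι) : -Theta l X = comm X.pos l - (comm X l).pos := by
  have h1 : comm l X = -comm X l := by rw [Op.comm, Op.comm, neg_sub]
  have h2 : comm l X.pos = -comm X.pos l := by rw [Op.comm, Op.comm, neg_sub]
  rw [Theta, h1, h2, Op.pos_neg]
  abel

lemma isVariation_neg_Theta {m : ℕ} {l X : Op ι} (hl : l.IsMonic m) (hX : X.IsEven) :
    (-Theta l X).IsVariation m := by
  have hl' := isMonic_iff.1 hl
  rw [isVariation_iff]
  constructor
  · rw [neg_Theta]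
    exact (hX.pos.comm hl'.1).sub (hX.comm hl'.1).pos
  · have e : -Theta l X = comm l X.neg - (comm l X).neg := by
      have h1 : comm l X = comm l X.pos + comm l X.neg := by
        nth_rewrite 1 [← pos_add_neg X]
        unfold Op.comm
        noncomm_ring
      rw [Theta, eq_sub_of_add_eq (pos_add_neg (comm l X)), h1]
      abel
    rw [e]
    exact ((hl'.2.1.comm (ordLE_neg X)).weaken (by omega)).sub ((ordLE_neg _).weaken (by omega))

/-- `Θ` does not see the part of order less than `-2m`, on which gradients are undetermined. -/
lemma Theta_congr {m : ℕ} {l X Y : Op ι} (hl : l.IsMonic m)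
    (h : ∀ j : ℤ, -(2 * m) ≤ j → X.coeff j = Y.coeff j) : Theta l X = Theta l Y := by
  have hZ : OrdLE (-(2 * m) - 1) (X - Y) := fun j hj => by
    rw [coeff_sub, h j (by omega), sub_self]
  have h1 : X.pos = Y.pos := by
    ext1 j
    rw [coeff_pos, coeff_pos]
    split_ifs with hj
    · exact h j (by omega)
    · rfl
  have h2 : (comm l X).pos = (comm l Y).pos := by
    have e : comm l X = comm l Y + comm l (X - Y) := by
      unfold Op.comm
      noncomm_ring
    rw [e, Op.pos_add, ((isMonic_iff.1 hl).2.1.comm hZ).pos_eq (by omega), add_zero]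
  rw [Theta, Theta, h1, h2]

/-- The gradient of the Hamiltonian built from the gradient `X` of `γ_n`. -/
def hamiltonianGradient (X : Op ι) (z : ExtSpace ι N) : ExtSpace ι N :=
  ⟨X, fun i => X.adjPos (z.fs i), fun i => X.actPos (z.Phi i), fun i => X.actPos (z.f i),
    fun i => X.adjPos (z.Phis i)⟩

/-- The Lax vector field built from the gradient `X` of `γ_n`. -/
def laxVector (X : Op ι) (z : ExtSpace ι N) : ExtSpace ι N :=
  ⟨comm X.pos z.l, fun i => X.actPos (z.f i), fun i => -X.adjPos (z.Phis i),
    fun i => -X.adjPos (z.fs i), fun i => X.actPos (z.Phi i)⟩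

lemma hasParity_neg {p : ℤ} {u : SF ι} (h : u.HasParity p) : (-u).HasParity p := by
  rw [SF.hasParity_iff_eps] at *
  rw [SF.par_neg, h, smul_neg]

lemma hasParity_zero (p : ℤ) : (0 : SF ι).HasParity p := by
  rw [SF.hasParity_iff_eps, SF.par_zero, smul_zero]

lemma hasFieldParities_laxVector {X : Op ι} (hX : X.IsEven) {z : ExtSpace ι N}
    (hz : z.HasFieldParities) : (laxVector X z).HasFieldParities := fun i =>
  ⟨hasParity_actPos hX (hz i).1, hasParity_neg (hasParity_adjPos hX (hz i).2.1),
    hasParity_neg (hasParity_adjPos hX (hz i).2.2.1), hasParity_actPos hX (hz i).2.2.2⟩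

lemma form_dyadsDeriv {X : Op ι} (hX : X.IsEven) (z h : ExtSpace ι N) :
    form X (dyadsDeriv z h) = fieldPair (hamiltonianGradient X z) h := by
  rw [form_eq, dyadsDeriv, Finset.mul_sum, map_sum, fieldPair]
  refine Finset.sum_congr rfl fun i _ => ?_
  rw [mul_add, mul_add, mul_add, map_add, map_add, map_add, ← form_eq, ← form_eq, ← form_eq,
    ← form_eq, form_dyad_eq_pair_adjPos hX, form_dyad_eq_pair_actPos, form_dyad_eq_pair_adjPos hX,
    form_dyad_eq_pair_actPos]
  change _ = pair (h.f i) (X.adjPos (z.fs i)) + pair (X.actPos (z.Phi i)) (h.Phis i) +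
    pair (X.actPos (z.f i)) (h.fs i) + pair (h.Phi i) (X.adjPos (z.Phis i))
  abel

lemma HasFieldParities.shift {z h : ExtSpace ι N} (hz : z.HasFieldParities)
    (hh : h.HasFieldParities) (ε : ℝ) : (z.shift h ε).HasFieldParities := by
  have key : ∀ {p : ℤ} {u v : SF ι}, u.HasParity p → v.HasParity p →
      (u + (ε : ℂ) • v).HasParity p := fun {p u v} hu hv => by
    rw [SF.hasParity_iff_eps] at *
    rw [SF.par_add, SF.par_smul, hu, hv, smul_add, smul_comm]
  exact fun i => ⟨key (hz i).1 (hh i).1, key (hz i).2.1 (hh i).2.1,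
    key (hz i).2.2.1 (hh i).2.2.1, key (hz i).2.2.2 (hh i).2.2.2⟩

lemma IsPoint.shift {m : ℕ} {z h : ExtSpace ι N} (hz : z.IsPoint m) (hh : h.IsTangent m)
    (ε : ℝ) : (z.shift h ε).IsPoint m :=
  ⟨hz.1.add_variation (hh.1.smul _), hz.2.shift hh.2 ε⟩

lemma shift_zero (z h : ExtSpace ι N) : z.shift h 0 = z := by
  simp [ExtSpace.shift]

lemma hasVelocity_shift (z h : ExtSpace ι N) : HasVelocity (fun ε => z.shift h ε) h 0 := by
  have key : ∀ u v : SF ι, HasSFVelocity (fun ε : ℝ => u + (ε : ℂ) • v) v 0 := fun u v => by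
    have := (HasSFVelocity.const u 0).add (HasSFVelocity.ofReal_smul v 0)
    rwa [zero_add] at this
  exact ⟨fun j => key _ _, fun i => ⟨key _ _, key _ _, key _ _, key _ _⟩⟩

/-- The gradient of the Hamiltonian is found by the chain rule from
`(X, u D_θ^{-1} v) = ⟨X_+ u, v⟩ = ⟨u, X_+^* v⟩`. -/
lemma isGradient_hamiltonianGradient {m n : ℕ} (hm : 1 ≤ m) {z : ExtSpace ι N}
    (hz : z.IsPoint m) {X : Op ι} (hX : IsCasimirGradient m n (backlund z).l X) :
    IsGradient m (hamiltonian m n) z (hamiltonianGradient X z) := by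
  refine ⟨⟨hX.1, fun i => ⟨hasParity_adjPos hX.1 (hz.2 i).2.2.1,
    hasParity_actPos hX.1 (hz.2 i).2.2.2, hasParity_actPos hX.1 (hz.2 i).1,
    hasParity_adjPos hX.1 (hz.2 i).2.1⟩⟩, fun h hh => ?_⟩
  have hpt : ∀ ε, (backlund (z.shift h ε)).IsPoint m := fun ε => (hz.shift hh ε).backlund
  have hvel := (hasVelocity_shift z h).backlund
  rw [shift_zero] at hvel
  have hop : HasOpVelocity (2 * m) (fun ε => (backlund (z.shift h ε)).l)
      (backlundDeriv z h).l 0 := by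
    refine ⟨fun ε => (isMonic_iff.1 (hpt ε).1).2.1, ?_, hvel.1⟩
    exact (hh.1.ordLE.weaken (by omega)).add (OrdLE.sum fun i _ =>
      (((ordLE_dyad _ _).add (ordLE_dyad _ _)).add
        ((ordLE_dyad _ _).add (ordLE_dyad _ _))).weaken (by omega))
  have key := hasVariation_gamma hm n (fun ε => (hpt ε).1) hop (X := X)
    (by rw [shift_zero]; exact hX)
  have e : form X (backlundDeriv z h).l =
      form (hamiltonianGradient X z).l h.l + fieldPair (hamiltonianGradient X z) h := by
    rw [← form_dyadsDeriv hX.1, form_eq, form_eq, form_eq, ← map_add]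
    change tr (X * (h.l + dyadsDeriv z h)) = tr (X * h.l + X * dyadsDeriv z h)
    rw [mul_add]
  rw [e] at key
  exact key

lemma _root_.SuperLax.HasVariation.unique {g : ℝ → Grass ι} {v w : Grass ι}
    (hv : HasVariation g v) (hw : HasVariation g w) : v = w := by
  rw [← sub_eq_zero, ← Module.forall_dual_apply_eq_zero_iff ℂ]
  intro φ
  rw [map_sub, (hv φ).unique (hw φ), sub_self]

lemma eq_of_pair_left [Infinite ι] (p : ℤ) {v w : SF ι}
    (h : ∀ u : SF ι, u.HasParity p → pair u v = pair u w) : v = w := by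
  have : (v - w).par = 0 := SF.eq_zero_of_berezin_mul p fun u hu => by
    have := h u hu
    rw [pair_eq, pair_eq, ← sub_eq_zero] at this
    rw [SF.par_sub, mul_sub]
    exact (SF.berezinL.map_sub _ _).trans this
  rw [← sub_eq_zero, ← SF.par_par (v - w), this, SF.par_zero]

/-- Nondegeneracy in the other argument; one of the parities is even, so the factors commute. -/
lemma eq_of_pair_right [Infinite ι] {p q : ℤ} (hpq : Even p ∨ Even q) {v w : SF ι}
    (hv : v.HasParity p) (hw : w.HasParity p)
    (h : ∀ u : SF ι, u.HasParity q → pair v u = pair w u) : v = w := by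
  have hx : ∀ u : SF ι, u.HasParity q → (v - w) * u = u * (v - w) := fun u hu => by
    rw [SF.hasParity_iff_eps] at hv hw hu
    rcases hpq with hp | hq
    · refine SF.even_comm ?_ u
      rw [SF.par_sub, hv, hw, eps_even hp, one_smul, one_smul]
    · rw [eps_even hq, one_smul] at hu
      exact (SF.even_comm hu _).symm
  have : v - w = 0 := SF.eq_zero_of_berezin_mul q fun u hu => by
    have h1 := h u hu
    rw [pair_eq, pair_eq, SF.hasParity_iff_eps.1 hu, mul_smul_comm, mul_smul_comm] at h1
    have h2 := congrArg (fun x => eps q • x) (sub_eq_zero.2 h1)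
    have h3 : ∀ x : SF ι, (eps q • x).berezin = eps q • x.berezin := fun x =>
      map_zsmul SF.berezinL _ x
    rw [h3, h3, ← smul_sub, smul_smul, eps_mul_self, one_smul, smul_zero] at h2
    rw [← hx u hu, sub_mul]
    exact (SF.berezinL.map_sub _ _).trans h2
  exact sub_eq_zero.1 this

lemma isVariation_zero (m : ℕ) : (0 : Op ι).IsVariation m :=
  ⟨fun j => hasParity_zero j, fun _ _ => rfl⟩

lemma single_hasParity {p : ℤ} {u : SF ι} (hu : u.HasParity p) (i j : Fin N) :
    ((Pi.single i u : Fin N → SF ι) j).HasParity p := by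
  rcases eq_or_ne j i with rfl | h
  · rwa [Pi.single_eq_same]
  · rw [Pi.single_eq_of_ne h]; exact hasParity_zero p

/-- Gradients are unique up to the part of their operator component of order less than `-2m`. -/
lemma IsGradient.unique [Infinite ι] {m : ℕ} {F : ExtSpace ι N → Grass ι} {z G G' : ExtSpace ι N}
    (hG : IsGradient m F z G) (hG' : IsGradient m F z G') :
    (∀ j : ℤ, -(2 * m) ≤ j → G.l.coeff j = G'.l.coeff j) ∧ G.f = G'.f ∧ G.Phis = G'.Phis ∧
      G.fs = G'.fs ∧ G.Phi = G'.Phi := by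
  have key : ∀ h : ExtSpace ι N, h.IsTangent m →
      form G.l h.l + fieldPair G h = form G'.l h.l + fieldPair G' h := fun h hh =>
    (hG.2 h hh).unique (hG'.2 h hh)
  have hz := hasParity_zero (ι := ι)
  have form_zero : ∀ X : Op ι, form X 0 = 0 := fun X => by rw [form_eq, mul_zero, map_zero]
  have single_pair : ∀ (i : Fin N) (u : SF ι) (g : Fin N → SF ι),
      ∑ j, pair ((Pi.single i u : Fin N → SF ι) j) (g j) = pair u (g i) := fun i u g => by
    rw [Finset.sum_eq_single i, Pi.single_eq_same]
    · intro j _ hj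
      rw [Pi.single_eq_of_ne hj, pair_zero_left]
    · simp
  have pair_single : ∀ (i : Fin N) (u : SF ι) (g : Fin N → SF ι),
      ∑ j, pair (g j) ((Pi.single i u : Fin N → SF ι) j) = pair (g i) u := fun i u g => by
    rw [Finset.sum_eq_single i, Pi.single_eq_same]
    · intro j _ hj
      rw [Pi.single_eq_of_ne hj, pair_zero_right]
    · simp
  refine ⟨fun j hj => coeff_eq_of_form_eq hG.1.1 hG'.1.1 (fun δ hδ => ?_) hj, funext fun i => ?_,
    funext fun i => ?_, funext fun i => ?_, funext fun i => ?_⟩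
  · have := key ⟨δ, 0, 0, 0, 0⟩ ⟨hδ, fun i => ⟨hz 0, hz 0, hz 1, hz 1⟩⟩
    simpa [fieldPair, pair_zero_left, pair_zero_right] using this
  · refine eq_of_pair_left 0 fun u hu => ?_
    have := key ⟨0, Pi.single i u, 0, 0, 0⟩ ⟨isVariation_zero m, fun j =>
      ⟨single_hasParity hu i j, hz 0, hz 1, hz 1⟩⟩
    simpa [fieldPair, pair_zero_left, pair_zero_right, form_zero, single_pair] using this
  · refine eq_of_pair_right (Or.inr Even.zero) (hG.1.2 i).2.1 (hG'.1.2 i).2.1 fun u hu => ?_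
    have := key ⟨0, 0, Pi.single i u, 0, 0⟩ ⟨isVariation_zero m, fun j =>
      ⟨hz 0, single_hasParity hu i j, hz 1, hz 1⟩⟩
    simpa [fieldPair, pair_zero_left, pair_zero_right, form_zero, pair_single] using this
  · refine eq_of_pair_right (q := 1) (Or.inl Even.zero) (hG.1.2 i).2.2.1 (hG'.1.2 i).2.2.1 fun u hu => ?_
    have := key ⟨0, 0, 0, Pi.single i u, 0⟩ ⟨isVariation_zero m, fun j =>
      ⟨hz 0, hz 0, single_hasParity hu i j, hz 1⟩⟩
    simpa [fieldPair, pair_zero_left, pair_zero_right, form_zero, pair_single] using this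
  · refine eq_of_pair_left 1 fun u hu => ?_
    have := key ⟨0, 0, 0, 0, Pi.single i u⟩ ⟨isVariation_zero m, fun j =>
      ⟨hz 0, hz 0, hz 1, single_hasParity hu i j⟩⟩
    simpa [fieldPair, pair_zero_left, pair_zero_right, form_zero, single_pair] using this

/-- The Hamiltonian vector field is single-valued, and given by the canonical gradient. -/
lemma isHamiltonianVector_iff [Infinite ι] {m n : ℕ} (hm : 1 ≤ m) {z v : ExtSpace ι N}
    (hz : z.IsPoint m) {X : Op ι} (hX : IsCasimirGradient m n (backlund z).l X) :
    IsHamiltonianVector m (hamiltonian m n) z v ↔ v = -poissonL z (hamiltonianGradient X z) := by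
  have hG := isGradient_hamiltonianGradient hm hz hX
  refine ⟨?_, fun h => ⟨_, hG, h⟩⟩
  rintro ⟨G', hG', rfl⟩
  obtain ⟨h0, h1, h2, h3, h4⟩ := hG'.unique hG
  rw [poissonL, poissonL, Theta_congr hz.1 h0, h1, h2, h3, h4]

lemma isLaxVector_iff [Infinite ι] {m n : ℕ} (hm : 1 ≤ m) {z w : ExtSpace ι N}
    (hz : z.IsPoint m) {X : Op ι} (hX : IsCasimirGradient m n z.l X) :
    IsLaxVector m n z w ↔ w = laxVector X z := by
  have hG := hX.isOpGradient hm hz.1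
  refine ⟨?_, fun h => ⟨_, hG, h⟩⟩
  rintro ⟨Y, hY, rfl⟩
  have hpos : Y.pos = X.pos := by
    ext1 j
    rw [coeff_pos, coeff_pos]
    split_ifs with hj
    · exact coeff_eq_of_form_eq hY.1 hG.1
        (fun δ hδ => (hY.2 δ hδ).unique (hG.2 δ hδ)) (m := m) (by omega)
    · rfl
  rw [laxVector, hpos]
  simp only [fun u => actPos_congr hpos u, fun u => adjPos_congr hpos u]

lemma isTangent_neg_poissonL {m n : ℕ} {z : ExtSpace ι N} (hz : z.IsPoint m) {X : Op ι}
    (hX : IsCasimirGradient m n (backlund z).l X) :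
    (-poissonL z (hamiltonianGradient X z)).IsTangent m := by
  refine ⟨isVariation_neg_Theta hz.1 hX.1, ?_⟩
  have h := hasFieldParities_laxVector hX.1 hz.2
  intro i
  have h1 : ∀ u : SF ι, - -u = u := neg_neg
  refine ⟨?_, (h i).2.1, (h i).2.2.1, ?_⟩
  · change SF.HasParity 0 (- -(X.actPos (z.f i)))
    rw [h1]; exact (h i).1
  · change SF.HasParity 1 (- -(X.actPos (z.Phi i)))
    rw [h1]; exact (h i).2.2.2

lemma isTangent_laxVector {m n : ℕ} (hm : 1 ≤ m) {z : ExtSpace ι N} (hz : z.IsPoint m)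
    {X : Op ι} (hX : IsCasimirGradient m n z.l X) : (laxVector X z).IsTangent m := by
  refine ⟨isVariation_iff.2 ⟨hX.1.pos.comm hz.1.1, ?_⟩, hasFieldParities_laxVector hX.1 hz.2⟩
  have h0 := hX.comm_eq_zero hm hz.1
  -- since `X` commutes with `l`, `[X_+, l] = [l, X_-]` has order less than `2m`
  have e : comm X.pos z.l = comm z.l X.neg := by
    have h1 : comm z.l X = comm z.l X.neg - comm X.pos z.l := by
      nth_rewrite 1 [← pos_add_neg X]
      unfold Op.comm
      noncomm_ring
    rw [h0] at h1
    exact (sub_eq_zero.1 h1.symm).symm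
  change OrdLE _ (comm X.pos z.l)
  rw [e]
  exact ((isMonic_iff.1 hz.1).2.1.comm (ordLE_neg X)).weaken (by omega)

/-- The integral part of `[X_+, ∑ (f D_θ^{-1} f^* + Φ D_θ^{-1} Φ^*)]` is the derivative of the sum
along the flow of eigenfunctions and adjoint eigenfunctions. -/
lemma comm_pos_dyads {X : Op ι} (hX : X.IsEven) (z : ExtSpace ι N) :
    comm X.pos (dyads z) - (comm X.pos (dyads z)).pos = dyadsDeriv z (laxVector X z) := by
  have hdiff : IsDiff (comm X.pos (dyads z) - dyadsDeriv z (laxVector X z)) := by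
    have e : comm X.pos (dyads z) - dyadsDeriv z (laxVector X z) = ∑ i,
        (((X.pos * dyad (z.f i) (z.fs i) - dyad (X.actPos (z.f i)) (z.fs i)) -
          (dyad (z.f i) (z.fs i) * X.pos - dyad (z.f i) (X.adjPos (z.fs i)))) +
        ((X.pos * dyad (z.Phi i) (z.Phis i) - dyad (X.actPos (z.Phi i)) (z.Phis i)) -
          (dyad (z.Phi i) (z.Phis i) * X.pos - dyad (z.Phi i) (X.adjPos (z.Phis i))))) := by
      rw [Op.comm, dyads, dyadsDeriv, Finset.mul_sum, Finset.sum_mul, ← Finset.sum_sub_distrib,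
        ← Finset.sum_sub_distrib]
      refine Finset.sum_congr rfl fun i _ => ?_
      simp only [laxVector, dyad_neg_right, mul_add, add_mul]
      abel
    rw [e]
    exact IsDiff.sum fun i _ =>
      ((isDiff_pos_mul_dyad _ _ _).sub (isDiff_dyad_mul_pos hX _ _)).add
        ((isDiff_pos_mul_dyad _ _ _).sub (isDiff_dyad_mul_pos hX _ _))
  have hord : OrdLE (-1) (dyadsDeriv z (laxVector X z)) := OrdLE.sum fun i _ =>
    ((ordLE_dyad _ _).add (ordLE_dyad _ _)).add ((ordLE_dyad _ _).add (ordLE_dyad _ _))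
  have h1 : comm X.pos (dyads z) = (comm X.pos (dyads z) - dyadsDeriv z (laxVector X z)) +
      dyadsDeriv z (laxVector X z) := (sub_add_cancel _ _).symm
  have h2 : (comm X.pos (dyads z)).pos =
      comm X.pos (dyads z) - dyadsDeriv z (laxVector X z) := by
    rw [h1, Op.pos_add, hdiff.pos_eq, hord.pos_eq le_rfl, add_zero, ← h1]
  rw [h2, sub_sub_cancel]

/-- The Bäcklund transformation carries the Hamiltonian vector field to the Lax vector field. -/
lemma backlundDeriv_hamiltonian {m n : ℕ} (hm : 1 ≤ m) {z : ExtSpace ι N} (hz : z.IsPoint m)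
    {X : Op ι} (hX : IsCasimirGradient m n (backlund z).l X) :
    backlundDeriv z (-poissonL z (hamiltonianGradient X z)) = laxVector X (backlund z) := by
  have h0 : comm (z.l + dyads z) X = 0 := hX.comm_eq_zero hm hz.backlund.1
  have hfields : backlundDeriv z (-poissonL z (hamiltonianGradient X z)) =
      ⟨-Theta z.l X + dyadsDeriv z (laxVector X z), fun i => X.actPos (z.f i),
        fun i => -X.adjPos (z.Phis i), fun i => -X.adjPos (z.fs i),
        fun i => X.actPos (z.Phi i)⟩ := by
    have h1 : ∀ u : Fin N → SF ι, - -u = u := neg_neg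
    have e : -poissonL z (hamiltonianGradient X z) = ⟨-Theta z.l X, (laxVector X z).f,
        (laxVector X z).Phis, (laxVector X z).fs, (laxVector X z).Phi⟩ := by
      ext1
      · rfl
      · exact h1 _
      · rfl
      · rfl
      · exact h1 _
    rw [e]
    rfl
  have hcomm : comm X z.l = -comm X (dyads z) := by
    rw [← sub_eq_zero, ← neg_eq_zero, ← h0]
    unfold Op.comm
    noncomm_ring
  have hpos : (comm X (dyads z)).pos = (comm X.pos (dyads z)).pos := by
    have e : comm X (dyads z) = comm X.pos (dyads z) + comm X.neg (dyads z) := by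
      nth_rewrite 1 [← pos_add_neg X]
      unfold Op.comm
      noncomm_ring
    rw [e, Op.pos_add, ((ordLE_neg X).comm (ordLE_dyads z)).pos_eq (by norm_num), add_zero]
  have hl : -Theta z.l X + dyadsDeriv z (laxVector X z) = comm X.pos (z.l + dyads z) := by
    rw [neg_Theta, ← comm_pos_dyads hX.1, hcomm, Op.pos_neg, hpos]
    unfold Op.comm
    noncomm_ring
  rw [hfields, hl]
  rfl

/-- `J` inverts the odd symplectic form. -/
lemma omega_poissonL (z : ExtSpace ι N) {G h : ExtSpace ι N} (hG : G.IsCovector)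
    (hh : h.HasFieldParities) : omega (poissonL z G) h = fieldPair G h := by
  unfold omega fieldPair
  refine Finset.sum_congr rfl fun i _ => ?_
  obtain ⟨g1, -, -, g4⟩ := hG.2 i
  obtain ⟨-, h2, h3, -⟩ := hh i
  rw [SF.hasParity_iff_eps] at g1 g4 h2 h3
  rw [eps_odd (by decide), neg_one_smul] at g1 h3
  rw [eps_even (by decide), one_smul] at g4 h2
  rw [pair_eq, pair_eq, pair_eq, pair_eq, g1, h2, h3, g4]
  change SF.berezinL ((-G.fs i * h.fs i - h.f i * G.f i) -
    (-G.Phis i * h.Phis i - h.Phi i * G.Phi i)) = _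
  simp only [← SF.berezinL_apply, ← map_add]
  congr 1
  noncomm_ring

end ExtSpace

end

end SuperLax

open SuperLax
theorem theorem1 {ι : Type*} [Infinite ι] (N m n : ℕ) (hm : 1 ≤ m) :
    -- the Lie-Poisson structure `Θ` comes from the Lie bracket `[·, ·]_R`
    (∀ a b c : Op ι, Op.commR a (Op.commR b c) + Op.commR b (Op.commR c a) +
      Op.commR c (Op.commR a b) = 0) ∧
    (∀ l a b : Op ι, l.IsEven → a.IsEven → b.IsEven →
      Op.form l (Op.commR a b) = Op.form (ExtSpace.Theta l a) b) ∧
    -- the structure `J` is the inverse of the odd symplectic form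
    (∀ z G h : ExtSpace ι N, G.IsCovector → h.HasFieldParities →
      ExtSpace.omega (ExtSpace.poissonL z G) h = ExtSpace.fieldPair G h) ∧
    -- the functionals `γ_n` are well defined and are Casimir functionals
    (∀ l : Op ι, l.IsMonic m → ∃! P, Op.IsRoot m l P) ∧
    (∀ l : Op ι, l.IsMonic m →
      ∃ X, IsOpGradient m (Op.gamma m n) l X ∧ Op.comm l X = 0) ∧
    -- both dynamical systems are well-defined vector fields on the extended phase space
    (∀ z : ExtSpace ι N, z.IsPoint m → ∃! v, ExtSpace.IsHamiltonianVector m (ExtSpace.hamiltonian m n) z v) ∧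
    (∀ z v : ExtSpace ι N, z.IsPoint m → ExtSpace.IsHamiltonianVector m (ExtSpace.hamiltonian m n) z v →
      v.IsTangent m) ∧
    (∀ z : ExtSpace ι N, z.IsPoint m → ∃! w, ExtSpace.IsLaxVector m n z w) ∧
    (∀ z w : ExtSpace ι N, z.IsPoint m → ExtSpace.IsLaxVector m n z w → w.IsTangent m) ∧
    -- the explicit form of the Hamiltonian system
    (∀ z v : ExtSpace ι N, z.IsPoint m →
      (ExtSpace.IsHamiltonianVector m (ExtSpace.hamiltonian m n) z v ↔
        ∃ G : ExtSpace ι N, ExtSpace.IsGradient m (ExtSpace.hamiltonian m n) z G ∧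
          v.l = Op.comm G.l.pos z.l - (Op.comm G.l z.l).pos ∧
          v.f = G.fs ∧ v.Phis = -G.Phi ∧ v.fs = -G.f ∧ v.Phi = G.Phis)) ∧
    -- the Bäcklund transformation is a bijection of the extended phase space, and it carries
    -- solutions of the Hamiltonian system exactly to solutions of the extended Lax system
    Set.BijOn (ExtSpace.backlund (ι := ι) (N := N)) {z | z.IsPoint m} {z | z.IsPoint m} ∧
    (∀ (c : ℝ → ExtSpace ι N) (t : ℝ), (∀ s, (c s).IsPoint m) →
      ((∃ v, ExtSpace.IsHamiltonianVector m (ExtSpace.hamiltonian m n) (c t) v ∧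
          ExtSpace.HasVelocity c v t) ↔
        (∃ w, ExtSpace.IsLaxVector m n (ExtSpace.backlund (c t)) w ∧
          ExtSpace.HasVelocity (fun s => ExtSpace.backlund (c s)) w t))) := by
  have casimir : ∀ z : ExtSpace ι N, z.IsPoint m → ∃ X, Op.IsCasimirGradient m n z.l X :=
    fun z hz => Op.exists_isCasimirGradient hm n hz.1
  refine ⟨Op.commR_jacobi, fun l a b _ ha _ => Op.form_commR ha,
    fun z G h hG hh => ExtSpace.omega_poissonL z hG hh, fun l hl => Op.existsUnique_isRoot hm hl,
    fun l hl => ?_, fun z hz => ?_, fun z v hz hv => ?_, fun z hz => ?_, fun z w hz hw => ?_,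
    fun z v hz => ?_, ExtSpace.backlund_bijOn m, fun c t hc => ?_⟩
  · obtain ⟨X, hX⟩ := Op.exists_isCasimirGradient hm n hl
    exact ⟨X, hX.isOpGradient hm hl, hX.comm_eq_zero hm hl⟩
  · obtain ⟨X, hX⟩ := casimir _ hz.backlund
    exact ⟨_, (ExtSpace.isHamiltonianVector_iff hm hz hX).2 rfl,
      fun v hv => (ExtSpace.isHamiltonianVector_iff hm hz hX).1 hv⟩
  · obtain ⟨X, hX⟩ := casimir _ hz.backlund
    rw [(ExtSpace.isHamiltonianVector_iff hm hz hX).1 hv]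
    exact ExtSpace.isTangent_neg_poissonL hz hX
  · obtain ⟨X, hX⟩ := casimir _ hz
    exact ⟨_, (ExtSpace.isLaxVector_iff hm hz hX).2 rfl,
      fun v hv => (ExtSpace.isLaxVector_iff hm hz hX).1 hv⟩
  · obtain ⟨X, hX⟩ := casimir _ hz
    rw [(ExtSpace.isLaxVector_iff hm hz hX).1 hw]
    exact ExtSpace.isTangent_laxVector hm hz hX
  · refine exists_congr fun G => and_congr_right fun _ => ?_
    have h1 : ∀ u : Fin N → SF ι, - -u = u := neg_neg
    have e : -ExtSpace.poissonL z G =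
        ⟨Op.comm G.l.pos z.l - (Op.comm G.l z.l).pos, G.fs, -G.Phi, -G.f, G.Phis⟩ := by
      ext1
      · exact ExtSpace.neg_Theta z.l G.l
      · exact h1 _
      · rfl
      · rfl
      · exact h1 _
    rw [e, ExtSpace.ext_iff]
  · obtain ⟨X, hX⟩ := casimir _ (hc t).backlund
    have key := ExtSpace.backlundDeriv_hamiltonian hm (hc t) hX
    constructor
    · rintro ⟨v, hv, hcv⟩
      rw [ExtSpace.isHamiltonianVector_iff hm (hc t) hX] at hv
      subst hv
      exact ⟨_, (ExtSpace.isLaxVector_iff hm (hc t).backlund hX).2 rfl, key ▸ hcv.backlund⟩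
    · rintro ⟨w, hw, hcw⟩
      rw [ExtSpace.isLaxVector_iff hm (hc t).backlund hX] at hw
      subst hw
      rw [← key] at hcw
      exact ⟨_, (ExtSpace.isHamiltonianVector_iff hm (hc t) hX).2 rfl, hcw.of_backlund⟩
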